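/- Let $\Bbbk$ be a field of characteristic zero, let $e,h,f$ be the standard basis of $\mathfrak{sl}_2$, and let $\mathfrak I=\mathfrak b_++z\,\mathfrak{sl}_2[z]$ be the Iwahori subalgebra, spanned by $ez^a,hz^a\ (a\ge 0)$ and $fz^a\ (a>0)$. Let $\mathfrak I[\xi]=\mathfrak I\oplus\mathfrak I\xi$, where $\xi$ is odd and $\xi^2=0$; it is bigraded by $z$-degree and $\xi$-degree. Let $\omega$ be the fundamental weight. For $m\in\mathbb Z$ the local nonsymmetric Macdonald module $\mathsf{EM}^{loc}_{m\omega}$ is the cyclic $\mathfrak I[\xi]$-module with generator $w=w_{m\omega}$, placed in $z$- and $\xi$-degree $0$, and relations $hw=mw$, $h\xi w=0$, $hz^aw=0$ for $a>0$, together with * $ez^a\xi^bw=0$ for $a\ge 0$, $b\in\{0,1\}$, and $(fz)^mw=0$, if $m>0$; * $fz^a\xi^bw=0$ for $a>0$, $b\in\{0,1\}$, and $e^{-m+1}w=0$, if $m\le 0$. Nonsymmetric Macdonald polynomials: on $\mathbb Q(q,t)[x^{\pm1}]$ put $s_1(x^m)=x^{-m}$, $s_0(x^m)=q^mx^{-m}$,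 $T_1=ts_1+\frac{t-1}{x^2-1}(s_1-1)$, $T_0=ts_0+\frac{t-1}{qx^{-2}-1}(s_0-1)$ and $Y=T_0T_1$. Write $n\prec m$ if $|n|<|m|$ and $m-n$ is even, or if $|n|=|m|$ and $n>m$. Then $E_{m\omega}$ is the eigenvector of $Y$ of the form $x^m+\sum_{n\prec m}c_nx^n$. Its integral form is $\widetilde E_{m\omega}=\prod_{i=1}^{r}(1-q^it)\,E_{m\omega}$, where $r=-m$ if $m\le 0$ and $r=m-1$ if $m>0$. Theorem. 1. For every $m\in\mathbb Z$, $\mathsf{EM}^{loc}_{m\omega}$ is the direct sum of its components of weight $n\omega$, $z$-degree $a$ and $\xi$-degree $b$ ($n\in\mathbb Z$, $a,b\ge 0$), the polynomial $E_{m\omega}$ exists and is unique, and $$\sum_{n,a,b}q^a(-t)^b\dim\big(\mathsf{EM}^{loc}_{m\omega}\big)_{n,a,b}\,x^n=\widetilde E_{m\omega}(x,q,t).$$ 2. For every $k\ge 0$, $\dim\mathsf{EM}^{loc}_{-k\omega}=\dim\mathsf{EM}^{loc}_{(k+1)\omega}=4^k$. 3. Let $X^{s\omega}$ denote the tensor product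 with the one-dimensional module of weight $s\omega$, and let $\mathbf q,\mathbf v$ denote the shifts that raise the $z$-degree and the $\xi$-degree by one. For $k\ge 0$ let $w_1=w$, $w_2=e^{k+1}w_1$, $w_3=h\xi w_2$, $w_4=(fz)^{k+1}w_3$ in $\mathsf{EM}^{loc}_{-(k+1)\omega}$, and let $D_i=U(\mathfrak I[\xi])w_i$. Then $\mathsf{EM}^{loc}_{-(k+1)\omega}=D_1\supseteq D_2\supseteq D_3\supseteq D_4$, and there are isomorphisms of bigraded $\mathfrak I[\xi]$-modules, sending cyclic vectors to the classes of the $w_i$: $$X^{-\omega}\mathsf{EM}^{loc}_{-k\omega}\cong D_1/D_2,\quad \mathsf{EM}^{loc}_{(k+1)\omega}\cong D_2/D_3,\quad \mathbf v\,\mathsf{EM}^{loc}_{(k+1)\omega}\cong D_3/D_4,\quad X^{-\omega}\mathbf q^{k+1}\mathbf v\,\mathsf{EM}^{loc}_{-k\omega}\cong D_4.$$ 4. For $k\ge 0$ let $w_1=w$, $w_2=(fz)^{k+1}w_1$, $w_3=h\xi w_2$, $w_4=e^{k+1}w_3$ in $\mathsf{EM}^{loc}_{(k+2)\omega}$, and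 let $D_i=U(\mathfrak I[\xi])w_i$. Then $\mathsf{EM}^{loc}_{(k+2)\omega}=D_1\supseteq D_2\supseteq D_3\supseteq D_4$, and there are isomorphisms of bigraded $\mathfrak I[\xi]$-modules, sending cyclic vectors to the classes of the $w_i$: $$X^{\omega}\mathsf{EM}^{loc}_{(k+1)\omega}\cong D_1/D_2,\quad \mathbf q^{k+1}\mathsf{EM}^{loc}_{-k\omega}\cong D_2/D_3,\quad \mathbf q^{k+1}\mathbf v\,\mathsf{EM}^{loc}_{-k\omega}\cong D_3/D_4,\quad X^{\omega}\mathbf q^{k+1}\mathbf v\,\mathsf{EM}^{loc}_{(k+1)\omega}\cong D_4.$$ -/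

import Mathlib

noncomputable section

namespace MacdonaldSL2

open scoped Polynomial

/-! ### The Lie superalgebra `L[ξ] = L ⊕ Lξ` and its enveloping algebra -/

section Envelope

universe u v

variable (R : Type u) (L : Type v) [CommRing R] [LieRing L] [LieAlgebra R L]

/-- The defining relations of the enveloping algebra of the Lie superalgebra
`L[ξ] = L ⊗ R[ξ]`, where `ξ` is odd and `ξ² = 0`.  A pair `(x, y) : L × L` stands for `x + yξ`.
The even elements `x` and the odd elements `xξ` satisfy
`[x, y] = xy - yx`, `[x, yξ] = [x, y]ξ` and `[xξ, yξ] = xξ yξ + yξ xξ = 0`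
(`2` is invertible in all uses). -/
inductive SuperCurrentRel : TensorAlgebra R (L × L) → TensorAlgebra R (L × L) → Prop
  | even_even (x y : L) : SuperCurrentRel
      (TensorAlgebra.ι R (x, 0) * TensorAlgebra.ι R (y, 0))
      (TensorAlgebra.ι R (y, 0) * TensorAlgebra.ι R (x, 0) + TensorAlgebra.ι R (⁅x, y⁆, 0))
  | even_odd (x y : L) : SuperCurrentRel
      (TensorAlgebra.ι R (x, 0) * TensorAlgebra.ι R (0, y))
      (TensorAlgebra.ι R (0, y) * TensorAlgebra.ι R (x, 0) + TensorAlgebra.ι R (0, ⁅x, y⁆))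
  | odd_odd (x y : L) : SuperCurrentRel
      (TensorAlgebra.ι R (0, x) * TensorAlgebra.ι R (0, y)
        + TensorAlgebra.ι R (0, y) * TensorAlgebra.ι R (0, x)) 0

/-- The universal enveloping algebra `U(L[ξ])`. -/
def SuperCurrentEnv : Type (max u v) := RingQuot (SuperCurrentRel R L)

instance : Ring (SuperCurrentEnv R L) :=
  inferInstanceAs (Ring (RingQuot (SuperCurrentRel R L)))

instance : Algebra R (SuperCurrentEnv R L) :=
  inferInstanceAs (Algebra R (RingQuot (SuperCurrentRel R L)))

variable {L}

/-- The even element `x` of `L[ξ]`, as an element of `U(L[ξ])`. -/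
def ev (x : L) : SuperCurrentEnv R L :=
  RingQuot.mkAlgHom R (SuperCurrentRel R L) (TensorAlgebra.ι R (x, 0))

/-- The odd element `xξ` of `L[ξ]`, as an element of `U(L[ξ])`. -/
def od (x : L) : SuperCurrentEnv R L :=
  RingQuot.mkAlgHom R (SuperCurrentRel R L) (TensorAlgebra.ι R (0, x))

end Envelope

/-! ### The Iwahori subalgebra of `sl₂[z]` -/

section Iwahori

variable (k : Type*) [Field k]

attribute [local instance 100] LieRing.ofAssociativeRing

/-- The Iwahori subalgebra `𝔟₊ + z sl₂[z]`: the traceless `2 × 2` matrices over `k[z]` that are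
upper triangular at `z = 0`. -/
def iwahori : LieSubalgebra k (Matrix (Fin 2) (Fin 2) k[X]) where
  carrier := {A | A.trace = 0 ∧ Polynomial.X ∣ A 1 0}
  add_mem' := by
    rintro A B ⟨hA, hA'⟩ ⟨hB, hB'⟩
    exact ⟨by rw [Matrix.trace_add, hA, hB, add_zero], dvd_add hA' hB'⟩
  zero_mem' := ⟨by simp, by simp⟩
  smul_mem' := by
    rintro c A ⟨hA, hA'⟩
    refine ⟨by rw [Matrix.trace_smul, hA, smul_zero], ?_⟩
    rw [Matrix.smul_apply, Polynomial.smul_eq_C_mul]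
    exact Dvd.dvd.mul_left hA' _
  lie_mem' := by
    rintro A B ⟨-, hA⟩ ⟨-, hB⟩
    refine ⟨?_, ?_⟩
    · rw [Ring.lie_def, Matrix.trace_sub, Matrix.trace_mul_comm, sub_self]
    · rw [Ring.lie_def, Matrix.sub_apply, Matrix.mul_apply, Matrix.mul_apply, Fin.sum_univ_two,
        Fin.sum_univ_two]
      exact dvd_sub (dvd_add (hA.mul_right _) (hB.mul_left _))
        (dvd_add (hB.mul_right _) (hA.mul_left _))

/-- `e z^a`. -/
def eZ (a : ℕ) : iwahori k :=
  ⟨!![0, Polynomial.X ^ a; 0, 0], by simp [Matrix.trace_fin_two], by simp⟩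

/-- `h z^a`. -/
def hZ (a : ℕ) : iwahori k :=
  ⟨!![Polynomial.X ^ a, 0; 0, -Polynomial.X ^ a], by simp [Matrix.trace_fin_two], by simp⟩

/-- `f z^(a+1)`; the exponent of `z` is shifted by one because `f` itself is not in the Iwahori
subalgebra. -/
def fZ (a : ℕ) : iwahori k :=
  ⟨!![0, 0; Polynomial.X ^ (a + 1), 0], by simp [Matrix.trace_fin_two],
    by simp [pow_succ]⟩

/-- The character of the Iwahori algebra that sends `h` to `1` and `e z^a`, `f z^(a+1)`,
`h z^(a+1)` to `0`. -/
def hCoeff (x : iwahori k) : k := (x.1 0 0).coeff 0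

/-- The element `x` of the Iwahori algebra is homogeneous of `z`-degree `a`. -/
def IsHomogeneousZ (a : ℕ) (x : iwahori k) : Prop :=
  ∀ i j, ∃ c : k, x.1 i j = Polynomial.monomial a c

/-- `U(𝕴[ξ])` for the Iwahori algebra `𝕴` of `sl₂`. -/
abbrev U := SuperCurrentEnv k (iwahori k)

variable {k} in
/-- Products of homogeneous elements of `𝕴[ξ]`, with their total `z`-degree `a` and `ξ`-degree `b`
(`z` has degree `(1, 0)` and `ξ` has degree `(0, 1)`). -/
inductive IsBihomogeneous : ℕ → ℕ → U k → Prop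
  | one : IsBihomogeneous 0 0 1
  | ev_mul {a b c : ℕ} {x : iwahori k} {y : U k} :
      IsHomogeneousZ k c x → IsBihomogeneous a b y → IsBihomogeneous (c + a) b (ev k x * y)
  | od_mul {a b c : ℕ} {x : iwahori k} {y : U k} :
      IsHomogeneousZ k c x → IsBihomogeneous a b y → IsBihomogeneous (c + a) (b + 1) (od k x * y)

/-- The component of `U(𝕴[ξ])` of `z`-degree `a` and `ξ`-degree `b`. -/
def gradedU (a b : ℕ) : Submodule k (U k) :=
  Submodule.span k {y | IsBihomogeneous a b y}

end Iwahori

/-! ### The local nonsymmetric Macdonald modules for `sl₂` -/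

section Modules

variable (k : Type*) [Field k]

/-- The elements of `U(𝕴[ξ])` that annihilate the cyclic vector of the global nonsymmetric
Macdonald module of weight `mω`. -/
def globalRelations (m : ℤ) : Set (U k) :=
  {ev k (hZ k 0) - algebraMap k (U k) (m : k), od k (hZ k 0)} ∪
    if 0 < m then
      (Set.range fun a => ev k (eZ k a)) ∪ (Set.range fun a => od k (eZ k a)) ∪
        {ev k (fZ k 0) ^ m.toNat}
    else
      (Set.range fun a => ev k (fZ k a)) ∪ (Set.range fun a => od k (fZ k a)) ∪
        {ev k (eZ k 0) ^ ((-m).toNat + 1)}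

/-- The relations of the local module: those of the global one, and `h z^a w = 0` for `a > 0`. -/
def localRelations (m : ℤ) : Set (U k) :=
  globalRelations k m ∪ Set.range fun a => ev k (hZ k (a + 1))

/-- The local nonsymmetric Macdonald module of weight `mω`: the quotient of `U(𝕴[ξ])` by the left
ideal generated by the relations. -/
abbrev EMloc (m : ℤ) : Type _ := U k ⧸ Submodule.span (U k) (localRelations k m)

/-- The cyclic vector of the local nonsymmetric Macdonald module. -/
def gen (m : ℤ) : EMloc k m := Submodule.Quotient.mk 1

/-- The component of `z`-degree `a` and `ξ`-degree `b` (the cyclic vector has degree `(0, 0)`). -/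
def gradedEM (m : ℤ) (a b : ℕ) : Submodule k (EMloc k m) :=
  (gradedU k a b).map
    ((Submodule.span (U k) (localRelations k m)).mkQ.restrictScalars k)

/-- The subspace of vectors of `h`-weight `n` (that is, weight `nω`). -/
def weightEM (m n : ℤ) : Submodule k (EMloc k m) :=
  Module.End.eigenspace (Algebra.lsmul k k (EMloc k m) (ev k (hZ k 0))) (n : k)

/-- The component of weight `nω`, `z`-degree `a` and `ξ`-degree `b`, with `d = (n, a, b)`. -/
def pieceEM (m : ℤ) (d : ℤ × ℕ × ℕ) : Submodule k (EMloc k m) :=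
  weightEM k m d.1 ⊓ gradedEM k m d.2.1 d.2.2

/-- The vectors `w₁ = w`, `w₂ = a^r w₁`, `w₃ = hξ w₂`, `w₄ = b^r w₃`, where `w` is the cyclic
vector. -/
def filtVec (m : ℤ) (a b : iwahori k) (r : ℕ) : Fin 4 → EMloc k m :=
  ![gen k m,
    ev k a ^ r • gen k m,
    od k (hZ k 0) • ev k a ^ r • gen k m,
    ev k b ^ r • od k (hZ k 0) • ev k a ^ r • gen k m]

/-- The submodules generated by the vectors of `filtVec`. -/
def filt (m : ℤ) (a b : iwahori k) (r : ℕ) (i : Fin 4) : Submodule (U k) (EMloc k m) :=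
  Submodule.span (U k) {filtVec k m a b r i}

variable {k} in
/-- The component of bidegree `(a, b)` of a subquotient `P / Q` of a Macdonald module. -/
def gradedSubquotient {m : ℤ} (P Q : Submodule (U k) (EMloc k m)) (a b : ℕ) :
    Submodule k (P ⧸ Q.submoduleOf P) :=
  ((gradedEM k m a b).comap (P.subtype.restrictScalars k)).map
    ((Q.submoduleOf P).mkQ.restrictScalars k)

variable {k} in
/-- The subquotient `P / Q` is isomorphic to the shift `X^{sω} q^A v^B EM^loc_{mω}` by an
isomorphism of bigraded modules that sends the cyclic vector to the class of `v ∈ P`.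
Here `X^{sω}` is the tensor product with the one-dimensional module of weight `sω`, on which
`h` acts by `s` and `e z^a`, `f z^(a+1)`, `h z^(a+1)` and all odd elements act by zero; `q^A` and
`v^B` raise the `z`-degree by `A` and the `ξ`-degree by `B`. -/
def IsShiftedEM (m s : ℤ) (A B : ℕ) {m' : ℤ} (P Q : Submodule (U k) (EMloc k m'))
    (v : EMloc k m') : Prop :=
  ∃ φ : EMloc k m ≃ₗ[k] (P ⧸ Q.submoduleOf P),
    (∃ hv : v ∈ P, φ (gen k m) = Submodule.Quotient.mk ⟨v, hv⟩) ∧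
    (∀ (x : iwahori k) (y : EMloc k m),
      ev k x • φ y = φ (ev k x • y) + ((s : k) * hCoeff k x) • φ y) ∧
    (∀ (x : iwahori k) (y : EMloc k m), od k x • φ y = φ (od k x • y)) ∧
    (∀ a b : ℕ, (gradedEM k m a b).map φ.toLinearMap = gradedSubquotient P Q (a + A) (b + B))

end Modules

/-! ### Nonsymmetric Macdonald polynomials of type `A₁` -/

section Macdonald

open LaurentPolynomial

/-- The field `ℚ(q, t)`. -/
def Kqt : Type := FractionRing (MvPolynomial (Fin 2) ℚ)

instance : Field Kqt := inferInstanceAs (Field (FractionRing (MvPolynomial (Fin 2) ℚ)))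

instance : Algebra (MvPolynomial (Fin 2) ℚ) Kqt :=
  inferInstanceAs (Algebra (MvPolynomial (Fin 2) ℚ) (FractionRing (MvPolynomial (Fin 2) ℚ)))

instance : IsFractionRing (MvPolynomial (Fin 2) ℚ) Kqt :=
  inferInstanceAs
    (IsFractionRing (MvPolynomial (Fin 2) ℚ) (FractionRing (MvPolynomial (Fin 2) ℚ)))

/-- The parameter `q`. -/
def qq : Kqt := algebraMap (MvPolynomial (Fin 2) ℚ) Kqt (MvPolynomial.X 0)

/-- The parameter `t`. -/
def tt : Kqt := algebraMap (MvPolynomial (Fin 2) ℚ) Kqt (MvPolynomial.X 1)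

/-- The `ℚ(q, t)`-linear operator on Laurent polynomials in `x` that sends `x^m` to `g m`;
the monomial `x^m = T m` stands for `e^{mω}`. -/
def linExt (g : ℤ → LaurentPolynomial Kqt) : LaurentPolynomial Kqt →ₗ[Kqt] LaurentPolynomial Kqt :=
  Finsupp.linearCombination Kqt g ∘ₗ (AddMonoidAlgebra.coeffLinearEquiv Kqt).toLinearMap

theorem linExt_T (g : ℤ → LaurentPolynomial Kqt) (m : ℤ) : linExt g (T m) = g m := by
  have : (AddMonoidAlgebra.coeffLinearEquiv Kqt) (T m : LaurentPolynomial Kqt)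
      = Finsupp.single m 1 := rfl
  simp [linExt, this]

theorem linMap_ext {f g : LaurentPolynomial Kqt →ₗ[Kqt] LaurentPolynomial Kqt}
    (h : ∀ m : ℤ, f (T m) = g (T m)) : f = g := by
  apply LinearMap.ext
  intro p
  induction p using LaurentPolynomial.induction_on' with
  | add p r hp hr => rw [map_add, map_add, hp, hr]
  | C_mul_T n a => rw [← LaurentPolynomial.smul_eq_C_mul, map_smul, map_smul, h]

/-- The reflection `s₁`: `x^m ↦ x^{-m}`. -/
def refl1 : LaurentPolynomial Kqt →ₗ[Kqt] LaurentPolynomial Kqt := linExt fun m => T (-m)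

/-- The affine reflection `s₀`: `x^m ↦ q^m x^{-m}`. -/
def refl0 : LaurentPolynomial Kqt →ₗ[Kqt] LaurentPolynomial Kqt :=
  linExt fun m => qq ^ m • T (-m)

/-- The Hecke operator `T₁ = t s₁ + (t - 1) / (x² - 1) (s₁ - 1)`, given on monomials
(see `hecke1_spec`). -/
def hecke1 : LaurentPolynomial Kqt →ₗ[Kqt] LaurentPolynomial Kqt :=
  linExt fun m => tt • T (-m) + (tt - 1) •
    if 0 ≤ m then -∑ j ∈ Finset.range m.natAbs, T (-m + 2 * j)
    else ∑ j ∈ Finset.range m.natAbs, T (m + 2 * j)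

/-- The Hecke operator `T₀ = t s₀ + (t - 1) / (q x⁻² - 1) (s₀ - 1)`, given on monomials
(see `hecke0_spec`). -/
def hecke0 : LaurentPolynomial Kqt →ₗ[Kqt] LaurentPolynomial Kqt :=
  linExt fun m => (tt * qq ^ m) • T (-m) + (tt - 1) •
    if 0 ≤ m then ∑ j ∈ Finset.range m.natAbs, qq ^ (j : ℤ) • T (m - 2 * j)
    else -∑ j ∈ Finset.range m.natAbs, qq ^ (-(j + 1) : ℤ) • T (m + 2 * (j + 1))

theorem qq_ne_zero : qq ≠ 0 := by
  unfold qq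
  rw [Ne, IsFractionRing.to_map_eq_zero_iff]
  exact MvPolynomial.X_ne_zero 0

theorem hecke1_spec (f : LaurentPolynomial Kqt) :
    (T 2 - 1) * (hecke1 f - tt • refl1 f) = (tt - 1) • (refl1 f - f) := by
  have key : (LinearMap.mulLeft Kqt (T 2 - 1 : LaurentPolynomial Kqt)) ∘ₗ (hecke1 - tt • refl1)
      = (tt - 1) • (refl1 - LinearMap.id) := by
    apply linMap_ext
    intro m
    simp only [LinearMap.comp_apply, LinearMap.sub_apply, LinearMap.smul_apply, hecke1, refl1,
      linExt_T, LinearMap.mulLeft_apply, LinearMap.id_apply, add_sub_cancel_left, mul_smul_comm]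
    congr 1
    have tel : ∀ (c : ℤ) (n : ℕ), (T 2 - 1 : LaurentPolynomial Kqt) *
        ∑ j ∈ Finset.range n, T (c + 2 * j) = T (c + 2 * n) - T c := by
      intro c n
      induction n with
      | zero => simp
      | succ n ih =>
        rw [Finset.sum_range_succ, mul_add, ih, sub_mul, ← T_add, one_mul]
        have : (2 + (c + 2 * (n : ℤ))) = c + 2 * ((n + 1 : ℕ) : ℤ) := by push_cast; ring
        rw [this]
        ring
    split_ifs with hm
    · rw [mul_neg, tel]
      have : -m + 2 * (m.natAbs : ℤ) = m := by omega
      rw [this]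
      ring
    · rw [tel]
      have : m + 2 * (m.natAbs : ℤ) = -m := by omega
      rw [this]
  exact LinearMap.congr_fun key f

theorem hecke0_spec (f : LaurentPolynomial Kqt) :
    (qq • T (-2) - 1) * (hecke0 f - tt • refl0 f) = (tt - 1) • (refl0 f - f) := by
  have key : (LinearMap.mulLeft Kqt (qq • T (-2) - 1 : LaurentPolynomial Kqt)) ∘ₗ
      (hecke0 - tt • refl0) = (tt - 1) • (refl0 - LinearMap.id) := by
    apply linMap_ext
    intro m
    simp only [LinearMap.comp_apply, LinearMap.sub_apply, LinearMap.smul_apply, hecke0, refl0,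
      linExt_T, LinearMap.mulLeft_apply, LinearMap.id_apply, mul_smul_comm, smul_smul,
      add_sub_cancel_left]
    congr 1
    have tel1 : ∀ (c : ℤ) (n : ℕ), (qq • T (-2) - 1 : LaurentPolynomial Kqt) *
        ∑ j ∈ Finset.range n, qq ^ (j : ℤ) • T (c - 2 * j)
          = qq ^ (n : ℤ) • T (c - 2 * n) - T c := by
      intro c n
      induction n with
      | zero => simp
      | succ n ih =>
        rw [Finset.sum_range_succ, mul_add, ih, sub_mul, smul_mul_smul_comm, ← T_add, one_mul]
        have h1 : (-2 + (c - 2 * (n : ℤ))) = c - 2 * ((n + 1 : ℕ) : ℤ) := by push_cast; ring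
        have h2 : qq * qq ^ (n : ℤ) = qq ^ ((n + 1 : ℕ) : ℤ) := by
          push_cast
          rw [zpow_add_one₀ qq_ne_zero, mul_comm]
        rw [h1, h2]
        abel
    have tel2 : ∀ (c : ℤ) (n : ℕ), (qq • T (-2) - 1 : LaurentPolynomial Kqt) *
        ∑ j ∈ Finset.range n, qq ^ (-(j + 1) : ℤ) • T (c + 2 * (j + 1))
          = T c - qq ^ (-n : ℤ) • T (c + 2 * n) := by
      intro c n
      induction n with
      | zero => simp
      | succ n ih =>
        rw [Finset.sum_range_succ, mul_add, ih, sub_mul, smul_mul_smul_comm, ← T_add, one_mul]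
        have h1 : (-2 + (c + 2 * ((n : ℤ) + 1))) = c + 2 * (n : ℤ) := by ring
        have h2 : qq * qq ^ (-((n : ℤ) + 1)) = qq ^ (-(n : ℤ)) := by
          rw [← zpow_one_add₀ qq_ne_zero]
          congr 1
          ring
        rw [h1, h2]
        push_cast
        abel
    split_ifs with hm
    · rw [tel1]
      have h1 : m - 2 * (m.natAbs : ℤ) = -m := by omega
      have h2 : (m.natAbs : ℤ) = m := by omega
      rw [h1, h2]
    · rw [mul_neg, tel2]
      have h1 : m + 2 * (m.natAbs : ℤ) = -m := by omega
      have h2 : -(m.natAbs : ℤ) = m := by omega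
      rw [h1, h2]
      abel
  exact LinearMap.congr_fun key f

/-- The Cherednik operator `Y` of the simple coroot, `Y = T₀ T₁`. -/
def cherednikY : LaurentPolynomial Kqt →ₗ[Kqt] LaurentPolynomial Kqt := hecke0 ∘ₗ hecke1

/-- The strict Cherednik order on the weights `nω` of `sl₂`: `n ≺ m` if and only if either
`|n| < |m|` and `m - n` is even, or `|n| = |m|` and `n > m`. -/
def CherednikLT (n m : ℤ) : Prop := (|n| < |m| ∧ Even (m - n)) ∨ (|n| = |m| ∧ m < n)

/-- `E` is the nonsymmetric Macdonald polynomial `E_{mω}(x, q, t)`: it is `x^m` plus a linear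
combination of the `x^n` with `n ≺ m`, and it is an eigenvector of `Y`. -/
def IsNonsymMacdonald (m : ℤ) (E : LaurentPolynomial Kqt) : Prop :=
  E.coeff m = 1 ∧ (∀ n : ℤ, E.coeff n ≠ 0 → n = m ∨ CherednikLT n m) ∧
    ∃ c : Kqt, cherednikY E = c • E

/-- The integral form: `∏_{i=1}^{r} (1 - q^i t) E_{mω}` with `r = -m` if `m ≤ 0` and `r = m - 1`
if `m > 0`. -/
def integralForm (m : ℤ) (E : LaurentPolynomial Kqt) : LaurentPolynomial Kqt :=
  (∏ i ∈ Finset.range (if 0 < m then (m - 1).toNat else (-m).toNat),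
    (1 - qq ^ (i + 1) * tt)) • E

/-- The graded supercharacter `∑ q^a (-t)^b x^n dim (EM^loc_{mω})_{n,a,b}`. -/
def gch (k : Type*) [Field k] (m : ℤ) : LaurentPolynomial Kqt :=
  ∑ᶠ d : ℤ × ℕ × ℕ,
    ((Module.finrank k (pieceEM k m d) : Kqt) * qq ^ d.2.1 * (-tt) ^ d.2.2) • T d.1

end Macdonald

end MacdonaldSL2

end

open MacdonaldSL2

/-! The proof bounds the local modules from above and from below, and the bounds meet at dimension
`4 ^ n`.

Upper bound. In the module of weight `-(n+1)ω` the vectors `w`, `e^(n+1) w`, `hξ e^(n+1) w`,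
`(fz)^(n+1) hξ e^(n+1) w` generate a descending chain of cyclic submodules. Modulo the next
submodule, each vector satisfies the relations of a shifted module of weight `-nω` or `(n+1)ω`. The
same holds in weight `(n+2)ω` with `e` and `fz` exchanged (`lowChain`, `highChain`). By induction
the modules of weights `-nω` and `(n+1)ω` are spanned by `4 ^ n` homogeneous vectors each. The
contributions of these vectors to the supercharacter add up to the two members of `macPair n`, which
obey the recursion read off from the chains (`hasHomogeneousSpan`).

Lower bound. This is a fusion argument. Take `n` copies of the four-dimensional space `k² ⊗ Λ(ξ)`
and let `z` act on them by the distinct numbers `1, …, n`. The result is a cyclic module of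
dimension `4 ^ n` satisfying the global relations of weight `-nω`, on whose generator `h z^a` with
`a > 0` acts by a scalar. An induction on the `z`-degree shows that every finite homogeneous family
that spans the local module also spans this one (`SpinSystem.orbit_mem_span`). The diagram
automorphism transfers the bound to weight `(n+1)ω` (`finrank_neg_le_finrank_pos`).

Consequently the spanning families are bases, which determines the supercharacter. The four
subquotients have dimension at most `4 ^ n` and add up to `4 ^ (n+1)`, so the surjections onto them
are isomorphisms.

Macdonald side. The Hecke operators exchange the two members of `macPair n` up to scalars and powers
of `x` (`macPair_hecke`), so both are eigenvectors of `Y`. Their eigenvalues `q^n t²` and `q^(-n-1)`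
are pairwise distinct over all `n`, and the eigenvectors are triangular for the Cherednik order.
They therefore form an eigenbasis with simple spectrum, and a polynomial satisfying the definition
of `E_{mω}` must be a multiple of the one attached to `m` (`IsNonsymMacdonald.eq`). -/

noncomputable section

namespace MacdonaldSL2

open scoped Polynomial

/-! ### The enveloping algebra of `L[ξ]` and its universal property -/

section Envelope

variable {R : Type*} {L : Type*} [CommRing R] [LieRing L] [LieAlgebra R L]
variable {A : Type*} [Ring A] [Algebra R A]

variable (R L) in
/-- `ev` as a linear map. -/
def evL : L →ₗ[R] SuperCurrentEnv R L :=
  (RingQuot.mkAlgHom R (SuperCurrentRel R L)).toLinearMap ∘ₗ TensorAlgebra.ι R ∘ₗ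
    LinearMap.inl R L L

variable (R L) in
/-- `od` as a linear map. -/
def odL : L →ₗ[R] SuperCurrentEnv R L :=
  (RingQuot.mkAlgHom R (SuperCurrentRel R L)).toLinearMap ∘ₗ TensorAlgebra.ι R ∘ₗ
    LinearMap.inr R L L

theorem evL_apply (x : L) : evL R L x = ev R x := rfl

theorem odL_apply (x : L) : odL R L x = od R x := rfl

theorem ev_add (x y : L) : ev R (x + y) = ev R x + ev R y := map_add (evL R L) x y

theorem ev_smul (c : R) (x : L) : ev R (c • x) = c • ev R x := map_smul (evL R L) c x

theorem od_add (x y : L) : od R (x + y) = od R x + od R y := map_add (odL R L) x y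

theorem od_smul (c : R) (x : L) : od R (c • x) = c • od R x := map_smul (odL R L) c x

theorem ev_neg (x : L) : ev R (-x) = -ev R x := map_neg (evL R L) x

theorem od_neg (x : L) : od R (-x) = -od R x := map_neg (odL R L) x

theorem ev_zero : ev R (0 : L) = 0 := map_zero (evL R L)

theorem od_zero : od R (0 : L) = 0 := map_zero (odL R L)

theorem ev_mul_ev (x y : L) : ev R x * ev R y = ev R y * ev R x + ev R ⁅x, y⁆ := by
  have := RingQuot.mkAlgHom_rel R (SuperCurrentRel.even_even (R := R) x y)
  simp only [map_mul, map_add] at this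
  exact this

theorem ev_mul_od (x y : L) : ev R x * od R y = od R y * ev R x + od R ⁅x, y⁆ := by
  have := RingQuot.mkAlgHom_rel R (SuperCurrentRel.even_odd (R := R) x y)
  simp only [map_mul, map_add] at this
  exact this

theorem od_mul_od (x y : L) : od R x * od R y + od R y * od R x = 0 := by
  have := RingQuot.mkAlgHom_rel R (SuperCurrentRel.odd_odd (R := R) x y)
  simp only [map_mul, map_add, map_zero] at this
  exact this

/-- The universal property of `U(L[ξ])`. -/
def envLift (f g : L →ₗ[R] A) (h₁ : ∀ x y, f x * f y = f y * f x + f ⁅x, y⁆)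
    (h₂ : ∀ x y, f x * g y = g y * f x + g ⁅x, y⁆) (h₃ : ∀ x y, g x * g y + g y * g x = 0) :
    SuperCurrentEnv R L →ₐ[R] A :=
  RingQuot.liftAlgHom R ⟨TensorAlgebra.lift R (f.coprod g), by
    rintro _ _ (⟨x, y⟩ | ⟨x, y⟩ | ⟨x, y⟩)
    · simpa using h₁ x y
    · simpa using h₂ x y
    · simpa using h₃ x y⟩

section

variable (f g : L →ₗ[R] A) (h₁ : ∀ x y, f x * f y = f y * f x + f ⁅x, y⁆)
    (h₂ : ∀ x y, f x * g y = g y * f x + g ⁅x, y⁆) (h₃ : ∀ x y, g x * g y + g y * g x = 0)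

@[simp] theorem envLift_ev (x : L) : envLift f g h₁ h₂ h₃ (ev R x) = f x :=
  (RingQuot.liftAlgHom_mkAlgHom_apply R _ _ _).trans (by simp)

@[simp] theorem envLift_od (x : L) : envLift f g h₁ h₂ h₃ (od R x) = g x :=
  (RingQuot.liftAlgHom_mkAlgHom_apply R _ _ _).trans (by simp)

end

theorem env_hom_ext {φ ψ : SuperCurrentEnv R L →ₐ[R] A} (he : ∀ x, φ (ev R x) = ψ (ev R x))
    (ho : ∀ x, φ (od R x) = ψ (od R x)) : φ = ψ := by
  apply RingQuot.ringQuot_ext'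
  apply TensorAlgebra.hom_ext
  apply LinearMap.ext
  rintro ⟨x, y⟩
  have e : ((x, y) : L × L) = (x, 0) + (0, y) := by simp
  rw [e, map_add, map_add]
  exact congrArg₂ (· + ·) (he x) (ho y)

/-- A subspace of `U(L[ξ])` that contains `1` and is stable under left multiplication by the
generators is everything. -/
theorem env_eq_top (W : Submodule R (SuperCurrentEnv R L)) (h1 : 1 ∈ W)
    (he : ∀ x, ∀ y ∈ W, ev R x * y ∈ W) (ho : ∀ x, ∀ y ∈ W, od R x * y ∈ W) : W = ⊤ := by
  -- The elements that preserve `W` form a subalgebra containing the generators. The universal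
  -- property gives a map `ψ` into it, and `ψ` followed by the inclusion fixes the generators, so
  -- the subalgebra is everything.
  let B : Subalgebra R (SuperCurrentEnv R L) :=
    { carrier := {u | ∀ y ∈ W, u * y ∈ W}
      mul_mem' := fun {a b} ha hb y hy => by rw [mul_assoc]; exact ha _ (hb _ hy)
      add_mem' := fun {a b} ha hb y hy => by rw [add_mul]; exact W.add_mem (ha _ hy) (hb _ hy)
      algebraMap_mem' := fun r y hy => by rw [← Algebra.smul_def]; exact W.smul_mem _ hy }
  have h₁ : ∀ x y : B, (x * y : B) = ⟨x.1 * y.1, (x * y).2⟩ := fun _ _ => rfl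
  let ψ : SuperCurrentEnv R L →ₐ[R] B := envLift
    ((evL R L).codRestrict B.toSubmodule (fun x y hy => he x y hy))
    ((odL R L).codRestrict B.toSubmodule (fun x y hy => ho x y hy))
    (fun x y => Subtype.ext (ev_mul_ev x y)) (fun x y => Subtype.ext (ev_mul_od x y))
    (fun x y => Subtype.ext (od_mul_od x y))
  have hψ : B.val.comp ψ = AlgHom.id R _ := by
    apply env_hom_ext
    · intro x
      exact congrArg Subtype.val (envLift_ev (A := B) _ _ _ _ _ x)
    · intro x
      exact congrArg Subtype.val (envLift_od (A := B) _ _ _ _ _ x)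
  rw [eq_top_iff]
  intro u _
  have hu : u ∈ B := by
    have := (ψ u).2
    rwa [show ((ψ u : B) : SuperCurrentEnv R L) = u from AlgHom.congr_fun hψ u] at this
  simpa using hu 1 h1

/-- The endomorphism `x ↦ φ x + χ x`, `xξ ↦ c (φ x) ξ` of `U(L[ξ])`, for an endomorphism `φ` and a
character `χ` of `L`. -/
def envMap (φ : L →ₗ[R] L) (hφ : ∀ x y : L, φ ⁅x, y⁆ = ⁅φ x, φ y⁆) (χ : L →ₗ[R] R)
    (hχ : ∀ x y : L, χ ⁅x, y⁆ = 0) (c : R) : SuperCurrentEnv R L →ₐ[R] SuperCurrentEnv R L :=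
  -- Scalars are central and `χ` vanishes on brackets, so adding `χ` to the even generators
  -- preserves all relations. Weight shifts, rescalings of `z` and `ξ`, and the exchange of `e` with
  -- `fz` are all instances.
  envLift (evL R L ∘ₗ φ + Algebra.linearMap R _ ∘ₗ χ) (c • odL R L ∘ₗ φ)
    (fun x y => by
      simp only [LinearMap.add_apply, LinearMap.comp_apply, evL_apply, Algebra.linearMap_apply, hφ,
        hχ, map_zero, add_zero]
      rw [add_mul, mul_add, mul_add, add_mul, mul_add, mul_add, ev_mul_ev (φ x) (φ y),
        Algebra.commutes (χ x) (ev R (φ y)), Algebra.commutes (χ y) (ev R (φ x)),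
        Algebra.commutes (χ x) (algebraMap R _ (χ y))]
      abel)
    (fun x y => by
      simp only [LinearMap.add_apply, LinearMap.comp_apply, evL_apply, Algebra.linearMap_apply, hφ,
        LinearMap.smul_apply, odL_apply]
      rw [add_mul, mul_add, mul_smul_comm, ev_mul_od, Algebra.commutes (χ x) (c • od R (φ y)),
        smul_add, smul_mul_assoc c (od R (φ y)) (ev R (φ x))]
      abel)
    (fun x y => by
      simp only [LinearMap.comp_apply, LinearMap.smul_apply, odL_apply, smul_mul_smul_comm]
      rw [← smul_add, od_mul_od, smul_zero])

section

variable (φ : L →ₗ[R] L) (hφ : ∀ x y : L, φ ⁅x, y⁆ = ⁅φ x, φ y⁆) (χ : L →ₗ[R] R)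
    (hχ : ∀ x y : L, χ ⁅x, y⁆ = 0) (c : R)

@[simp] theorem envMap_ev (x : L) :
    envMap φ hφ χ hχ c (ev R x) = ev R (φ x) + algebraMap R _ (χ x) := by
  simp [envMap, evL_apply]

@[simp] theorem envMap_od (x : L) : envMap φ hφ χ hχ c (od R x) = c • od R (φ x) := by
  simp [envMap, odL_apply]

end

end Envelope

/-! ### Coordinates, brackets and automorphisms of the Iwahori algebra -/

section IwahoriBasics

variable {k : Type*} [Field k]

attribute [local instance 100] LieRing.ofAssociativeRing

theorem iwahori_ext {x y : iwahori k} (h0 : x.1 0 0 = y.1 0 0) (h1 : x.1 0 1 = y.1 0 1)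
    (h2 : x.1 1 0 = y.1 1 0) : x = y := by
  apply Subtype.ext
  have hx := x.2.1
  have hy := y.2.1
  rw [Matrix.trace_fin_two] at hx hy
  ext1 i j
  fin_cases i <;> fin_cases j
  · exact h0
  · exact h1
  · exact h2
  · change x.1 1 1 = y.1 1 1
    rw [eq_neg_of_add_eq_zero_right hx, eq_neg_of_add_eq_zero_right hy, h0]

theorem iwahori_diag (x : iwahori k) : x.1 1 1 = -x.1 0 0 := by
  have hx := x.2.1
  rw [Matrix.trace_fin_two] at hx
  exact eq_neg_of_add_eq_zero_right hx

theorem lie_zero_zero (x y : iwahori k) :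
    (⁅x, y⁆ : iwahori k).1 0 0 = x.1 0 1 * y.1 1 0 - y.1 0 1 * x.1 1 0 := by
  rw [LieSubalgebra.coe_bracket, Ring.lie_def, Matrix.sub_apply, Matrix.mul_apply,
    Matrix.mul_apply, Fin.sum_univ_two, Fin.sum_univ_two]
  ring

theorem lie_zero_one (x y : iwahori k) :
    (⁅x, y⁆ : iwahori k).1 0 1 = 2 * (x.1 0 0 * y.1 0 1 - y.1 0 0 * x.1 0 1) := by
  rw [LieSubalgebra.coe_bracket, Ring.lie_def, Matrix.sub_apply, Matrix.mul_apply,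
    Matrix.mul_apply, Fin.sum_univ_two, Fin.sum_univ_two, iwahori_diag, iwahori_diag]
  ring

theorem lie_one_zero (x y : iwahori k) :
    (⁅x, y⁆ : iwahori k).1 1 0 = 2 * (x.1 1 0 * y.1 0 0 - y.1 1 0 * x.1 0 0) := by
  rw [LieSubalgebra.coe_bracket, Ring.lie_def, Matrix.sub_apply, Matrix.mul_apply,
    Matrix.mul_apply, Fin.sum_univ_two, Fin.sum_univ_two, iwahori_diag, iwahori_diag]
  ring

/-- The element `p e`. -/
def ePoly : k[X] →ₗ[k] iwahori k where
  toFun p := ⟨!![0, p; 0, 0], by simp [Matrix.trace_fin_two], by simp⟩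
  map_add' p r := iwahori_ext (by simp) (by simp) (by simp)
  map_smul' c p := iwahori_ext (by simp) (by simp) (by simp)

/-- The element `p h`. -/
def hPoly : k[X] →ₗ[k] iwahori k where
  toFun p := ⟨!![p, 0; 0, -p], by simp [Matrix.trace_fin_two], by simp⟩
  map_add' p r := iwahori_ext (by simp) (by simp) (by simp)
  map_smul' c p := iwahori_ext (by simp) (by simp) (by simp)

/-- The element `z p f`. -/
def fPoly : k[X] →ₗ[k] iwahori k where
  toFun p := ⟨!![0, 0; Polynomial.X * p, 0], by simp [Matrix.trace_fin_two], by simp⟩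
  map_add' p r := iwahori_ext (by simp) (by simp) (by simp [mul_add])
  map_smul' c p := iwahori_ext (by simp) (by simp) (by simp)

section
variable (p : k[X])

@[simp] theorem ePoly_00 : (ePoly p).1 0 0 = 0 := rfl
@[simp] theorem ePoly_01 : (ePoly p).1 0 1 = p := rfl
@[simp] theorem ePoly_10 : (ePoly p).1 1 0 = 0 := rfl
@[simp] theorem hPoly_00 : (hPoly p).1 0 0 = p := rfl
@[simp] theorem hPoly_01 : (hPoly p).1 0 1 = 0 := rfl
@[simp] theorem hPoly_10 : (hPoly p).1 1 0 = 0 := rfl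
@[simp] theorem fPoly_00 : (fPoly p).1 0 0 = 0 := rfl
@[simp] theorem fPoly_01 : (fPoly p).1 0 1 = 0 := rfl
@[simp] theorem fPoly_10 : (fPoly p).1 1 0 = Polynomial.X * p := rfl
end

theorem iwahori_smul_apply (c : k) (x : iwahori k) (i j : Fin 2) :
    (c • x).1 i j = Polynomial.C c * x.1 i j := Polynomial.smul_eq_C_mul c

theorem iwahori_add_apply (x y : iwahori k) (i j : Fin 2) :
    (x + y).1 i j = x.1 i j + y.1 i j := rfl

section
variable (a : ℕ)

@[simp] theorem eZ_00 : (eZ k a).1 0 0 = 0 := rfl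
@[simp] theorem eZ_01 : (eZ k a).1 0 1 = Polynomial.X ^ a := rfl
@[simp] theorem eZ_10 : (eZ k a).1 1 0 = 0 := rfl
@[simp] theorem hZ_00 : (hZ k a).1 0 0 = Polynomial.X ^ a := rfl
@[simp] theorem hZ_01 : (hZ k a).1 0 1 = 0 := rfl
@[simp] theorem hZ_10 : (hZ k a).1 1 0 = 0 := rfl
@[simp] theorem fZ_00 : (fZ k a).1 0 0 = 0 := rfl
@[simp] theorem fZ_01 : (fZ k a).1 0 1 = 0 := rfl
@[simp] theorem fZ_10 : (fZ k a).1 1 0 = Polynomial.X ^ (a + 1) := rfl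
end

theorem eZ_eq (a : ℕ) : eZ k a = ePoly (Polynomial.X ^ a) := rfl

theorem fZ_eq (a : ℕ) : fZ k a = fPoly (Polynomial.X ^ a) :=
  iwahori_ext (by simp) (by simp) (by simp [pow_succ'])

theorem iwahori_decomp (x : iwahori k) :
    ∃ p q r : k[X], x = ePoly p + hPoly q + fPoly r := by
  obtain ⟨r, hr⟩ := x.2.2
  exact ⟨x.1 0 1, x.1 0 0, r, iwahori_ext (by simp) (by simp) (by simpa using hr)⟩

/-- The elements `e z^a`, `h z^a`, `f z^(a+1)` span the Iwahori algebra. -/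
theorem iwahori_span_induction {P : iwahori k → Prop} (he : ∀ a, P (eZ k a)) (hh : ∀ a, P (hZ k a))
    (hf : ∀ a, P (fZ k a)) (hadd : ∀ x y, P x → P y → P (x + y))
    (hsmul : ∀ (c : k) x, P x → P (c • x)) (x : iwahori k) : P x := by
  have key : ∀ g : k[X] →ₗ[k] iwahori k, (∀ a : ℕ, P (g (Polynomial.X ^ a))) → ∀ p, P (g p) := by
    intro g hg p
    induction p using Polynomial.induction_on' with
    | add p q hp hq => rw [map_add]; exact hadd _ _ hp hq
    | monomial n c =>
      rw [← Polynomial.C_mul_X_pow_eq_monomial, ← Polynomial.smul_eq_C_mul, map_smul]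
      exact hsmul _ _ (hg n)
  obtain ⟨p, q, r, rfl⟩ := iwahori_decomp x
  refine hadd _ _ (hadd _ _ (key _ he p) (key _ hh q)) (key _ (fun a => ?_) r)
  rw [← fZ_eq]
  exact hf a

variable (k) in
/-- `hCoeff` as a linear map. -/
def hCoeffL : iwahori k →ₗ[k] k where
  toFun := hCoeff k
  map_add' x y := by simp [hCoeff]
  map_smul' c x := by simp [hCoeff]

theorem hCoeffL_apply (x : iwahori k) : hCoeffL k x = hCoeff k x := rfl

/-- Every term of the diagonal entry of a bracket contains a lower left entry, which is divisible by
`z`. Hence `hCoeff` is a character and can serve as `χ` in `envMap`. -/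
theorem hCoeff_lie (x y : iwahori k) : hCoeff k ⁅x, y⁆ = 0 := by
  obtain ⟨r, hr⟩ := x.2.2
  obtain ⟨s, hs⟩ := y.2.2
  rw [hCoeff, lie_zero_zero, hr, hs]
  simp [Polynomial.coeff_zero_eq_eval_zero]

@[simp] theorem hCoeff_eZ (a : ℕ) : hCoeff k (eZ k a) = 0 := by simp [hCoeff, eZ]
@[simp] theorem hCoeff_fZ (a : ℕ) : hCoeff k (fZ k a) = 0 := by simp [hCoeff, fZ]
@[simp] theorem hCoeff_hZ_zero : hCoeff k (hZ k 0) = 1 := by simp [hCoeff, hZ]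
@[simp] theorem hCoeff_hZ_succ (a : ℕ) : hCoeff k (hZ k (a + 1)) = 0 := by simp [hCoeff, hZ]

/-- The automorphism `T_s` of `U(𝕴[ξ])` that shifts the action of `h` by `s`. -/
def twist (s : k) : U k →ₐ[k] U k :=
  envMap LinearMap.id (fun _ _ => rfl) (s • hCoeffL k)
    (fun x y => by simp [hCoeffL_apply, hCoeff_lie]) 1

@[simp] theorem twist_ev (s : k) (x : iwahori k) :
    twist s (ev k x) = ev k x + algebraMap k _ (s * hCoeff k x) := by
  simp [twist, hCoeffL_apply]

@[simp] theorem twist_od (s : k) (x : iwahori k) : twist s (od k x) = od k x := by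
  simp [twist]

theorem twist_twist (s : k) (u : U k) : twist s (twist (-s) u) = u := by
  have : (twist s).comp (twist (-s)) = AlgHom.id k (U k) := by
    apply env_hom_ext
    · intro x
      simp [AlgHom.commutes]
    · intro x
      simp
  exact AlgHom.congr_fun this u

/-- The scaling `z ↦ c z` of the Iwahori algebra. -/
def scaleZ (c : k) : iwahori k →ₗ[k] iwahori k where
  toFun x := ⟨x.1.map (Polynomial.aeval (Polynomial.C c * Polynomial.X)), by
    have := x.2.1
    rw [Matrix.trace_fin_two] at this ⊢
    rw [Matrix.map_apply, Matrix.map_apply, ← map_add, this, map_zero], by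
    obtain ⟨r, hr⟩ := x.2.2
    rw [Matrix.map_apply, hr, map_mul, Polynomial.aeval_X]
    exact Dvd.dvd.mul_right (Dvd.intro_left _ rfl) _⟩
  map_add' x y := iwahori_ext (by simp) (by simp) (by simp)
  map_smul' c x := iwahori_ext (by simp) (by simp) (by simp)

theorem scaleZ_apply (c : k) (x : iwahori k) (i j : Fin 2) :
    (scaleZ c x).1 i j = Polynomial.aeval (Polynomial.C c * Polynomial.X) (x.1 i j) := rfl

theorem scaleZ_lie (c : k) (x y : iwahori k) : scaleZ c ⁅x, y⁆ = ⁅scaleZ c x, scaleZ c y⁆ := by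
  apply iwahori_ext
  · simp only [lie_zero_zero, scaleZ_apply, map_sub, map_mul]
  · simp only [lie_zero_one, scaleZ_apply, map_sub, map_mul, map_ofNat]
  · simp only [lie_one_zero, scaleZ_apply, map_sub, map_mul, map_ofNat]

/-- This turns the `z`-grading into eigenvalues of an operator, from which independence of the
graded components will follow. -/
theorem scaleZ_homogeneous {c : k} {a : ℕ} {x : iwahori k} (hx : IsHomogeneousZ k a x) :
    scaleZ c x = c ^ a • x := by
  have key : ∀ i j, (scaleZ c x).1 i j = (c ^ a • x).1 i j := by
    intro i j
    obtain ⟨d, hd⟩ := hx i j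
    have : (c ^ a • x).1 i j = c ^ a • x.1 i j := rfl
    rw [this, scaleZ_apply, hd, Polynomial.aeval_monomial, mul_pow, ← Polynomial.C_pow,
      Polynomial.smul_monomial, ← Polynomial.C_mul_X_pow_eq_monomial]
    simp only [smul_eq_mul, map_mul, Polynomial.algebraMap_eq]
    ring
  exact iwahori_ext (key _ _) (key _ _) (key _ _)

/-- The diagram automorphism `e z^a ↔ f z^(a+1)`, `h z^a ↦ -h z^a` of the Iwahori algebra. -/
def swapIw : iwahori k →ₗ[k] iwahori k where
  toFun x := ⟨!![-x.1 0 0, (x.1 1 0).divX; Polynomial.X * x.1 0 1, x.1 0 0],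
    by simp [Matrix.trace_fin_two], by simp⟩
  map_add' x y := iwahori_ext (neg_add (x.1 0 0) (y.1 0 0)) Polynomial.divX_add
    (by simp only [iwahori_add_apply]; exact mul_add Polynomial.X (x.1 0 1) (y.1 0 1))
  map_smul' c x := iwahori_ext (smul_neg c (x.1 0 0)).symm
    ((congrArg Polynomial.divX (Polynomial.smul_eq_C_mul c)).trans (Polynomial.divX_C_mul.trans
      (Polynomial.smul_eq_C_mul c).symm)) (by
      simp only [iwahori_smul_apply]
      exact mul_left_comm Polynomial.X (Polynomial.C c) (x.1 0 1))

theorem swapIw_00 (x : iwahori k) : (swapIw x).1 0 0 = -x.1 0 0 := rfl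
theorem swapIw_01 (x : iwahori k) : (swapIw x).1 0 1 = (x.1 1 0).divX := rfl
theorem swapIw_10 (x : iwahori k) : (swapIw x).1 1 0 = Polynomial.X * x.1 0 1 := rfl

theorem X_mul_divX_of_dvd {p : k[X]} (h : Polynomial.X ∣ p) : Polynomial.X * p.divX = p := by
  have := Polynomial.X_mul_divX_add p
  rwa [Polynomial.X_dvd_iff.1 h, map_zero, add_zero] at this

theorem divX_X_mul (p : k[X]) : (Polynomial.X * p).divX = p :=
  mul_left_cancel₀ Polynomial.X_ne_zero (X_mul_divX_of_dvd (dvd_mul_right _ _))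

/-- The map is conjugation by the antidiagonal matrix with upper right entry `1` and lower left
entry `z`. The upper right entry of the result involves a division by `z`, so it is compared after
multiplication by `z`. -/
theorem swapIw_lie (x y : iwahori k) : swapIw ⁅x, y⁆ = ⁅swapIw x, swapIw y⁆ := by
  have hx := X_mul_divX_of_dvd x.2.2
  have hy := X_mul_divX_of_dvd y.2.2
  apply iwahori_ext
  · simp only [lie_zero_zero, swapIw_00, swapIw_01, swapIw_10]
    linear_combination (x.1 0 1) * hy - (y.1 0 1) * hx
  · have h := X_mul_divX_of_dvd (⁅x, y⁆ : iwahori k).2.2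
    rw [lie_one_zero] at h
    simp only [lie_zero_one, swapIw_00, swapIw_01]
    rw [lie_one_zero]
    apply mul_left_cancel₀ (Polynomial.X_ne_zero (R := k))
    linear_combination h + 2 * (x.1 0 0) * hy - 2 * (y.1 0 0) * hx
  · simp only [lie_one_zero, lie_zero_one, swapIw_00, swapIw_10]
    ring

@[simp] theorem swapIw_eZ (a : ℕ) : swapIw (eZ k a) = fZ k a :=
  iwahori_ext (by simp [swapIw_00]) (by simp [swapIw_01])
    (by simp [swapIw_10, pow_succ'])

@[simp] theorem swapIw_fZ (a : ℕ) : swapIw (fZ k a) = eZ k a :=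
  iwahori_ext (by simp [swapIw_00])
    (by simp [swapIw_01, pow_succ', divX_X_mul]) (by simp [swapIw_10])

@[simp] theorem swapIw_hZ (a : ℕ) : swapIw (hZ k a) = -hZ k a :=
  iwahori_ext (by simp [swapIw_00]) (by simp [swapIw_01]) (by simp [swapIw_10])

theorem swapIw_swapIw (x : iwahori k) : swapIw (swapIw x) = x :=
  iwahori_ext (by simp [swapIw_00]) (by simp [swapIw_01, swapIw_10, divX_X_mul])
    (by simp [swapIw_01, swapIw_10, X_mul_divX_of_dvd x.2.2])

theorem lie_eZ_eZ (a b : ℕ) : (⁅eZ k a, eZ k b⁆ : iwahori k) = 0 :=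
  iwahori_ext (by simp [lie_zero_zero]) (by simp [lie_zero_one])
    (by simp [lie_one_zero])

theorem lie_fZ_fZ (a b : ℕ) : (⁅fZ k a, fZ k b⁆ : iwahori k) = 0 :=
  iwahori_ext (by simp [lie_zero_zero]) (by simp [lie_zero_one])
    (by simp [lie_one_zero])

theorem lie_hZ_hZ (a b : ℕ) : (⁅hZ k a, hZ k b⁆ : iwahori k) = 0 :=
  iwahori_ext (by simp [lie_zero_zero]) (by simp [lie_zero_one])
    (by simp [lie_one_zero])

theorem lie_hZ_eZ (a b : ℕ) : (⁅hZ k a, eZ k b⁆ : iwahori k) = (2 : k) • eZ k (a + b) := by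
  have h2 : (Polynomial.C (2 : k)) = 2 := map_ofNat _ 2
  refine iwahori_ext (by simp [lie_zero_zero]) ?_
    (by simp [lie_one_zero])
  rw [lie_zero_one, iwahori_smul_apply, h2, hZ_00, eZ_01, eZ_01, eZ_00, pow_add, zero_mul,
    sub_zero]

theorem lie_hZ_fZ (a b : ℕ) : (⁅hZ k a, fZ k b⁆ : iwahori k) = (-2 : k) • fZ k (a + b) := by
  have h2 : (Polynomial.C (-2 : k)) = -2 := by rw [map_neg, map_ofNat]
  refine iwahori_ext (by simp [lie_zero_zero])
    (by simp [lie_zero_one]) ?_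
  rw [lie_one_zero, iwahori_smul_apply, h2, hZ_00, hZ_10, fZ_10, fZ_10, fZ_00]
  ring

theorem lie_eZ_fZ (a b : ℕ) : (⁅eZ k a, fZ k b⁆ : iwahori k) = hZ k (a + b + 1) :=
  iwahori_ext (by simp [lie_zero_zero]; ring) (by simp [lie_zero_one])
    (by simp [lie_one_zero])

end IwahoriBasics

/-! ### Commutator calculus along the chain of four vectors -/

section Systems

variable {A : Type*} [Ring A]

/-- The elements are abstract so that the formula applies both to `H a` with `E a` and to `H' a`
with `E' a`. -/
theorem mul_pow_succ_of_comm {h e e' : A} (h₁ : h * e = e * h + 2 * e') (h₂ : e * e' = e' * e)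
    (n : ℕ) : h * e ^ (n + 1) = e ^ (n + 1) * h + (2 * (n + 1) : ℕ) * (e' * e ^ n) := by
  induction n with
  | zero => simpa using h₁
  | succ n ih =>
    have h₃ : e' * e ^ n * e = e' * e ^ (n + 1) := by rw [mul_assoc, pow_succ]
    have h₄ : e ^ (n + 1) * e' = e' * e ^ (n + 1) := (Commute.pow_left h₂ (n + 1)).eq
    rw [pow_succ e (n + 1), ← mul_assoc, ih, add_mul, mul_assoc _ h e, h₁, mul_add, mul_assoc _ _ e,
      h₃, ← mul_assoc _ e h, ← mul_assoc _ 2 e', ← Nat.cast_two, ← Nat.cast_comm 2,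
      mul_assoc _ _ e', h₄, add_assoc, ← add_mul, ← Nat.cast_add]
    congr 3
    ring

/-- Used for `(f, h, e')` equal to `(F a, H (a+1), E (a+1))` and to `(F' a, H' (a+1), E' (a+1))`,
always with `e = E 0`. -/
theorem mul_pow_add_two_of_comm {f h e e' : A} (h₀ : f * e = e * f - h)
    (h₁ : h * e = e * h + 2 * e') (h₂ : e * e' = e' * e) (n : ℕ) :
    f * e ^ (n + 2) = e ^ (n + 2) * f - (n + 2 : ℕ) * (e ^ (n + 1) * h)
      - ((n + 1) * (n + 2) : ℕ) * (e' * e ^ n) := by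
  induction n with
  | zero =>
    simp only [zero_add, pow_one, pow_zero, mul_one, one_mul]
    rw [pow_two, ← mul_assoc, h₀, sub_mul, mul_assoc e f e, h₀, h₁]
    push_cast
    noncomm_ring
  | succ n ih =>
    have h₃ : e' * e ^ n * e = e' * e ^ (n + 1) := by rw [mul_assoc, pow_succ]
    have h₄ : e ^ (n + 1) * e' = e' * e ^ (n + 1) := (Commute.pow_left h₂ (n + 1)).eq
    have h₅ : e ^ (n + 1) * h * e = e ^ (n + 2) * h + 2 * (e' * e ^ (n + 1)) := by
      rw [mul_assoc, h₁, mul_add, ← mul_assoc, ← pow_succ, ← mul_assoc, ← Nat.cast_two,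
        ← Nat.cast_comm 2, mul_assoc, h₄]
    have h₆ : e ^ (n + 2) * f * e = e ^ (n + 3) * f - e ^ (n + 2) * h := by
      rw [mul_assoc, h₀, mul_sub, ← mul_assoc, ← pow_succ]
    rw [show n + 1 + 2 = (n + 2) + 1 by ring, pow_succ e (n + 2), ← mul_assoc, ih, sub_mul, sub_mul,
      h₆, mul_assoc _ _ e, h₅, mul_assoc _ _ e, h₃, ← pow_succ]
    push_cast
    noncomm_ring

variable (A) in
/-- Families of elements of a ring that satisfy the commutation relations of `e z^a`, `f z^(a+1)`,
`h z^a` (`E`, `F`, `H`) and of `e z^a ξ`, `f z^(a+1) ξ`, `h z^a ξ` (`E'`, `F'`, `H'`). -/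
structure IwahoriSystem where
  (E F H E' F' H' : ℕ → A)
  EE : ∀ a b, E a * E b = E b * E a
  FF : ∀ a b, F a * F b = F b * F a
  HE : ∀ a b, H a * E b = E b * H a + 2 * E (a + b)
  HF : ∀ a b, H a * F b = F b * H a - 2 * F (a + b)
  EF : ∀ a b, E a * F b = F b * E a + H (a + b + 1)
  EE' : ∀ a b, E a * E' b = E' b * E a
  FF' : ∀ a b, F a * F' b = F' b * F a
  HE' : ∀ a b, H a * E' b = E' b * H a + 2 * E' (a + b)
  HF' : ∀ a b, H a * F' b = F' b * H a - 2 * F' (a + b)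
  H'E : ∀ a b, H' a * E b = E b * H' a + 2 * E' (a + b)
  H'F : ∀ a b, H' a * F b = F b * H' a - 2 * F' (a + b)
  HH' : ∀ a b, H a * H' b = H' b * H a
  EF' : ∀ a b, E a * F' b = F' b * E a + H' (a + b + 1)
  E'F : ∀ a b, E' a * F b = F b * E' a + H' (a + b + 1)
  H'E' : ∀ a b, H' a * E' b = -(E' b * H' a)
  H'F' : ∀ a b, H' a * F' b = -(F' b * H' a)
  H'H' : ∀ a b, H' a * H' b = -(H' b * H' a)

namespace IwahoriSystem

/-- The system with `e z^a` and `f z^(a+1)` interchanged. -/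
def swap (S : IwahoriSystem A) : IwahoriSystem A where
  E := S.F
  F := S.E
  H a := -S.H a
  E' := S.F'
  F' := S.E'
  H' a := -S.H' a
  EE := S.FF
  FF := S.EE
  HE a b := by rw [neg_mul, S.HF]; noncomm_ring
  HF a b := by rw [neg_mul, S.HE]; noncomm_ring
  EF a b := by rw [S.EF, add_comm b a]; abel
  EE' := S.FF'
  FF' := S.EE'
  HE' a b := by rw [neg_mul, S.HF']; noncomm_ring
  HF' a b := by rw [neg_mul, S.HE']; noncomm_ring
  H'E a b := by rw [neg_mul, S.H'F]; noncomm_ring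
  H'F a b := by rw [neg_mul, S.H'E]; noncomm_ring
  HH' a b := by rw [neg_mul_neg, neg_mul_neg, S.HH']
  EF' a b := by rw [S.E'F, add_comm b a]; abel
  E'F a b := by rw [S.EF', add_comm b a]; abel
  H'E' a b := by rw [neg_mul, S.H'F']; noncomm_ring
  H'F' a b := by rw [neg_mul, S.H'E']; noncomm_ring
  H'H' a b := by rw [neg_mul_neg, neg_mul_neg, S.H'H']

variable (S : IwahoriSystem A) {M : Type*} [AddCommGroup M] [Module A M]

/-- `w` satisfies the relations of the cyclic vector of a local module, except for its weight. -/
structure IsLow (N : ℕ) (w : M) : Prop where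
  H : ∀ a, S.H (a + 1) • w = 0
  H' : S.H' 0 • w = 0
  F : ∀ a, S.F a • w = 0
  F' : ∀ a, S.F' a • w = 0
  E : S.E 0 ^ (N + 1) • w = 0

variable (w : M)

/-- Sums of products `± E a₁ ⋯ E aⱼ w` with `a₁ + ⋯ + aⱼ = d`. -/
inductive EvenSpan : ℕ → ℕ → M → Prop
  | base : EvenSpan 0 0 w
  | zero (j d : ℕ) : EvenSpan j d 0
  | add {j d : ℕ} {y y' : M} : EvenSpan j d y → EvenSpan j d y' → EvenSpan j d (y + y')
  | neg {j d : ℕ} {y : M} : EvenSpan j d y → EvenSpan j d (-y)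
  | mul {j d e a : ℕ} {y : M} : e = a + d → EvenSpan j d y → EvenSpan (j + 1) e (S.E a • y)

/-- Sums of products of `j` factors `E a` or `E' a`, at most one of them odd, applied to `w` or
`H' a w`, with one odd factor in all and total degree `d`. -/
inductive OddSpan : ℕ → ℕ → M → Prop
  | base (d : ℕ) : OddSpan 0 d (S.H' d • w)
  | zero (j d : ℕ) : OddSpan j d 0
  | add {j d : ℕ} {y y' : M} : OddSpan j d y → OddSpan j d y' → OddSpan j d (y + y')
  | neg {j d : ℕ} {y : M} : OddSpan j d y → OddSpan j d (-y)
  | mul {j d e a : ℕ} {y : M} : e = a + d → OddSpan j d y → OddSpan (j + 1) e (S.E a • y)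
  | mul' {j d e a : ℕ} {y : M} : e = a + d → EvenSpan S w j d y → OddSpan (j + 1) e (S.E' a • y)

variable {S w}

theorem two_smul_right (x : A) (y : M) : (2 * x) • y = x • y + x • y := by
  rw [two_mul, add_smul]

namespace EvenSpan

theorem sub {j d : ℕ} {y y' : M} (h : EvenSpan S w j d y) (h' : EvenSpan S w j d y') :
    EvenSpan S w j d (y - y') := by
  rw [sub_eq_add_neg]
  exact h.add h'.neg

/-- Without factors `E a` only integer multiples of `w` occur, and those have degree zero. -/
theorem eq_zero {j d : ℕ} {y : M} (h : EvenSpan S w j d y) (hj : j = 0) (hd : d ≠ 0) : y = 0 := by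
  induction h with
  | base => exact absurd rfl hd
  | zero => rfl
  | add _ _ ih ih' => rw [ih hj hd, ih' hj hd, add_zero]
  | neg _ ih => rw [ih hj hd, neg_zero]
  | mul => omega

theorem H_smul (hH : ∀ a, S.H (a + 1) • w = 0) (c : ℕ) {j d : ℕ} {y : M} (h : EvenSpan S w j d y) :
    ∀ e, e = c + 1 + d → EvenSpan S w j e (S.H (c + 1) • y) := by
  induction h with
  | base => intro e _; rw [hH]; exact zero _ _
  | zero => intro e _; rw [smul_zero]; exact zero _ _
  | add _ _ ih ih' => intro e he; rw [smul_add]; exact (ih e he).add (ih' e he)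
  | neg _ ih => intro e he; rw [smul_neg]; exact (ih e he).neg
  | @mul j d e' a y he' hy ih =>
    intro e he
    rw [smul_smul, S.HE, add_smul, mul_smul, two_smul_right]
    exact (mul (by omega) (ih _ rfl)).add
      ((mul (d := d) (by omega) hy).add (mul (d := d) (by omega) hy))

/-- Moving `F c` past `E a` leaves `-H (a + c + 1)`, which keeps the number of the remaining factors
and adds its degree. Since `F c` kills `w`, it removes exactly one factor and raises the degree by
`c + 1`. -/
theorem F_smul (hH : ∀ a, S.H (a + 1) • w = 0) (hF : ∀ a, S.F a • w = 0) (c : ℕ) {j d : ℕ} {y : M}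
    (h : EvenSpan S w j d y) :
    (j = 0 → S.F c • y = 0) ∧
      ∀ i e, j = i + 1 → e = c + 1 + d → EvenSpan S w i e (S.F c • y) := by
  induction h with
  | base => exact ⟨fun _ => hF c, fun i e h => by omega⟩
  | zero =>
    rw [smul_zero]
    exact ⟨fun _ => rfl, fun i e _ _ => zero _ _⟩
  | add _ _ ih ih' =>
    rw [smul_add]
    exact ⟨fun h => by rw [ih.1 h, ih'.1 h, add_zero],
      fun i e h he => (ih.2 i e h he).add (ih'.2 i e h he)⟩
  | neg _ ih =>
    rw [smul_neg]
    exact ⟨fun h => by rw [ih.1 h, neg_zero], fun i e h he => (ih.2 i e h he).neg⟩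
  | @mul j d e' a y he' hy ih =>
    refine ⟨fun h => by omega, fun i e hi he => ?_⟩
    obtain rfl : j = i := by omega
    have h1 : S.F c • S.E a • y = S.E a • S.F c • y - S.H (a + c + 1) • y := by
      rw [smul_smul, smul_smul, S.EF, add_smul, add_sub_cancel_right]
    rw [h1]
    refine sub ?_ (hy.H_smul hH _ _ (by omega))
    rcases j with _ | j
    · rw [ih.1 rfl, smul_zero]
      exact zero _ _
    · exact mul (by omega) (ih.2 j _ rfl rfl)

theorem F_pow_smul (hH : ∀ a, S.H (a + 1) • w = 0) (hF : ∀ a, S.F a • w = 0) (n : ℕ) {j d : ℕ}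
    {y : M} (h : EvenSpan S w (j + n) d y) : EvenSpan S w j (d + n) (S.F 0 ^ n • y) := by
  induction n generalizing d y with
  | zero => simpa using h
  | succ n ih =>
    rw [pow_succ, mul_smul]
    have := ih ((h.F_smul hH hF 0).2 (j + n) (1 + d) rfl (by omega))
    rwa [show 1 + d + n = d + (n + 1) by ring] at this

theorem H'_smul (c : ℕ) {j d : ℕ} {y : M} (h : EvenSpan S w j d y) :
    ∀ e, e = c + d → OddSpan S w j e (S.H' c • y) := by
  induction h with
  | base => rintro e rfl; exact .base _
  | zero => intro e _; rw [smul_zero]; exact .zero _ _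
  | add _ _ ih ih' => intro e he; rw [smul_add]; exact (ih e he).add (ih' e he)
  | neg _ ih => intro e he; rw [smul_neg]; exact (ih e he).neg
  | @mul j d e' a y he' hy ih =>
    intro e he
    rw [smul_smul, S.H'E, add_smul, mul_smul, two_smul_right]
    exact (OddSpan.mul (by omega) (ih _ rfl)).add
      ((OddSpan.mul' (d := d) (by omega) hy).add (OddSpan.mul' (d := d) (by omega) hy))

theorem E_pow (S : IwahoriSystem A) (w : M) (n : ℕ) : EvenSpan S w n 0 (S.E 0 ^ n • w) := by
  induction n with
  | zero => simpa using base
  | succ n ih =>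
    rw [pow_succ', mul_smul]
    exact mul (by simp) ih

end EvenSpan

namespace OddSpan

theorem sub {j d : ℕ} {y y' : M} (h : OddSpan S w j d y) (h' : OddSpan S w j d y') :
    OddSpan S w j d (y - y') := by
  rw [sub_eq_add_neg]
  exact h.add h'.neg

theorem H_smul (hH : ∀ a, S.H (a + 1) • w = 0) (c : ℕ) {j d : ℕ} {y : M} (h : OddSpan S w j d y) :
    ∀ e, e = c + 1 + d → OddSpan S w j e (S.H (c + 1) • y) := by
  induction h with
  | base => intro e _; rw [smul_smul, S.HH', mul_smul, hH, smul_zero]; exact zero _ _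
  | zero => intro e _; rw [smul_zero]; exact zero _ _
  | add _ _ ih ih' => intro e he; rw [smul_add]; exact (ih e he).add (ih' e he)
  | neg _ ih => intro e he; rw [smul_neg]; exact (ih e he).neg
  | @mul j d e' a y he' hy ih =>
    intro e he
    rw [smul_smul, S.HE, add_smul, mul_smul, two_smul_right]
    exact (mul (by omega) (ih _ rfl)).add
      ((mul (d := d) (by omega) hy).add (mul (d := d) (by omega) hy))
  | @mul' j d e' a y he' hy =>
    intro e he
    rw [smul_smul, S.HE', add_smul, mul_smul, two_smul_right]
    exact (mul' (by omega) (hy.H_smul hH _ _ rfl)).add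
      ((mul' (d := d) (by omega) hy).add (mul' (d := d) (by omega) hy))

theorem F_smul (hH : ∀ a, S.H (a + 1) • w = 0) (hF : ∀ a, S.F a • w = 0)
    (hF' : ∀ a, S.F' a • w = 0) (c : ℕ) {j d : ℕ} {y : M} (h : OddSpan S w j d y) :
    (j = 0 → S.F c • y = 0) ∧
      ∀ i e, j = i + 1 → e = c + 1 + d → OddSpan S w i e (S.F c • y) := by
  induction h with
  | base d =>
    refine ⟨fun _ => ?_, fun i e h => by omega⟩
    have h1 := congrArg (· • w) (S.H'F d c)
    simp only [sub_smul, mul_smul, hF, hF', smul_zero, sub_zero] at h1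
    exact h1.symm
  | zero =>
    rw [smul_zero]
    exact ⟨fun _ => rfl, fun i e _ _ => zero _ _⟩
  | add _ _ ih ih' =>
    rw [smul_add]
    exact ⟨fun h => by rw [ih.1 h, ih'.1 h, add_zero],
      fun i e h he => (ih.2 i e h he).add (ih'.2 i e h he)⟩
  | neg _ ih =>
    rw [smul_neg]
    exact ⟨fun h => by rw [ih.1 h, neg_zero], fun i e h he => (ih.2 i e h he).neg⟩
  | @mul j d e' a y he' hy ih =>
    refine ⟨fun h => by omega, fun i e hi he => ?_⟩
    obtain rfl : j = i := by omega
    have h1 : S.F c • S.E a • y = S.E a • S.F c • y - S.H (a + c + 1) • y := by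
      rw [smul_smul, smul_smul, S.EF, add_smul, add_sub_cancel_right]
    rw [h1]
    refine sub ?_ (hy.H_smul hH _ _ (by omega))
    rcases j with _ | j
    · rw [ih.1 rfl, smul_zero]
      exact zero _ _
    · exact mul (by omega) (ih.2 j _ rfl rfl)
  | @mul' j d e' a y he' hy =>
    refine ⟨fun h => by omega, fun i e hi he => ?_⟩
    obtain rfl : j = i := by omega
    have h1 : S.F c • S.E' a • y = S.E' a • S.F c • y - S.H' (a + c + 1) • y := by
      rw [smul_smul, smul_smul, S.E'F, add_smul, add_sub_cancel_right]
    rw [h1]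
    refine sub ?_ (hy.H'_smul _ _ (by omega))
    rcases j with _ | j
    · rw [(hy.F_smul hH hF c).1 rfl, smul_zero]
      exact zero _ _
    · exact mul' (by omega) ((hy.F_smul hH hF c).2 j _ rfl rfl)

theorem F_pow_smul (hH : ∀ a, S.H (a + 1) • w = 0) (hF : ∀ a, S.F a • w = 0)
    (hF' : ∀ a, S.F' a • w = 0) (n : ℕ) {j d : ℕ}
    {y : M} (h : OddSpan S w (j + n) d y) : OddSpan S w j (d + n) (S.F 0 ^ n • y) := by
  induction n generalizing d y with
  | zero => simpa using h
  | succ n ih =>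
    rw [pow_succ, mul_smul]
    have := ih ((h.F_smul hH hF hF' 0).2 (j + n) (1 + d) rfl (by omega))
    rwa [show 1 + d + n = d + (n + 1) by ring] at this

theorem H'_zero_smul (hH' : S.H' 0 • w = 0) {j d : ℕ} {y : M} (h : OddSpan S w j d y)
    (hj : j = 0) : S.H' 0 • y = 0 := by
  induction h with
  | base d => rw [smul_smul, S.H'H', neg_smul, mul_smul, hH', smul_zero, neg_zero]
  | zero => rw [smul_zero]
  | add _ _ ih ih' => rw [smul_add, ih hj, ih' hj, add_zero]
  | neg _ ih => rw [smul_neg, ih hj, neg_zero]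
  | mul => omega
  | mul' => omega

end OddSpan

theorem eq_zero_of_natCast_smul [IsAddTorsionFree M] {n : ℕ} (hn : n ≠ 0) {y : M}
    (h : (n : A) • y = 0) : y = 0 := by
  rw [Nat.cast_smul_eq_nsmul] at h
  exact (nsmul_eq_zero_iff_right hn).1 h

theorem oddSpan_odd (S : IwahoriSystem A) (w : M) (n : ℕ) :
    OddSpan S w (0 + (n + 1)) 0 (S.H' 0 • S.E 0 ^ (n + 1) • w) := by
  rw [zero_add]
  exact (EvenSpan.E_pow S w (n + 1)).H'_smul 0 _ rfl

namespace IsLow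

variable {n : ℕ}

/-- The powers of `F 0` strip off all factors `E 0` and leave a multiple of `w` in degree `n + 1`,
which must vanish. -/
theorem F_pow_smul_top (hw : S.IsLow (n + 1) w) : S.F 0 ^ (n + 1) • S.E 0 ^ (n + 1) • w = 0 := by
  have h := EvenSpan.E_pow S w (n + 1)
  rw [← zero_add (n + 1)] at h
  have h1 := (h.F_pow_smul hw.H hw.F (n + 1)).eq_zero rfl (by omega)
  rwa [zero_add] at h1

/-- After `n + 1` applications of `F 0` an integer multiple of `H' (n + 1) • w` is left. One more
kills it, because `F` commutes with `H'` up to `F'` and both annihilate `w`. -/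
theorem F_pow_smul_odd (hw : S.IsLow (n + 1) w) :
    S.F 0 ^ (n + 2) • S.H' 0 • S.E 0 ^ (n + 1) • w = 0 := by
  rw [pow_succ', mul_smul]
  exact (((oddSpan_odd S w n).F_pow_smul hw.H hw.F hw.F' (n + 1)).F_smul hw.H hw.F hw.F' 0).1 rfl

theorem H'_smul_bottom (hw : S.IsLow (n + 1) w) :
    S.H' 0 • S.F 0 ^ (n + 1) • S.H' 0 • S.E 0 ^ (n + 1) • w = 0 :=
  ((oddSpan_odd S w n).F_pow_smul hw.H hw.F hw.F' (n + 1)).H'_zero_smul hw.H' rfl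

variable [IsAddTorsionFree M]

/-- In the commutator of `F a` with `E 0 ^ (n + 2)`, applied to `w`, every term vanishes except
`(n+1)(n+2)` times this vector. -/
theorem E_smul_pow (hw : S.IsLow (n + 1) w) (a : ℕ) : S.E (a + 1) • S.E 0 ^ n • w = 0 := by
  have h := congrArg (· • w) (mul_pow_add_two_of_comm (f := S.F a)
    (by rw [S.EF 0 a, zero_add, add_sub_cancel_right]) (S.HE (a + 1) 0) (S.EE 0 (a + 1)) n)
  simp only [sub_smul, mul_smul, hw.F, hw.H, show S.E 0 ^ (n + 2) • w = 0 from hw.E, smul_zero,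
    sub_zero, zero_sub] at h
  exact eq_zero_of_natCast_smul (A := A) (by positivity) (neg_eq_zero.1 h.symm)

theorem H_smul_top (hw : S.IsLow (n + 1) w) (a : ℕ) : S.H (a + 1) • S.E 0 ^ (n + 1) • w = 0 := by
  rw [smul_smul, mul_pow_succ_of_comm (S.HE (a + 1) 0) (S.EE 0 (a + 1)), add_smul, mul_smul, hw.H,
    mul_smul, mul_smul, add_zero, hw.E_smul_pow, smul_zero, smul_zero, add_zero]

theorem E_smul_top (hw : S.IsLow (n + 1) w) (a : ℕ) : S.E a • S.E 0 ^ (n + 1) • w = 0 := by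
  rcases a with _ | a
  · rw [smul_smul, ← pow_succ']
    exact hw.E
  · rw [pow_succ', mul_smul, smul_smul, S.EE, mul_smul, hw.E_smul_pow, smul_zero]

/-- For index `a + 1` put `X = E 0 ^ (n+2) • H' (a+1) • w` and `Y = E' (a+1) • E 0 ^ (n+1) • w`.
Commuting `H' (a+1)` past `E 0 ^ (n+2)` gives `X + 2(n+2) Y = 0`. Commuting `F' a` past it, dividing
by `n + 2` and applying `E 0` gives `X + (n+1) Y = 0`. The difference is `(n+3) Y = 0`. For index
`0` the term `X` is already zero. -/
theorem E'_smul_top (hw : S.IsLow (n + 1) w) (a : ℕ) : S.E' a • S.E 0 ^ (n + 1) • w = 0 := by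
  have h0 := congrArg (· • w) (mul_pow_succ_of_comm (S.H'E a 0) (S.EE' 0 a) (n + 1))
  simp only [add_smul, mul_smul, show S.E 0 ^ (n + 1 + 1) • w = 0 from hw.E, smul_zero,
    add_zero] at h0
  rcases a with _ | a
  · rw [hw.H', smul_zero, zero_add] at h0
    exact eq_zero_of_natCast_smul (A := A) (by positivity) h0.symm
  · have h := congrArg (· • w) (mul_pow_add_two_of_comm (f := S.F' a)
      (by rw [S.EF' 0 a, zero_add, add_sub_cancel_right]) (S.H'E (a + 1) 0) (S.EE' 0 (a + 1)) n)
    simp only [sub_smul, mul_smul, hw.F', show S.E 0 ^ (n + 2) • w = 0 from hw.E, smul_zero,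
      zero_sub, add_zero] at h
    have h1 : S.E 0 ^ (n + 1) • S.H' (a + 1) • w + ((n + 1 : ℕ) : A) • S.E' (a + 1) • S.E 0 ^ n • w
        = 0 := by
      apply eq_zero_of_natCast_smul (A := A) (n := n + 2) (by positivity)
      rw [smul_add, smul_smul ((n + 2 : ℕ) : A) ((n + 1 : ℕ) : A), ← Nat.cast_mul, mul_comm (n + 2)]
      rw [← neg_eq_zero, neg_add, ← sub_eq_add_neg]
      exact h.symm
    have h2 := congrArg (S.E 0 • ·) h1
    simp only [smul_add, smul_zero] at h2
    rw [smul_smul (S.E 0) (S.E 0 ^ (n + 1)), ← pow_succ', smul_smul (S.E 0) ((n + 1 : ℕ) : A),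
      ← Nat.cast_comm, mul_smul, smul_smul (S.E 0) (S.E' (a + 1)), S.EE', mul_smul,
      smul_smul (S.E 0) (S.E 0 ^ n), ← pow_succ'] at h2
    rw [eq_neg_of_add_eq_zero_left h2, neg_add_eq_sub, ← sub_smul, ← Nat.cast_sub (by omega)] at h0
    exact eq_zero_of_natCast_smul (A := A) (by omega) h0.symm

theorem E_smul_odd (hw : S.IsLow (n + 1) w) (a : ℕ) :
    S.E a • S.H' 0 • S.E 0 ^ (n + 1) • w = 0 := by
  have h := congrArg (· • (S.E 0 ^ (n + 1) • w)) (S.H'E 0 a)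
  simp only [add_smul, mul_smul, hw.E_smul_top, hw.E'_smul_top, zero_add, smul_zero,
    add_zero] at h
  exact h.symm

theorem E'_smul_odd (hw : S.IsLow (n + 1) w) (a : ℕ) :
    S.E' a • S.H' 0 • S.E 0 ^ (n + 1) • w = 0 := by
  have h := congrArg (· • (S.E 0 ^ (n + 1) • w)) (S.H'E' 0 a)
  simp only [neg_smul, mul_smul, hw.E'_smul_top, smul_zero] at h
  exact neg_eq_zero.1 h.symm

theorem H_smul_odd (hw : S.IsLow (n + 1) w) (a : ℕ) :
    S.H (a + 1) • S.H' 0 • S.E 0 ^ (n + 1) • w = 0 := by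
  rw [smul_smul, S.HH', mul_smul, hw.H_smul_top, smul_zero]

theorem H'_smul_H' (y : M) : S.H' 0 • S.H' 0 • y = 0 := by
  have h := S.H'H' 0 0
  apply eq_zero_of_natCast_smul (A := A) (n := 2) (by positivity)
  rw [Nat.cast_two, two_smul, smul_smul, ← add_smul, eq_neg_iff_add_eq_zero.1 h, zero_smul]

/-- The third vector of the chain is a low vector for the exchanged system. The relations of the
fourth vector are thus those of the second, read after the swap. -/
theorem swap_odd (hw : S.IsLow (n + 1) w) :
    S.swap.IsLow (n + 1) (S.H' 0 • S.E 0 ^ (n + 1) • w) where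
  H a := by
    change -S.H (a + 1) • _ = _
    rw [neg_smul, hw.H_smul_odd, neg_zero]
  H' := by
    change -S.H' 0 • _ = _
    rw [neg_smul, H'_smul_H', neg_zero]
  F := hw.E_smul_odd
  F' := hw.E'_smul_odd
  E := hw.F_pow_smul_odd

theorem F_smul_bottom (hw : S.IsLow (n + 1) w) (a : ℕ) :
    S.F a • S.F 0 ^ (n + 1) • S.H' 0 • S.E 0 ^ (n + 1) • w = 0 :=
  hw.swap_odd.E_smul_top a

theorem F'_smul_bottom (hw : S.IsLow (n + 1) w) (a : ℕ) :
    S.F' a • S.F 0 ^ (n + 1) • S.H' 0 • S.E 0 ^ (n + 1) • w = 0 :=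
  hw.swap_odd.E'_smul_top a

theorem H_smul_bottom (hw : S.IsLow (n + 1) w) (a : ℕ) :
    S.H (a + 1) • S.F 0 ^ (n + 1) • S.H' 0 • S.E 0 ^ (n + 1) • w = 0 := by
  have h : -S.H (a + 1) • S.F 0 ^ (n + 1) • S.H' 0 • S.E 0 ^ (n + 1) • w = 0 :=
    hw.swap_odd.H_smul_top a
  rwa [neg_smul, neg_eq_zero] at h

theorem E_pow_smul_bottom (hw : S.IsLow (n + 1) w) :
    S.E 0 ^ (n + 1) • S.F 0 ^ (n + 1) • S.H' 0 • S.E 0 ^ (n + 1) • w = 0 :=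
  hw.swap_odd.F_pow_smul_top

end IsLow

end IwahoriSystem

end Systems

/-! ### The bigrading of `U(𝕴[ξ])` -/

section GradedEnvelope

variable {k : Type*} [Field k]

attribute [local instance 100] LieRing.ofAssociativeRing

variable (k) in
/-- The elements `e z^a`, `f z^(a+1)`, `h z^a` and their odd counterparts in `U(𝕴[ξ])`. -/
def stdSystem : IwahoriSystem (U k) where
  E a := ev k (eZ k a)
  F a := ev k (fZ k a)
  H a := ev k (hZ k a)
  E' a := od k (eZ k a)
  F' a := od k (fZ k a)
  H' a := od k (hZ k a)
  EE a b := by rw [ev_mul_ev, lie_eZ_eZ, ev_zero, add_zero]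
  FF a b := by rw [ev_mul_ev, lie_fZ_fZ, ev_zero, add_zero]
  HE a b := by rw [ev_mul_ev, lie_hZ_eZ, ev_smul, ofNat_smul_eq_nsmul, two_nsmul, two_mul]
  HF a b := by
    rw [ev_mul_ev, lie_hZ_fZ, ev_smul, neg_smul, ofNat_smul_eq_nsmul, two_nsmul, two_mul,
      ← sub_eq_add_neg]
  EF a b := by rw [ev_mul_ev, lie_eZ_fZ]
  EE' a b := by rw [ev_mul_od, lie_eZ_eZ, od_zero, add_zero]
  FF' a b := by rw [ev_mul_od, lie_fZ_fZ, od_zero, add_zero]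
  HE' a b := by rw [ev_mul_od, lie_hZ_eZ, od_smul, ofNat_smul_eq_nsmul, two_nsmul, two_mul]
  HF' a b := by
    rw [ev_mul_od, lie_hZ_fZ, od_smul, neg_smul, ofNat_smul_eq_nsmul, two_nsmul, two_mul,
      ← sub_eq_add_neg]
  H'E a b := by
    rw [ev_mul_od, ← lie_skew, lie_hZ_eZ, ← neg_smul, od_smul, neg_smul, ofNat_smul_eq_nsmul,
      two_nsmul, two_mul, add_comm a b, neg_add_cancel_right]
  H'F a b := by
    rw [ev_mul_od, ← lie_skew, lie_hZ_fZ, ← neg_smul, neg_neg, od_smul, ofNat_smul_eq_nsmul,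
      two_nsmul, two_mul, add_comm a b, add_sub_cancel_right]
  HH' a b := by rw [ev_mul_od, lie_hZ_hZ, od_zero, add_zero]
  EF' a b := by rw [ev_mul_od, lie_eZ_fZ]
  E'F a b := by
    rw [ev_mul_od, ← lie_skew, lie_eZ_fZ, ← neg_one_smul k, od_smul, neg_one_smul,
      neg_add_cancel_right]
  H'E' a b := eq_neg_of_add_eq_zero_left (od_mul_od _ _)
  H'F' a b := eq_neg_of_add_eq_zero_left (od_mul_od _ _)
  H'H' a b := eq_neg_of_add_eq_zero_left (od_mul_od _ _)

theorem isHomogeneousZ_eZ (a : ℕ) : IsHomogeneousZ k a (eZ k a) := by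
  intro i j
  fin_cases i <;> fin_cases j
  exacts [⟨0, (Polynomial.monomial_zero_right a).symm⟩, ⟨1, (Polynomial.X_pow_eq_monomial a)⟩,
    ⟨0, (Polynomial.monomial_zero_right a).symm⟩, ⟨0, (Polynomial.monomial_zero_right a).symm⟩]

theorem isHomogeneousZ_fZ (a : ℕ) : IsHomogeneousZ k (a + 1) (fZ k a) := by
  intro i j
  fin_cases i <;> fin_cases j
  exacts [⟨0, (Polynomial.monomial_zero_right _).symm⟩,
    ⟨0, (Polynomial.monomial_zero_right _).symm⟩,
    ⟨1, (Polynomial.X_pow_eq_monomial _)⟩, ⟨0, (Polynomial.monomial_zero_right _).symm⟩]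

theorem isHomogeneousZ_hZ (a : ℕ) : IsHomogeneousZ k a (hZ k a) := by
  intro i j
  fin_cases i <;> fin_cases j
  exacts [⟨1, (Polynomial.X_pow_eq_monomial a)⟩, ⟨0, (Polynomial.monomial_zero_right a).symm⟩,
    ⟨0, (Polynomial.monomial_zero_right a).symm⟩, ⟨-1, by
      rw [map_neg, ← Polynomial.X_pow_eq_monomial]; rfl⟩]

theorem IsHomogeneousZ.hCoeff_eq_zero {a : ℕ} {x : iwahori k} (hx : IsHomogeneousZ k a x)
    (ha : a ≠ 0) : hCoeff k x = 0 := by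
  obtain ⟨c, hc⟩ := hx 0 0
  rw [hCoeff, hc, Polynomial.coeff_monomial, if_neg ha]

theorem one_mem_gradedU : (1 : U k) ∈ gradedU k 0 0 := Submodule.subset_span .one

theorem ev_mul_mem_gradedU {a b c : ℕ} {x : iwahori k} {y : U k} (hx : IsHomogeneousZ k c x)
    (hy : y ∈ gradedU k a b) : ev k x * y ∈ gradedU k (c + a) b := by
  induction hy using Submodule.span_induction with
  | mem y hy => exact Submodule.subset_span (.ev_mul hx hy)
  | zero => rw [mul_zero]; exact zero_mem _
  | add y y' _ _ h h' => rw [mul_add]; exact add_mem h h'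
  | smul r y _ h => rw [mul_smul_comm]; exact Submodule.smul_mem _ _ h

theorem od_mul_mem_gradedU {a b c : ℕ} {x : iwahori k} {y : U k} (hx : IsHomogeneousZ k c x)
    (hy : y ∈ gradedU k a b) : od k x * y ∈ gradedU k (c + a) (b + 1) := by
  induction hy using Submodule.span_induction with
  | mem y hy => exact Submodule.subset_span (.od_mul hx hy)
  | zero => rw [mul_zero]; exact zero_mem _
  | add y y' _ _ h h' => rw [mul_add]; exact add_mem h h'
  | smul r y _ h => rw [mul_smul_comm]; exact Submodule.smul_mem _ _ h

theorem ev_mem_gradedU {c : ℕ} {x : iwahori k} (hx : IsHomogeneousZ k c x) :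
    ev k x ∈ gradedU k c 0 := by
  simpa using ev_mul_mem_gradedU hx one_mem_gradedU

theorem od_mem_gradedU {c : ℕ} {x : iwahori k} (hx : IsHomogeneousZ k c x) :
    od k x ∈ gradedU k c 1 := by
  simpa using od_mul_mem_gradedU hx one_mem_gradedU

theorem IsBihomogeneous.mul_mem {a b c d : ℕ} {x y : U k} (hx : IsBihomogeneous a b x)
    (hy : y ∈ gradedU k c d) : x * y ∈ gradedU k (a + c) (b + d) := by
  induction hx with
  | one => simpa using hy
  | ev_mul h _ ih => rw [mul_assoc, add_assoc]; exact ev_mul_mem_gradedU h ih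
  | od_mul h _ ih =>
    rw [mul_assoc, add_assoc, add_right_comm]
    exact od_mul_mem_gradedU h ih

theorem mul_mem_gradedU {a b c d : ℕ} {x y : U k} (hx : x ∈ gradedU k a b)
    (hy : y ∈ gradedU k c d) : x * y ∈ gradedU k (a + c) (b + d) := by
  induction hx using Submodule.span_induction with
  | mem x hx => exact hx.mul_mem hy
  | zero => rw [zero_mul]; exact zero_mem _
  | add y y' _ _ h h' => rw [add_mul]; exact add_mem h h'
  | smul r y _ h => rw [smul_mul_assoc]; exact Submodule.smul_mem _ _ h

theorem pow_mem_gradedU {a : ℕ} {x : U k} (hx : x ∈ gradedU k a 0) (n : ℕ) :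
    x ^ n ∈ gradedU k (n * a) 0 := by
  induction n with
  | zero => simpa using one_mem_gradedU
  | succ n ih =>
    have h := mul_mem_gradedU ih hx
    rwa [← pow_succ, add_zero, ← Nat.succ_mul] at h

/-- The scalar added by the twist is nonzero only on generators of `z`-degree zero, where it has the
same bidegree as the generator. -/
theorem twist_mem_gradedU (s : k) {a b : ℕ} {u : U k} (hu : u ∈ gradedU k a b) :
    twist s u ∈ gradedU k a b := by
  induction hu using Submodule.span_induction with
  | mem x hx =>
    induction hx with
    | one => rw [map_one]; exact one_mem_gradedU
    | @ev_mul a b c x y h _ ih =>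
      rw [map_mul, twist_ev, add_mul, ← Algebra.smul_def]
      refine add_mem (ev_mul_mem_gradedU h ih) ?_
      by_cases hc : c = 0
      · subst hc
        rw [zero_add]
        exact Submodule.smul_mem _ _ ih
      · rw [h.hCoeff_eq_zero hc, mul_zero, zero_smul]
        exact zero_mem _
    | od_mul h _ ih => rw [map_mul, twist_od]; exact od_mul_mem_gradedU h ih
  | zero => rw [map_zero]; exact zero_mem _
  | add y y' _ _ h h' => rw [map_add]; exact add_mem h h'
  | smul r y _ h => rw [map_smul]; exact Submodule.smul_mem _ _ h

theorem iSup_gradedU : ⨆ d : ℕ × ℕ, gradedU k d.1 d.2 = ⊤ := by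
  have hle : ∀ a b, gradedU k a b ≤ ⨆ d : ℕ × ℕ, gradedU k d.1 d.2 :=
    fun a b => le_iSup (fun d : ℕ × ℕ => gradedU k d.1 d.2) (a, b)
  apply env_eq_top
  · exact hle 0 0 one_mem_gradedU
  · intro x y hy
    induction hy using Submodule.iSup_induction' with
    | mem d y hy =>
      induction x using iwahori_span_induction with
      | he a => exact hle _ _ (ev_mul_mem_gradedU (isHomogeneousZ_eZ a) hy)
      | hh a => exact hle _ _ (ev_mul_mem_gradedU (isHomogeneousZ_hZ a) hy)
      | hf a => exact hle _ _ (ev_mul_mem_gradedU (isHomogeneousZ_fZ a) hy)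
      | hadd x x' h h' => rw [ev_add, add_mul]; exact add_mem h h'
      | hsmul c x h => rw [ev_smul, smul_mul_assoc]; exact Submodule.smul_mem _ _ h
    | zero => rw [mul_zero]; exact zero_mem _
    | add y y' _ _ h h' => rw [mul_add]; exact add_mem h h'
  · intro x y hy
    induction hy using Submodule.iSup_induction' with
    | mem d y hy =>
      induction x using iwahori_span_induction with
      | he a => exact hle _ _ (od_mul_mem_gradedU (isHomogeneousZ_eZ a) hy)
      | hh a => exact hle _ _ (od_mul_mem_gradedU (isHomogeneousZ_hZ a) hy)
      | hf a => exact hle _ _ (od_mul_mem_gradedU (isHomogeneousZ_fZ a) hy)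
      | hadd x x' h h' => rw [od_add, add_mul]; exact add_mem h h'
      | hsmul c x h => rw [od_smul, smul_mul_assoc]; exact Submodule.smul_mem _ _ h
    | zero => rw [mul_zero]; exact zero_mem _
    | add y y' _ _ h h' => rw [mul_add]; exact add_mem h h'

variable (k) in
/-- The endomorphism of `U(𝕴[ξ])` induced by `z ↦ 2z`, `ξ ↦ 3ξ`. -/
def scaleU : U k →ₐ[k] U k := envMap (scaleZ 2) (scaleZ_lie 2) 0 (fun _ _ => rfl) 3

theorem scaleU_eq_smul {a b : ℕ} {u : U k} (hu : u ∈ gradedU k a b) :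
    scaleU k u = ((2 : k) ^ a * 3 ^ b) • u := by
  induction hu using Submodule.span_induction with
  | mem x hx =>
    induction hx with
    | one => simp
    | ev_mul h _ ih =>
      rw [map_mul, ih, scaleU, envMap_ev, scaleZ_homogeneous h, ev_smul, LinearMap.zero_apply,
        map_zero, add_zero, smul_mul_smul_comm]
      congr 1
      ring
    | od_mul h _ ih =>
      rw [map_mul, ih, scaleU, envMap_od, scaleZ_homogeneous h, od_smul, smul_smul,
        smul_mul_smul_comm]
      congr 1
      ring
  | zero => rw [map_zero, smul_zero]
  | add y y' _ _ h h' => rw [map_add, smul_add, h, h']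
  | smul r y _ h => rw [map_smul, h, smul_comm]

/-- By unique factorization a single eigenvalue `2^a 3^b` records both degrees. -/
theorem two_three_injective [CharZero k] :
    Function.Injective (fun d : ℕ × ℕ => (2 : k) ^ d.1 * 3 ^ d.2) := by
  rintro ⟨a, b⟩ ⟨c, d⟩ h
  have h' : 2 ^ a * 3 ^ b = 2 ^ c * 3 ^ d := by
    simp only at h
    exact_mod_cast h
  have h2 := congrArg (fun n => n.factorization 2) h'
  have h3 := congrArg (fun n => n.factorization 3) h'
  simp [Nat.factorization_mul, Nat.prime_two.factorization, Nat.prime_three.factorization] at h2 h3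
  rw [h2, h3]

/-- The components lie in eigenspaces of `scaleU` for distinct eigenvalues, so no PBW basis is
needed. -/
theorem iSupIndep_gradedU [CharZero k] : iSupIndep fun d : ℕ × ℕ => gradedU k d.1 d.2 :=
  ((Module.End.eigenspaces_iSupIndep (scaleU k).toLinearMap).comp two_three_injective).mono
    fun _ _ hu => Module.End.mem_eigenspace_iff.2 (scaleU_eq_smul hu)

end GradedEnvelope

/-- The projections to the summands of a direct sum decomposition. -/
theorem exists_projections {k V ι : Type*} [Field k] [AddCommGroup V] [Module k V]
    {G : ι → Submodule k V} (h : iSupIndep G) (h' : ⨆ i, G i = ⊤) :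
    ∃ π : ι → V →ₗ[k] V, (∀ i, ∀ x ∈ G i, π i x = x) ∧ ∀ i j, ∀ x ∈ G j, j ≠ i → π i x = 0 := by
  classical
  have hI := DirectSum.isInternal_submodule_of_iSupIndep_of_iSup_eq_top h h'
  let e := LinearEquiv.ofBijective (DirectSum.coeLinearMap G) hI
  have he : ∀ j (x : G j), e.symm x = DirectSum.lof k ι (fun i => G i) j x := fun j x => by
    rw [LinearEquiv.symm_apply_eq]
    exact (DirectSum.coeLinearMap_lof G j x).symm
  refine ⟨fun i => (G i).subtype ∘ₗ DirectSum.component k ι (fun i => G i) i ∘ₗ e.symm.toLinearMap,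
    fun i x hx => ?_, fun i j x hx hij => ?_⟩
  · simp only [LinearMap.comp_apply, LinearEquiv.coe_coe]
    rw [he i ⟨x, hx⟩, DirectSum.component.lof_self]
    rfl
  · simp only [LinearMap.comp_apply, LinearEquiv.coe_coe]
    rw [he j ⟨x, hx⟩, DirectSum.component.of, dif_neg hij, map_zero]

theorem isAddTorsionFree_of_charZero (k V : Type*) [Field k] [CharZero k] [AddCommGroup V]
    [Module k V] : IsAddTorsionFree V where
  nsmul_right_injective {n} hn x y h := by
    have h' : (n : k) • x = (n : k) • y := by simpa only [Nat.cast_smul_eq_nsmul] using h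
    exact smul_right_injective V (Nat.cast_ne_zero.2 hn) h'

/-! ### Relations of shifted local modules -/

section Relations

variable {k : Type*} [Field k]

/-- `v` satisfies, modulo `Q`, the relations of the cyclic vector of the module `EM^loc_{mω}`
shifted by the weight `sω`. -/
def IsShiftedGen (m s : ℤ) {V : Type*} [AddCommGroup V] [Module (U k) V] (Q : Submodule (U k) V)
    (v : V) : Prop :=
  ∀ r ∈ localRelations k m, twist (-(s : k)) r • v ∈ Q

section

variable {V : Type*} [AddCommGroup V] [Module (U k) V] [Module k V] [IsScalarTower k (U k) V]
  {Q : Submodule (U k) V} {v : V}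

theorem algebraMap_smul_U (c : k) (v : V) : algebraMap k (U k) c • v = c • v :=
  algebraMap_smul (U k) c v

theorem twist_weight_smul {m s : ℤ} (h : ev k (hZ k 0) • v = ((m + s : ℤ) : k) • v) :
    twist (-(s : k)) (ev k (hZ k 0) - algebraMap k (U k) (m : k)) • v = 0 := by
  rw [map_sub, twist_ev, AlgHom.commutes, hCoeff_hZ_zero, mul_one, sub_smul, add_smul, h,
    algebraMap_smul_U, algebraMap_smul_U, ← add_smul, ← sub_smul, Int.cast_add,
    add_neg_cancel_right, sub_self, zero_smul]

theorem isShiftedGen_neg {n : ℕ} {s : ℤ} (h : ev k (hZ k 0) • v = ((-(n : ℤ) + s : ℤ) : k) • v)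
    (h' : od k (hZ k 0) • v ∈ Q) (hf : ∀ a, ev k (fZ k a) • v ∈ Q)
    (hf' : ∀ a, od k (fZ k a) • v ∈ Q) (he : ev k (eZ k 0) ^ (n + 1) • v ∈ Q)
    (hh : ∀ a, ev k (hZ k (a + 1)) • v ∈ Q) : IsShiftedGen (-(n : ℤ)) s Q v := by
  rintro r ((hr | hr) | ⟨a, rfl⟩)
  · rcases hr with rfl | rfl
    · rw [twist_weight_smul h]
      exact Q.zero_mem
    · rwa [twist_od]
  · rw [if_neg (by omega)] at hr
    rcases hr with (⟨a, rfl⟩ | ⟨a, rfl⟩) | rfl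
    · simpa using hf a
    · simpa using hf' a
    · simpa using he
  · simpa using hh a

theorem isShiftedGen_pos {n : ℕ} {s : ℤ} (h : ev k (hZ k 0) • v = (((n : ℤ) + 1 + s : ℤ) : k) • v)
    (h' : od k (hZ k 0) • v ∈ Q) (hf : ∀ a, ev k (eZ k a) • v ∈ Q)
    (hf' : ∀ a, od k (eZ k a) • v ∈ Q) (he : ev k (fZ k 0) ^ (n + 1) • v ∈ Q)
    (hh : ∀ a, ev k (hZ k (a + 1)) • v ∈ Q) : IsShiftedGen ((n : ℤ) + 1) s Q v := by
  rintro r ((hr | hr) | ⟨a, rfl⟩)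
  · rcases hr with rfl | rfl
    · rw [twist_weight_smul h]
      exact Q.zero_mem
    · rwa [twist_od]
  · rw [if_pos (by omega)] at hr
    rcases hr with (⟨a, rfl⟩ | ⟨a, rfl⟩) | rfl
    · simpa using hf a
    · simpa using hf' a
    · have : ((n : ℤ) + 1).toNat = n + 1 := by omega
      simpa [this] using he
  · simpa using hh a

end

/-- Homogeneity makes `scaleU` multiply each relation by a scalar, which is why the operator
descends to the local module. -/
theorem localRelations_homogeneous {m : ℤ} {r : U k} (hr : r ∈ localRelations k m) :
    ∃ a b, r ∈ gradedU k a b := by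
  rcases hr with (hr | hr) | ⟨a, rfl⟩
  · rcases hr with rfl | rfl
    · refine ⟨0, 0, sub_mem (ev_mem_gradedU (isHomogeneousZ_hZ 0)) ?_⟩
      rw [Algebra.algebraMap_eq_smul_one]
      exact Submodule.smul_mem _ _ one_mem_gradedU
    · exact ⟨0, 1, od_mem_gradedU (isHomogeneousZ_hZ 0)⟩
  · split_ifs at hr
    · rcases hr with (⟨a, rfl⟩ | ⟨a, rfl⟩) | rfl
      · exact ⟨a, 0, ev_mem_gradedU (isHomogeneousZ_eZ a)⟩
      · exact ⟨a, 1, od_mem_gradedU (isHomogeneousZ_eZ a)⟩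
      · exact ⟨_, 0, pow_mem_gradedU (ev_mem_gradedU (isHomogeneousZ_fZ 0)) _⟩
    · rcases hr with (⟨a, rfl⟩ | ⟨a, rfl⟩) | rfl
      · exact ⟨a + 1, 0, ev_mem_gradedU (isHomogeneousZ_fZ a)⟩
      · exact ⟨a + 1, 1, od_mem_gradedU (isHomogeneousZ_fZ a)⟩
      · exact ⟨_, 0, pow_mem_gradedU (ev_mem_gradedU (isHomogeneousZ_eZ 0)) _⟩
  · exact ⟨a + 1, 0, ev_mem_gradedU (isHomogeneousZ_hZ (a + 1))⟩

end Relations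

/-! ### Universal property and grading of the local modules -/

section LocalModule

variable {k : Type*} [Field k] {m : ℤ}

theorem mk_eq_smul_gen (u : U k) : (Submodule.Quotient.mk u : EMloc k m) = u • gen k m := by
  rw [gen, ← Submodule.Quotient.mk_smul, smul_eq_mul, mul_one]

theorem exists_smul_gen (y : EMloc k m) : ∃ u : U k, y = u • gen k m := by
  obtain ⟨u, rfl⟩ := Submodule.Quotient.mk_surjective _ y
  exact ⟨u, mk_eq_smul_gen u⟩

theorem smul_gen_eq_zero_iff (u : U k) :
    u • gen k m = 0 ↔ u ∈ Submodule.span (U k) (localRelations k m) := by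
  rw [← mk_eq_smul_gen, Submodule.Quotient.mk_eq_zero]

theorem relation_smul_gen {r : U k} (hr : r ∈ localRelations k m) : r • gen k m = 0 :=
  (smul_gen_eq_zero_iff r).2 (Submodule.subset_span hr)

theorem span_gen : Submodule.span (U k) {gen k m} = ⊤ := by
  rw [eq_top_iff]
  intro y _
  obtain ⟨u, rfl⟩ := exists_smul_gen y
  exact Submodule.smul_mem _ _ (Submodule.mem_span_singleton_self _)

/-- A linear map on `U(𝕴[ξ])` that kills the left ideal of relations descends to the local
module. -/
def liftEM {V : Type*} [AddCommGroup V] [Module k V] (g : U k →ₗ[k] V)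
    (hg : ∀ u : U k, ∀ r ∈ localRelations k m, g (u * r) = 0) : EMloc k m →ₗ[k] V :=
  (((Submodule.span (U k) (localRelations k m)).restrictScalars k).liftQ g (by
    intro x hx
    rw [Submodule.restrictScalars_mem] at hx
    rw [LinearMap.mem_ker]
    suffices ∀ u : U k, g (u * x) = 0 by simpa using this 1
    induction hx using Submodule.span_induction with
    | mem r hr => exact fun u => hg u r hr
    | zero => intro u; rw [mul_zero, map_zero]
    | add y y' _ _ h h' => intro u; rw [mul_add, map_add, h, h', add_zero]
    | smul a y _ h => intro u; rw [smul_eq_mul, ← mul_assoc]; exact h _)).comp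
  (Submodule.Quotient.restrictScalarsEquiv k _).symm.toLinearMap

theorem liftEM_smul_gen {V : Type*} [AddCommGroup V] [Module k V] (g : U k →ₗ[k] V)
    (hg : ∀ u : U k, ∀ r ∈ localRelations k m, g (u * r) = 0) (u : U k) :
    liftEM g hg (u • gen k m) = g u := by
  rw [← mk_eq_smul_gen]
  rfl

theorem mem_gradedEM_iff {a b : ℕ} {y : EMloc k m} :
    y ∈ gradedEM k m a b ↔ ∃ u ∈ gradedU k a b, y = u • gen k m := by
  constructor
  · rintro ⟨u, hu, rfl⟩
    exact ⟨u, hu, mk_eq_smul_gen u⟩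
  · rintro ⟨u, hu, rfl⟩
    exact ⟨u, hu, mk_eq_smul_gen u⟩

theorem iSup_gradedEM : ⨆ d : ℕ × ℕ, gradedEM k m d.1 d.2 = ⊤ := by
  rw [eq_top_iff]
  intro y _
  obtain ⟨u, rfl⟩ := exists_smul_gen y
  have hu : u ∈ ⨆ d : ℕ × ℕ, gradedU k d.1 d.2 := iSup_gradedU (k := k) ▸ Submodule.mem_top
  induction hu using Submodule.iSup_induction' with
  | mem d u hu => exact Submodule.mem_iSup_of_mem d (mem_gradedEM_iff.2 ⟨u, hu, rfl⟩)
  | zero => rw [zero_smul]; exact zero_mem _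
  | add u u' _ _ h h' => rw [add_smul]; exact add_mem (h trivial) (h' trivial)

variable (k m) in
/-- The operator on the local module induced by `z ↦ 2z`, `ξ ↦ 3ξ`. -/
def scaleEM : EMloc k m →ₗ[k] EMloc k m :=
  liftEM ((LinearMap.toSpanSingleton (U k) (EMloc k m) (gen k m)).restrictScalars k ∘ₗ
      (scaleU k).toLinearMap) (by
    intro u r hr
    obtain ⟨a, b, h⟩ := localRelations_homogeneous hr
    change scaleU k (u * r) • gen k m = 0
    rw [map_mul, scaleU_eq_smul h, mul_smul, smul_assoc, relation_smul_gen hr, smul_zero,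
      smul_zero])

theorem scaleEM_smul_gen (u : U k) : scaleEM k m (u • gen k m) = scaleU k u • gen k m :=
  liftEM_smul_gen _ _ u

theorem scaleEM_eq_smul {a b : ℕ} {y : EMloc k m} (hy : y ∈ gradedEM k m a b) :
    scaleEM k m y = ((2 : k) ^ a * 3 ^ b) • y := by
  obtain ⟨u, hu, rfl⟩ := mem_gradedEM_iff.1 hy
  rw [scaleEM_smul_gen, scaleU_eq_smul hu, smul_assoc]

theorem iSupIndep_gradedEM [CharZero k] : iSupIndep fun d : ℕ × ℕ => gradedEM k m d.1 d.2 :=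
  ((Module.End.eigenspaces_iSupIndep (scaleEM k m)).comp two_three_injective).mono
    fun _ _ hu => Module.End.mem_eigenspace_iff.2 (scaleEM_eq_smul hu)

theorem commute_scaleEM : Commute (Algebra.lsmul k k (EMloc k m) (ev k (hZ k 0)))
    (scaleEM k m) := by
  apply LinearMap.ext
  intro y
  obtain ⟨u, rfl⟩ := exists_smul_gen y
  change ev k (hZ k 0) • scaleEM k m (u • gen k m) = scaleEM k m (ev k (hZ k 0) • u • gen k m)
  rw [smul_smul, scaleEM_smul_gen, scaleEM_smul_gen, map_mul,
    scaleU_eq_smul (ev_mem_gradedU (isHomogeneousZ_hZ 0)), pow_zero, pow_zero, mul_one, one_smul,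
    mul_smul]

/-- The pieces lie in joint eigenspaces of the commuting operators `h` and `scaleEM`, whose pairs of
eigenvalues determine the weight and both degrees. -/
theorem iSupIndep_pieceEM [CharZero k] : iSupIndep (pieceEM k m) := by
  have h := Module.End.independent_iInf_maxGenEigenspace_of_forall_mapsTo
    ![Algebra.lsmul k k (EMloc k m) (ev k (hZ k 0)), scaleEM k m] (by
      intro i j φ
      apply Module.End.mapsTo_maxGenEigenspace_of_comm
      fin_cases i <;> fin_cases j
      exacts [Commute.refl _, commute_scaleEM.symm, commute_scaleEM, Commute.refl _])
  have hinj : Function.Injective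
      (fun d : ℤ × ℕ × ℕ => (![(d.1 : k), 2 ^ d.2.1 * 3 ^ d.2.2] : Fin 2 → k)) := by
    rintro ⟨n, d⟩ ⟨n', d'⟩ hd
    have h0 := congrFun hd 0
    have h1 := congrFun hd 1
    simp only [Matrix.cons_val_zero, Int.cast_inj] at h0
    have h2 : d = d' := two_three_injective (k := k) h1
    rw [h0, h2]
  refine (h.comp hinj).mono fun d => le_iInf fun i => ?_
  fin_cases i
  · exact inf_le_left.trans (Module.End.genEigenspace_le_maximal _ _ _)
  · refine inf_le_right.trans (le_trans ?_ (Module.End.genEigenspace_le_maximal _ _ 1))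
    exact fun y hy => Module.End.mem_eigenspace_iff.2 (scaleEM_eq_smul hy)

theorem weight_smul_gen : ev k (hZ k 0) • gen k m = (m : k) • gen k m := by
  have h := relation_smul_gen (k := k) (m := m) (.inl (.inl (.inl rfl)))
  rwa [sub_smul, algebraMap_smul_U, sub_eq_zero] at h

theorem isLow_gen (n : ℕ) : (stdSystem k).IsLow n (gen k (-(n : ℤ))) where
  H a := relation_smul_gen (.inr ⟨a, rfl⟩)
  H' := relation_smul_gen (.inl (.inl (.inr rfl)))
  F a := relation_smul_gen (.inl (.inr (by rw [if_neg (by omega)]; exact .inl (.inl ⟨a, rfl⟩))))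
  F' a := relation_smul_gen (.inl (.inr (by rw [if_neg (by omega)]; exact .inl (.inr ⟨a, rfl⟩))))
  E := relation_smul_gen (.inl (.inr (by
    rw [if_neg (by omega), neg_neg, Int.toNat_natCast]
    exact .inr rfl)))

theorem isLow_swap_gen (n : ℕ) : (stdSystem k).swap.IsLow n (gen k ((n : ℤ) + 1)) where
  H a := by
    have h : ev k (hZ k (a + 1)) • gen k ((n : ℤ) + 1) = 0 := relation_smul_gen (.inr ⟨a, rfl⟩)
    change -ev k (hZ k (a + 1)) • _ = _
    rw [neg_smul, h, neg_zero]
  H' := by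
    have h : od k (hZ k 0) • gen k ((n : ℤ) + 1) = 0 := relation_smul_gen (.inl (.inl (.inr rfl)))
    change -od k (hZ k 0) • _ = _
    rw [neg_smul, h, neg_zero]
  F a := relation_smul_gen (.inl (.inr (by rw [if_pos (by omega)]; exact .inl (.inl ⟨a, rfl⟩))))
  F' a := relation_smul_gen (.inl (.inr (by rw [if_pos (by omega)]; exact .inl (.inr ⟨a, rfl⟩))))
  E := relation_smul_gen (.inl (.inr (by
    rw [if_pos (by omega), show ((n : ℤ) + 1).toNat = n + 1 by omega]
    exact .inr rfl)))

end LocalModule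

/-! ### Elements homogeneous for the weight and both degrees -/

section HomogeneousElements

variable {k : Type*} [Field k]

/-- `u` has `ad h`-weight `d.1`, `z`-degree `d.2.1` and `ξ`-degree `d.2.2`. -/
structure IsHomU (d : ℤ × ℕ × ℕ) (u : U k) : Prop where
  mem : u ∈ gradedU k d.2.1 d.2.2
  weight : ev k (hZ k 0) * u = u * ev k (hZ k 0) + (d.1 : k) • u

namespace IsHomU

theorem mul {d d' : ℤ × ℕ × ℕ} {u u' : U k} (h : IsHomU d u) (h' : IsHomU d' u') :
    IsHomU (d + d') (u * u') where
  mem := mul_mem_gradedU h.mem h'.mem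
  weight := by
    rw [← mul_assoc, h.weight, add_mul, mul_assoc, h'.weight, mul_add, ← mul_assoc, Prod.fst_add,
      Int.cast_add, add_smul, smul_mul_assoc, mul_smul_comm]
    abel

theorem one : IsHomU 0 (1 : U k) where
  mem := one_mem_gradedU
  weight := by simp

theorem pow {d : ℤ × ℕ × ℕ} {u : U k} (h : IsHomU d u) (n : ℕ) : IsHomU (n • d) (u ^ n) := by
  induction n with
  | zero => simpa using one
  | succ n ih => rw [succ_nsmul, pow_succ]; exact ih.mul h

theorem twist (s : k) {d : ℤ × ℕ × ℕ} {u : U k} (h : IsHomU d u) : IsHomU d (twist s u) where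
  mem := twist_mem_gradedU s h.mem
  weight := by
    have := congrArg (MacdonaldSL2.twist s) h.weight
    rw [map_mul, map_add, map_mul, map_smul, twist_ev, add_mul, mul_add,
      Algebra.commutes] at this
    rw [add_right_comm] at this
    exact add_right_cancel this

theorem eZ_zero : IsHomU (2, 0, 0) (ev k (eZ k 0)) where
  mem := ev_mem_gradedU (isHomogeneousZ_eZ 0)
  weight := by
    have h := (stdSystem k).HE 0 0
    change ev k (hZ k 0) * ev k (eZ k 0) = ev k (eZ k 0) * ev k (hZ k 0) + 2 * ev k (eZ k 0) at h
    rw [h, Int.cast_ofNat, Algebra.smul_def, map_ofNat]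

theorem fZ_zero : IsHomU (-2, 1, 0) (ev k (fZ k 0)) where
  mem := ev_mem_gradedU (isHomogeneousZ_fZ 0)
  weight := by
    have h := (stdSystem k).HF 0 0
    change ev k (hZ k 0) * ev k (fZ k 0) = ev k (fZ k 0) * ev k (hZ k 0) - 2 * ev k (fZ k 0) at h
    rw [h, Int.cast_neg, Int.cast_ofNat, neg_smul, Algebra.smul_def, map_ofNat, sub_eq_add_neg]

theorem hZ_zero : IsHomU (0, 0, 1) (od k (hZ k 0)) where
  mem := od_mem_gradedU (isHomogeneousZ_hZ 0)
  weight := by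
    have h := (stdSystem k).HH' 0 0
    change ev k (hZ k 0) * od k (hZ k 0) = od k (hZ k 0) * ev k (hZ k 0) at h
    rw [h, Int.cast_zero, zero_smul, add_zero]

variable {V : Type*} [AddCommGroup V] [Module (U k) V] [Module k V] [IsScalarTower k (U k) V]

theorem weight_smul {d : ℤ × ℕ × ℕ} {u : U k} (h : IsHomU d u) {m : ℤ} {v : V}
    (hv : ev k (hZ k 0) • v = (m : k) • v) :
    ev k (hZ k 0) • u • v = ((m + d.1 : ℤ) : k) • u • v := by
  have hc : u • (m : k) • v = (m : k) • u • v := by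
    rw [← algebraMap_smul_U, ← algebraMap_smul_U, smul_smul, smul_smul, Algebra.commutes]
  rw [smul_smul, h.weight, add_smul, mul_smul, hv, hc, smul_assoc, Int.cast_add, add_smul]

theorem smul_gen_mem {d : ℤ × ℕ × ℕ} {u : U k} (h : IsHomU d u) {m : ℤ} :
    u • gen k m ∈ pieceEM k m (d + (m, 0, 0)) := by
  refine ⟨Module.End.mem_eigenspace_iff.2 ?_, mem_gradedEM_iff.2 ⟨u, h.mem, rfl⟩⟩
  rw [Prod.fst_add, add_comm]
  exact h.weight_smul weight_smul_gen

end IsHomU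

end HomogeneousElements

/-! ### The chains of cyclic submodules -/

section Chains

variable {k : Type*} [Field k]
  {V : Type*} [AddCommGroup V] [Module (U k) V] [Module k V] [IsScalarTower k (U k) V]

/-- If `P` is generated by a vector that satisfies the relations of a shifted local module modulo
`Q`, then `P` is spanned modulo `Q` by the images of a spanning set of the local module. -/
theorem IsShiftedGen.mem_of_span {m s : ℤ} {Q : Submodule (U k) V} {v : V}
    (h : IsShiftedGen m s Q v) {ι : Type*} {u : ι → U k}
    (hu : Submodule.span k (Set.range fun i => u i • gen k m) = ⊤) {W : Submodule k V}
    (hQ : ∀ y ∈ Q, y ∈ W) (hW : ∀ i, twist (-(s : k)) (u i) • v ∈ W) :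
    ∀ y ∈ Submodule.span (U k) {v}, y ∈ W := by
  let π : V →ₗ[k] V ⧸ Q := Q.mkQ.restrictScalars k
  have hπ : ∀ y, π y = 0 ↔ y ∈ Q := fun y => Submodule.Quotient.mk_eq_zero Q
  -- Untwisting the weight shift makes `g` kill the relations, so it factors through the local
  -- module, where `hu` controls its image.
  let g : U k →ₗ[k] V ⧸ Q := π ∘ₗ (LinearMap.toSpanSingleton (U k) V v).restrictScalars k ∘ₗ
    (twist (-(s : k))).toLinearMap
  have hg : ∀ u, g u = π (twist (-(s : k)) u • v) := fun _ => rfl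
  have hrel : ∀ u : U k, ∀ r ∈ localRelations k m, g (u * r) = 0 := by
    intro u r hr
    rw [hg, hπ, map_mul, mul_smul]
    exact Q.smul_mem _ (h r hr)
  have hle : LinearMap.range (liftEM g hrel) ≤ W.map π := by
    rw [LinearMap.range_eq_map, ← hu, Submodule.map_span, Submodule.span_le]
    rintro _ ⟨_, ⟨i, rfl⟩, rfl⟩
    rw [liftEM_smul_gen, hg]
    exact ⟨_, hW i, rfl⟩
  intro y hy
  obtain ⟨x, rfl⟩ := Submodule.mem_span_singleton.1 hy
  obtain ⟨z, hz, hz'⟩ := hle ⟨twist (s : k) x • gen k m, rfl⟩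
  have htw : twist (-(s : k)) (twist (s : k) x) = x := by
    simpa using twist_twist (-(s : k)) x
  rw [liftEM_smul_gen, hg, htw] at hz'
  have h1 : x • v - z ∈ Q := by rw [← hπ, map_sub, hz', sub_self]
  simpa using W.add_mem (hQ _ h1) hz

/-- Each vector satisfies every relation of the smaller module exactly, with one exception that
holds only modulo the next vector: the power of `e` for `w`, `hξ` for `v₁`, the power of `fz` for
`v₂`. For `v₃` there is no exception. -/
theorem lowChain [CharZero k] {n : ℕ} {w : V} (hw : (stdSystem k).IsLow (n + 1) w)
    (h : ev k (hZ k 0) • w = ((-((n : ℤ) + 1) : ℤ) : k) • w) :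
    let v₁ := ev k (eZ k 0) ^ (n + 1) • w
    let v₂ := od k (hZ k 0) • v₁
    let v₃ := ev k (fZ k 0) ^ (n + 1) • v₂
    IsShiftedGen (k := k) (-(n : ℤ)) (-1) (Submodule.span (U k) {v₁}) w ∧
    IsShiftedGen (k := k) ((n : ℤ) + 1) 0 (Submodule.span (U k) {v₂}) v₁ ∧
    IsShiftedGen (k := k) ((n : ℤ) + 1) 0 (Submodule.span (U k) {v₃}) v₂ ∧
    IsShiftedGen (k := k) (-(n : ℤ)) (-1) ⊥ v₃ := by
  intro v₁ v₂ v₃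
  have : IsAddTorsionFree V := isAddTorsionFree_of_charZero k V
  have hv₁ : ev k (hZ k 0) • v₁ = (((n : ℤ) + 1 + 0 : ℤ) : k) • v₁ := by
    rw [(IsHomU.eZ_zero.pow (n + 1)).weight_smul h]
    congr 2
    simp
    ring
  have hv₂ : ev k (hZ k 0) • v₂ = (((n : ℤ) + 1 + 0 : ℤ) : k) • v₂ := by
    rw [IsHomU.hZ_zero.weight_smul hv₁, add_zero]
  have hv₃ : ev k (hZ k 0) • v₃ = ((-(n : ℤ) + -1 : ℤ) : k) • v₃ := by
    rw [(IsHomU.fZ_zero.pow (n + 1)).weight_smul hv₂]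
    congr 2
    simp
    ring
  have mem : ∀ {Q : Submodule (U k) V} {y : V}, y = 0 → y ∈ Q := fun h => h ▸ Submodule.zero_mem _
  refine ⟨isShiftedGen_neg ?_ (mem hw.H') (fun a => mem (hw.F a)) (fun a => mem (hw.F' a))
      (Submodule.mem_span_singleton_self v₁) (fun a => mem (hw.H a)),
    isShiftedGen_pos hv₁ (Submodule.mem_span_singleton_self v₂) (fun a => mem (hw.E_smul_top a))
      (fun a => mem (hw.E'_smul_top a)) (mem hw.F_pow_smul_top) (fun a => mem (hw.H_smul_top a)),
    isShiftedGen_pos hv₂ (mem (IwahoriSystem.IsLow.H'_smul_H' (S := stdSystem k) v₁))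
      (fun a => mem (hw.E_smul_odd a)) (fun a => mem (hw.E'_smul_odd a))
      (Submodule.mem_span_singleton_self v₃) (fun a => mem (hw.H_smul_odd a)),
    isShiftedGen_neg hv₃ (mem hw.H'_smul_bottom) (fun a => mem (hw.F_smul_bottom a))
      (fun a => mem (hw.F'_smul_bottom a)) (mem hw.E_pow_smul_bottom)
      (fun a => mem (hw.H_smul_bottom a))⟩
  rw [h]
  congr 2
  ring

theorem highChain [CharZero k] {n : ℕ} {w : V} (hw : (stdSystem k).swap.IsLow (n + 1) w)
    (h : ev k (hZ k 0) • w = (((n : ℤ) + 2 : ℤ) : k) • w) :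
    let v₁ := ev k (fZ k 0) ^ (n + 1) • w
    let v₂ := od k (hZ k 0) • v₁
    let v₃ := ev k (eZ k 0) ^ (n + 1) • v₂
    IsShiftedGen (k := k) ((n : ℤ) + 1) 1 (Submodule.span (U k) {v₁}) w ∧
    IsShiftedGen (k := k) (-(n : ℤ)) 0 (Submodule.span (U k) {v₂}) v₁ ∧
    IsShiftedGen (k := k) (-(n : ℤ)) 0 (Submodule.span (U k) {v₃}) v₂ ∧
    IsShiftedGen (k := k) ((n : ℤ) + 1) 1 ⊥ v₃ := by
  intro v₁ v₂ v₃
  have : IsAddTorsionFree V := isAddTorsionFree_of_charZero k V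
  have hv₁ : ev k (hZ k 0) • v₁ = ((-(n : ℤ) + 0 : ℤ) : k) • v₁ := by
    rw [(IsHomU.fZ_zero.pow (n + 1)).weight_smul h]
    congr 2
    simp
    ring
  have hv₂ : ev k (hZ k 0) • v₂ = ((-(n : ℤ) + 0 : ℤ) : k) • v₂ := by
    rw [IsHomU.hZ_zero.weight_smul hv₁, add_zero]
  have hv₃ : ev k (hZ k 0) • v₃ = (((n : ℤ) + 1 + 1 : ℤ) : k) • v₃ := by
    rw [(IsHomU.eZ_zero.pow (n + 1)).weight_smul hv₂]
    congr 2
    simp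
    ring
  have mem : ∀ {Q : Submodule (U k) V} {y : V}, y = 0 → y ∈ Q := fun h => h ▸ Submodule.zero_mem _
  have neg : ∀ {x : U k} {y : V}, -x • y = 0 → x • y = 0 := fun {x y} h => by
    rwa [neg_smul, neg_eq_zero] at h
  -- The swapped system negates `H'`, so its chain agrees with `v₂` and `v₃` only up to sign.
  have e₂ : (stdSystem k).swap.H' 0 • (stdSystem k).swap.E 0 ^ (n + 1) • w = -v₂ :=
    neg_smul (od k (hZ k 0)) v₁
  have e₃ : (stdSystem k).swap.F 0 ^ (n + 1) • (stdSystem k).swap.H' 0 •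
      (stdSystem k).swap.E 0 ^ (n + 1) • w = -v₃ := by
    rw [e₂]
    exact smul_neg _ _
  have neg₂ : ∀ {x : U k}, x • (stdSystem k).swap.H' 0 • (stdSystem k).swap.E 0 ^ (n + 1) • w = 0 →
      x • v₂ = 0 := fun {x} h => by rwa [e₂, smul_neg, neg_eq_zero] at h
  have neg₃ : ∀ {x : U k}, x • (stdSystem k).swap.F 0 ^ (n + 1) • (stdSystem k).swap.H' 0 •
      (stdSystem k).swap.E 0 ^ (n + 1) • w = 0 → x • v₃ = 0 := fun {x} h => by
    rwa [e₃, smul_neg, neg_eq_zero] at h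
  refine ⟨isShiftedGen_pos ?_ (mem (neg hw.H')) (fun a => mem (hw.F a)) (fun a => mem (hw.F' a))
      (Submodule.mem_span_singleton_self v₁) (fun a => mem (neg (hw.H a))),
    isShiftedGen_neg hv₁ (Submodule.mem_span_singleton_self v₂) (fun a => mem (hw.E_smul_top a))
      (fun a => mem (hw.E'_smul_top a)) (mem hw.F_pow_smul_top)
      (fun a => mem (neg (hw.H_smul_top a))),
    isShiftedGen_neg hv₂ (mem (IwahoriSystem.IsLow.H'_smul_H' (S := stdSystem k) v₁))
      (fun a => mem (neg₂ (hw.E_smul_odd a))) (fun a => mem (neg₂ (hw.E'_smul_odd a)))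
      (Submodule.mem_span_singleton_self v₃) (fun a => mem (neg (neg₂ (hw.H_smul_odd a)))),
    isShiftedGen_pos hv₃ (mem (neg (neg₃ hw.H'_smul_bottom)))
      (fun a => mem (neg₃ (hw.F_smul_bottom a)))
      (fun a => mem (neg₃ (hw.F'_smul_bottom a))) (mem (neg₃ hw.E_pow_smul_bottom))
      (fun a => mem (neg (neg₃ (hw.H_smul_bottom a))))⟩
  rw [h]
  congr 2

end Chains

/-! ### The space of dimension `4 ^ n` underlying the fusion module -/

section SpinSystems

universe v

/-- `n` commuting actions of the `2 × 2` matrices and `n` anticommuting odd variables on a space of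
dimension `4 ^ n`, generated by a lowest vector `w`. -/
structure SpinSystem (k : Type v) [Field k] (n : ℕ) (M : Type v) [AddCommGroup M] [Module k M] where
  mat : Fin n → Matrix (Fin 2) (Fin 2) k →ₐ[k] Module.End k M
  odd : Fin n → Module.End k M
  w : M
  mat_comm : ∀ i j x y, i ≠ j → mat i x * mat j y = mat j y * mat i x
  odd_mat : ∀ i j x, odd i * mat j x = mat j x * odd i
  odd_odd : ∀ i j, odd i * odd j + odd j * odd i = 0
  mat_w : ∀ i x, x 0 1 = 0 → mat i x w = x 1 1 • w
  -- Cyclicity is required under these operators only, because interpolation in `z` extracts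
  -- precisely them from the action of the current algebra.
  generated : ∀ W : Submodule k M, w ∈ W → (∀ i, ∀ y ∈ W, mat i !![0, 1; 0, 0] y ∈ W) →
    (∀ i, ∀ y ∈ W, (odd i * mat i !![1, 0; 0, -1]) y ∈ W) → W = ⊤

variable {k : Type v} [Field k]

/-- `2 × 2` matrices acting on `k² ⊗ k² ⊗ M` through the first factor. -/
def matAct (M : Type v) [AddCommGroup M] [Module k M] :
    Matrix (Fin 2) (Fin 2) k →ₐ[k] Module.End k (Fin 2 → Fin 2 → M) where
  toFun x :=
    { toFun := fun v a b => x a 0 • v 0 b + x a 1 • v 1 b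
      map_add' := fun v v' => by
        ext a b
        simp only [Pi.add_apply, smul_add]
        abel
      map_smul' := fun c v => by
        ext a b
        simp only [Pi.smul_apply, smul_add, RingHom.id_apply]
        rw [smul_comm c, smul_comm c] }
  map_one' := by
    refine LinearMap.ext fun v => funext fun a => funext fun b => ?_
    fin_cases a <;> simp
  map_mul' x y := by
    refine LinearMap.ext fun v => funext fun a => funext fun b => ?_
    simp only [Matrix.mul_apply, Fin.sum_univ_two, LinearMap.coe_mk, AddHom.coe_mk,
      Module.End.mul_apply]
    module
  map_zero' := by
    refine LinearMap.ext fun v => funext fun a => funext fun b => ?_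
    simp
  map_add' x y := by
    refine LinearMap.ext fun v => funext fun a => funext fun b => ?_
    simp only [Matrix.add_apply, LinearMap.coe_mk, AddHom.coe_mk, LinearMap.add_apply, Pi.add_apply]
    module
  commutes' r := by
    refine LinearMap.ext fun v => funext fun a => funext fun b => ?_
    fin_cases a <;> simp [Matrix.algebraMap_matrix_apply, Module.algebraMap_end_apply]

theorem matAct_apply {M : Type v} [AddCommGroup M] [Module k M] (x : Matrix (Fin 2) (Fin 2) k)
    (v : Fin 2 → Fin 2 → M) (a b : Fin 2) :
    matAct M x v a b = x a 0 • v 0 b + x a 1 • v 1 b := rfl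

/-- Endomorphisms of `M` acting on `k² ⊗ k² ⊗ M`. -/
def endAct (M : Type v) [AddCommGroup M] [Module k M] :
    Module.End k M →ₐ[k] Module.End k (Fin 2 → Fin 2 → M) where
  toFun φ :=
    { toFun := fun v a b => φ (v a b)
      map_add' := fun v v' => by ext a b; simp
      map_smul' := fun c v => by ext a b; simp }
  map_one' := rfl
  map_mul' _ _ := rfl
  map_zero' := rfl
  map_add' _ _ := rfl
  commutes' _ := rfl

theorem endAct_apply {M : Type v} [AddCommGroup M] [Module k M] (φ : Module.End k M)
    (v : Fin 2 → Fin 2 → M) (a b : Fin 2) : endAct M φ v a b = φ (v a b) := rfl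

/-- The parity operator of the second factor of `k² ⊗ k² ⊗ M`. -/
def parityAct (k : Type v) [Field k] (M : Type v) [AddCommGroup M] [Module k M] :
    Module.End k (Fin 2 → Fin 2 → M) where
  toFun v a := ![v a 0, -v a 1]
  map_add' v v' := by
    ext a b
    fin_cases b <;> simp [add_comm]
  map_smul' c v := by
    ext a b
    fin_cases b <;> simp

/-- The raising operator of the second factor of `k² ⊗ k² ⊗ M`. -/
def raiseAct (k : Type v) [Field k] (M : Type v) [AddCommGroup M] [Module k M] :
    Module.End k (Fin 2 → Fin 2 → M) where
  toFun v a := ![0, v a 0]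
  map_add' v v' := by
    ext a b
    fin_cases b <;> simp
  map_smul' c v := by
    ext a b
    fin_cases b <;> simp

section

variable {M : Type v} [AddCommGroup M] [Module k M]

theorem parityAct_zero (v : Fin 2 → Fin 2 → M) (a : Fin 2) : parityAct k M v a 0 = v a 0 := rfl
theorem parityAct_one (v : Fin 2 → Fin 2 → M) (a : Fin 2) : parityAct k M v a 1 = -v a 1 := rfl
theorem raiseAct_zero (v : Fin 2 → Fin 2 → M) (a : Fin 2) : raiseAct k M v a 0 = 0 := rfl
theorem raiseAct_one (v : Fin 2 → Fin 2 → M) (a : Fin 2) : raiseAct k M v a 1 = v a 0 := rfl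

theorem end_ext {φ ψ : Module.End k (Fin 2 → Fin 2 → M)} (h : ∀ v a, φ v a 0 = ψ v a 0)
    (h' : ∀ v a, φ v a 1 = ψ v a 1) : φ = ψ := by
  apply LinearMap.ext
  intro v
  funext a b
  fin_cases b
  · exact h v a
  · exact h' v a

theorem matAct_endAct (x : Matrix (Fin 2) (Fin 2) k) (φ : Module.End k M) :
    matAct M x * endAct M φ = endAct M φ * matAct M x := by
  apply end_ext <;> intro v a <;>
    simp [matAct_apply, endAct_apply]

theorem parityAct_matAct (x : Matrix (Fin 2) (Fin 2) k) :
    parityAct k M * matAct M x = matAct M x * parityAct k M := by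
  apply end_ext <;> intro v a <;>
    simp [matAct_apply, parityAct_zero, parityAct_one, add_comm]

theorem parityAct_endAct (φ : Module.End k M) :
    parityAct k M * endAct M φ = endAct M φ * parityAct k M := by
  apply end_ext <;> intro v a <;>
    simp [endAct_apply, parityAct_zero, parityAct_one]

theorem raiseAct_matAct (x : Matrix (Fin 2) (Fin 2) k) :
    raiseAct k M * matAct M x = matAct M x * raiseAct k M := by
  apply end_ext <;> intro v a <;>
    simp [matAct_apply, raiseAct_zero, raiseAct_one]

theorem raiseAct_endAct (φ : Module.End k M) :
    raiseAct k M * endAct M φ = endAct M φ * raiseAct k M := by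
  apply end_ext <;> intro v a <;>
    simp [endAct_apply, raiseAct_zero, raiseAct_one]

theorem raiseAct_raiseAct : raiseAct k M * raiseAct k M = 0 := by
  apply end_ext <;> intro v a <;>
    simp [raiseAct_zero, raiseAct_one]

theorem raiseAct_parityAct : raiseAct k M * parityAct k M + parityAct k M * raiseAct k M = 0 := by
  apply end_ext <;> intro v a <;>
    simp [raiseAct_zero, raiseAct_one, parityAct_zero, parityAct_one]

theorem parityAct_parityAct : parityAct k M * parityAct k M = 1 := by
  apply end_ext <;> intro v a <;>
    simp [parityAct_zero, parityAct_one]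

end

namespace SpinSystem

/-- The system on the one-dimensional space. -/
def point : SpinSystem k 0 k where
  mat i := i.elim0
  odd i := i.elim0
  w := 1
  mat_comm i := i.elim0
  odd_mat i := i.elim0
  odd_odd i := i.elim0
  mat_w i := i.elim0
  generated W h _ _ := by
    rw [eq_top_iff]
    intro x _
    simpa using W.smul_mem x h

variable {M : Type v} [AddCommGroup M] [Module k M] {n : ℕ}

/-- The vector `y` in the component `(a, b)`. -/
def comp (a b : Fin 2) : M →ₗ[k] Fin 2 → Fin 2 → M :=
  LinearMap.single k (fun _ : Fin 2 => Fin 2 → M) a ∘ₗ LinearMap.single k (fun _ : Fin 2 => M) b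

theorem endAct_comp (φ : Module.End k M) (a b : Fin 2) (y : M) :
    endAct M φ (comp (k := k) a b y) = comp (k := k) a b (φ y) := by
  funext c d
  rw [endAct_apply]
  fin_cases a <;> fin_cases b <;> fin_cases c <;> fin_cases d <;> simp [comp]

theorem matAct_comp (x : Matrix (Fin 2) (Fin 2) k) (a b : Fin 2) (y : M) :
    matAct M x (comp (k := k) a b y) =
      x 0 a • comp (k := k) 0 b y + x 1 a • comp (k := k) 1 b y := by
  funext c d
  rw [matAct_apply]
  fin_cases a <;> fin_cases b <;> fin_cases c <;> fin_cases d <;> simp [comp]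

theorem parityAct_comp_zero (a : Fin 2) (y : M) :
    parityAct k M (comp (k := k) a 0 y) = comp (k := k) a 0 y := by
  funext c d
  fin_cases a <;> fin_cases c <;> fin_cases d <;> simp [comp, parityAct]

theorem raiseAct_comp_zero (a : Fin 2) (y : M) :
    raiseAct k M (comp (k := k) a 0 y) = comp (k := k) a 1 y := by
  funext c d
  fin_cases a <;> fin_cases c <;> fin_cases d <;> simp [comp, raiseAct]

theorem eq_sum_comp (v : Fin 2 → Fin 2 → M) : v = comp (k := k) 0 0 (v 0 0) +
    comp (k := k) 0 1 (v 0 1) + comp (k := k) 1 0 (v 1 0) + comp (k := k) 1 1 (v 1 1) := by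
  funext c d
  fin_cases c <;> fin_cases d <;> simp [comp]

/-- Adjoin one more spin and one more odd variable. -/
def succ (S : SpinSystem k n M) : SpinSystem k (n + 1) (Fin 2 → Fin 2 → M) where
  mat := Fin.cons (matAct M) fun i => (endAct M).comp (S.mat i)
  -- The parity operator supplies the sign that makes the old odd variables anticommute with the new
  -- one.
  odd := Fin.cons (raiseAct k M) fun i => parityAct k M * endAct M (S.odd i)
  w := comp (k := k) 1 0 S.w
  mat_comm i j x y hij := by
    cases i using Fin.cases <;> cases j using Fin.cases
    · exact absurd rfl hij
    · exact matAct_endAct _ _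
    · exact (matAct_endAct _ _).symm
    · simp only [Fin.cons_succ, AlgHom.comp_apply]
      rw [← map_mul (endAct M), ← map_mul (endAct M),
        S.mat_comm _ _ _ _ fun h => hij (congrArg _ h)]
  odd_mat i j x := by
    refine Fin.cases ?_ (fun i => ?_) i <;> refine Fin.cases ?_ (fun j => ?_) j <;>
      simp only [Fin.cons_succ, Fin.cons_zero, AlgHom.comp_apply]
    · exact raiseAct_matAct _
    · exact raiseAct_endAct _
    · rw [mul_assoc, ← matAct_endAct, ← mul_assoc, parityAct_matAct, mul_assoc]
    · rw [mul_assoc, ← map_mul, S.odd_mat, map_mul, ← mul_assoc, parityAct_endAct, mul_assoc]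
  odd_odd i j := by
    refine Fin.cases ?_ (fun i => ?_) i <;> refine Fin.cases ?_ (fun j => ?_) j <;>
      simp only [Fin.cons_succ, Fin.cons_zero]
    · rw [raiseAct_raiseAct, add_zero]
    · rw [← mul_assoc, mul_assoc (parityAct k M), ← raiseAct_endAct, ← mul_assoc, ← add_mul,
        raiseAct_parityAct, zero_mul]
    · rw [← mul_assoc, mul_assoc (parityAct k M), ← raiseAct_endAct, ← mul_assoc, ← add_mul,
        add_comm, raiseAct_parityAct, zero_mul]
    · have h : ∀ φ ψ : Module.End k M, parityAct k M * endAct M φ * (parityAct k M * endAct M ψ) =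
          endAct M (φ * ψ) := fun φ ψ => by
        rw [parityAct_endAct, mul_assoc, ← mul_assoc (parityAct k M), parityAct_parityAct, one_mul,
          map_mul]
      rw [h, h, ← map_add, S.odd_odd, map_zero]
  mat_w i x hx := by
    refine Fin.cases ?_ (fun i => ?_) i
    · simp only [Fin.cons_zero]
      rw [matAct_comp, hx, zero_smul, zero_add]
    · simp only [Fin.cons_succ, AlgHom.comp_apply]
      rw [endAct_comp, S.mat_w _ _ hx, map_smul]
  generated W hw he ho := by
    -- The old operators generate the component `(1, 0)`, on which parity is the identity. From
    -- there the new odd operator reaches `(1, 1)`, and the new raising matrix reaches `(0, 0)` and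
    -- `(0, 1)`.
    have h10 : ∀ y, comp (k := k) 1 0 y ∈ W := by
      have := S.generated (W.comap (comp (k := k) 1 0)) hw (fun i y hy => ?_) (fun i y hy => ?_)
      · intro y
        have hy : y ∈ W.comap (comp (k := k) 1 0) := by rw [this]; trivial
        exact hy
      · have h := he i.succ _ hy
        simp only [Fin.cons_succ, AlgHom.comp_apply] at h
        rwa [endAct_comp] at h
      · have h := ho i.succ _ hy
        simp only [Fin.cons_succ, AlgHom.comp_apply, Module.End.mul_apply] at h
        rwa [endAct_comp, endAct_comp, parityAct_comp_zero] at h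
    have h11 : ∀ y, comp (k := k) 1 1 y ∈ W := by
      intro y
      have h := ho 0 _ (h10 y)
      simp only [Fin.cons_zero, Module.End.mul_apply] at h
      rw [matAct_comp, map_add, map_smul, map_smul, raiseAct_comp_zero, raiseAct_comp_zero] at h
      simpa using h
    have h0 : ∀ b y, comp (k := k) 1 b y ∈ W → comp (k := k) 0 b y ∈ W := by
      intro b y hy
      have h := he 0 _ hy
      simp only [Fin.cons_zero] at h
      rw [matAct_comp] at h
      simpa using h
    rw [eq_top_iff]
    intro v _
    rw [eq_sum_comp (k := k) v]
    exact add_mem (add_mem (add_mem (h0 _ _ (h10 _)) (h0 _ _ (h11 _))) (h10 _)) (h11 _)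

theorem exists_spinSystem (k : Type v) [Field k] (n : ℕ) :
    ∃ (M : Type v) (_ : AddCommGroup M) (_ : Module k M),
      Module.Finite k M ∧ Module.finrank k M = 4 ^ n ∧ Nonempty (SpinSystem k n M) := by
  induction n with
  | zero => exact ⟨k, inferInstance, inferInstance, inferInstance, by simp, ⟨point⟩⟩
  | succ n ih =>
    obtain ⟨M, _, _, hf, h, ⟨S⟩⟩ := ih
    refine ⟨Fin 2 → Fin 2 → M, inferInstance, inferInstance, inferInstance, ?_, ⟨S.succ⟩⟩
    rw [Module.finrank_pi_fintype, Fin.sum_univ_two, Module.finrank_pi_fintype, Fin.sum_univ_two, h,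
      pow_succ]
    ring

end SpinSystem

end SpinSystems

/-! ### Sums of operators over commuting sites -/

section

variable {A : Type*} [Ring A] {n : ℕ}

/-- Only equal indices contribute to the commutator, so actions at separate sites add up to an
action. -/
theorem sum_mul_sum_of_commute {a b c : Fin n → A} (h : ∀ i j, i ≠ j → a i * b j = b j * a i)
    (h' : ∀ i, a i * b i = b i * a i + c i) :
    (∑ i, a i) * ∑ i, b i = (∑ i, b i) * ∑ i, a i + ∑ i, c i := by
  rw [Finset.sum_mul_sum, Finset.sum_mul_sum,
    Finset.sum_comm (f := fun i j => b i * a j), ← Finset.sum_add_distrib]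
  refine Finset.sum_congr rfl fun i _ => ?_
  rw [← sub_eq_iff_eq_add', ← Finset.sum_sub_distrib, Finset.sum_eq_single i]
  · rw [h', add_sub_cancel_left]
  · intro j _ hj
    rw [h i j hj.symm, sub_self]
  · intro hi
    exact absurd (Finset.mem_univ i) hi

theorem sum_mul_sum_of_anticommute {a b : Fin n → A} (h : ∀ i j, a i * b j + b j * a i = 0) :
    (∑ i, a i) * ∑ i, b i + (∑ i, b i) * ∑ i, a i = 0 := by
  rw [Finset.sum_mul_sum, Finset.sum_mul_sum,
    Finset.sum_comm (f := fun i j => b i * a j), ← Finset.sum_add_distrib]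
  refine Finset.sum_eq_zero fun i _ => ?_
  rw [← Finset.sum_add_distrib]
  exact Finset.sum_eq_zero fun j _ => h i j

/-- A monomial of degree `n + 1` in `n` commuting elements repeats one of them. This yields the
relation `e^(n+1) w = 0`. -/
theorem sum_pow_eq_zero_of_commute {a : Fin n → A} (h : ∀ i j, Commute (a i) (a j))
    (h' : ∀ i, a i * a i = 0) : (∑ i, a i) ^ (n + 1) = 0 := by
  induction n with
  | zero => simp
  | succ n ih =>
    rw [Fin.sum_univ_succ]
    refine Commute.add_pow_eq_zero_of_add_le_succ_of_pow_eq_zero (m := 2) (n := n + 1)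
      (Commute.sum_right _ _ _ fun i _ => h _ _) ?_ (ih (fun i j => h _ _) fun i => h' _) (by omega)
    rw [pow_two, h']

end

/-! ### The fusion module and the lower bound for the dimension -/

section Evaluation

universe v

variable {k : Type v} [Field k]

attribute [local instance 100] LieRing.ofAssociativeRing

/-- Evaluation at `z = c`. -/
def evalIw (c : k) : iwahori k →ₗ[k] Matrix (Fin 2) (Fin 2) k where
  toFun x := (Polynomial.evalRingHom c).mapMatrix x.1
  map_add' x y := map_add _ x.1 y.1
  map_smul' r x := by
    ext i j
    simp

theorem evalIw_apply (c : k) (x : iwahori k) (i j : Fin 2) :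
    evalIw c x i j = (x.1 i j).eval c := rfl

theorem evalIw_lie (c : k) (x y : iwahori k) :
    evalIw c ⁅x, y⁆ = evalIw c x * evalIw c y - evalIw c y * evalIw c x := by
  have h : (⁅x, y⁆ : iwahori k).1 = x.1 * y.1 - y.1 * x.1 := by
    rw [LieSubalgebra.coe_bracket, Ring.lie_def]
  change (Polynomial.evalRingHom c).mapMatrix (⁅x, y⁆ : iwahori k).1 = _
  rw [h, map_sub, map_mul, map_mul]
  rfl

theorem evalIw_ePoly (c : k) (p : k[X]) : evalIw c (ePoly p) = p.eval c • !![0, 1; 0, 0] := by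
  ext i j
  rw [evalIw_apply]
  fin_cases i <;> fin_cases j <;> simp [ePoly]

theorem evalIw_hPoly (c : k) (p : k[X]) : evalIw c (hPoly p) = p.eval c • !![1, 0; 0, -1] := by
  ext i j
  rw [evalIw_apply]
  fin_cases i <;> fin_cases j <;> simp [hPoly]

namespace SpinSystem

variable {M : Type v} [AddCommGroup M] [Module k M] {n : ℕ} (S : SpinSystem k n M)

/-- The action of the Iwahori algebra on the `i`-th spin, by evaluation at `z = i + 1`. -/
def site (i : Fin n) : iwahori k →ₗ[k] Module.End k M :=
  (S.mat i).toLinearMap ∘ₗ evalIw ((i : ℕ) + 1 : k)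

theorem site_apply (i : Fin n) (x : iwahori k) :
    S.site i x = S.mat i (evalIw ((i : ℕ) + 1 : k) x) := rfl

/-- The action of `x ∈ 𝕴` that is multiplied by the `i`-th odd variable to give that of `xξ`. -/
def siteOdd (i : Fin n) : iwahori k →ₗ[k] Module.End k M :=
  -- On the lowest vector `h` acts at each site by `-1`, and the character adds `1`; this is what
  -- makes `hξ` annihilate `w`.
  S.site i + Algebra.linearMap k _ ∘ₗ hCoeffL k

theorem siteOdd_apply (i : Fin n) (x : iwahori k) :
    S.siteOdd i x = S.site i x + algebraMap k _ (hCoeff k x) := rfl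

theorem site_comm {i j : Fin n} (h : i ≠ j) (x y : iwahori k) :
    S.site i x * S.site j y = S.site j y * S.site i x := S.mat_comm i j _ _ h

theorem site_lie (i : Fin n) (x y : iwahori k) :
    S.site i x * S.site i y = S.site i y * S.site i x + S.site i ⁅x, y⁆ := by
  simp only [site_apply]
  rw [evalIw_lie, map_sub, map_mul, map_mul, add_sub_cancel]

theorem odd_site (i j : Fin n) (x : iwahori k) : S.odd i * S.site j x = S.site j x * S.odd i :=
  S.odd_mat i j _

theorem odd_siteOdd (i j : Fin n) (x : iwahori k) :
    S.odd i * S.siteOdd j x = S.siteOdd j x * S.odd i := by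
  rw [siteOdd_apply, mul_add, add_mul, odd_site, Algebra.commutes]

theorem siteOdd_comm {i j : Fin n} (h : i ≠ j) (x y : iwahori k) :
    S.siteOdd i x * S.siteOdd j y = S.siteOdd j y * S.siteOdd i x := by
  simp only [siteOdd_apply, mul_add, add_mul]
  rw [S.site_comm h, Algebra.commutes (hCoeff k x) (S.site j y), Algebra.commutes (hCoeff k y)
      (S.site i x), Algebra.commutes (hCoeff k x)]
  abel

theorem site_siteOdd {i j : Fin n} (h : i ≠ j) (x y : iwahori k) :
    S.site i x * S.siteOdd j y = S.siteOdd j y * S.site i x := by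
  rw [siteOdd_apply, mul_add, add_mul, S.site_comm h, Algebra.commutes]

theorem site_w (i : Fin n) {x : iwahori k} (hx : x.1 0 1 = 0) :
    S.site i x S.w = -((x.1 0 0).eval ((i : ℕ) + 1 : k)) • S.w := by
  rw [site_apply, S.mat_w, evalIw_apply, iwahori_diag, Polynomial.eval_neg]
  rw [evalIw_apply, hx, Polynomial.eval_zero]

variable [CharZero k]

theorem odd_mul_self (i : Fin n) : S.odd i * S.odd i = 0 := by
  have h := S.odd_odd i i
  rw [← two_smul k] at h
  exact (smul_eq_zero.1 h).resolve_left two_ne_zero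

/-- The action of `U(𝕴[ξ])` on the space of a spin system. -/
def rep : U k →ₐ[k] Module.End k M :=
  envLift (∑ i, S.site i) (∑ i, LinearMap.mulLeft k (S.odd i) ∘ₗ S.siteOdd i)
    (fun x y => by
      simp only [LinearMap.sum_apply]
      exact sum_mul_sum_of_commute (fun i j h => S.site_comm h x y) fun i => S.site_lie i x y)
    (fun x y => by
      simp only [LinearMap.sum_apply, LinearMap.comp_apply, LinearMap.mulLeft_apply]
      refine sum_mul_sum_of_commute (fun i j h => ?_) fun i => ?_
      · rw [← mul_assoc, ← odd_site, mul_assoc, S.site_siteOdd h, mul_assoc]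
      · rw [← mul_assoc, ← odd_site, mul_assoc, mul_assoc, ← mul_add]
        congr 1
        rw [siteOdd_apply, siteOdd_apply, hCoeff_lie, map_zero, add_zero, mul_add, add_mul,
          site_lie, Algebra.commutes]
        abel)
    (fun x y => by
      simp only [LinearMap.sum_apply, LinearMap.comp_apply, LinearMap.mulLeft_apply]
      refine sum_mul_sum_of_anticommute fun i j => ?_
      have h : ∀ i j x y, S.odd i * S.siteOdd i x * (S.odd j * S.siteOdd j y)
          = S.odd i * S.odd j * (S.siteOdd i x * S.siteOdd j y) := fun i j x y => by
        rw [mul_assoc, ← mul_assoc (S.siteOdd i x), ← odd_siteOdd, mul_assoc, mul_assoc]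
      rw [h, h]
      by_cases hij : i = j
      · rw [hij, odd_mul_self, zero_mul, zero_mul, add_zero]
      · rw [S.siteOdd_comm hij, ← add_mul, S.odd_odd, zero_mul])

theorem rep_ev (x : iwahori k) : S.rep (ev k x) = ∑ i, S.site i x := by
  simp [rep]

theorem rep_od (x : iwahori k) : S.rep (od k x) = ∑ i, S.odd i * S.siteOdd i x := by
  simp [rep]

/-- `u ↦ u w`. -/
def orbit : U k →ₗ[k] M := LinearMap.applyₗ S.w ∘ₗ S.rep.toLinearMap

theorem orbit_apply (u : U k) : S.orbit u = S.rep u S.w := rfl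

theorem orbit_mul (u u' : U k) : S.orbit (u * u') = S.rep u (S.orbit u') := by
  rw [orbit_apply, map_mul]
  rfl

/-- The scalar is minus a power sum of the evaluation points and need not vanish. The local
relations thus hold only up to terms of lower `z`-degree, which suffices for `orbit_mem_span`. -/
theorem orbit_hZ (a : ℕ) : ∃ c : k, S.orbit (ev k (hZ k a)) = c • S.w := by
  refine ⟨∑ i : Fin n, -(((i : ℕ) + 1 : k) ^ a), ?_⟩
  rw [orbit_apply, rep_ev, LinearMap.sum_apply, Finset.sum_smul]
  refine Finset.sum_congr rfl fun i _ => ?_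
  rw [S.site_w i (hZ_01 a), hZ_00, Polynomial.eval_pow, Polynomial.eval_X]

theorem orbit_of_globalRelations {r : U k} (hr : r ∈ globalRelations k (-(n : ℤ))) :
    S.orbit r = 0 := by
  have h1 : S.orbit 1 = S.w := by rw [orbit_apply, map_one]; rfl
  rcases hr with hr | hr
  · rcases hr with rfl | rfl
    · rw [map_sub, Algebra.algebraMap_eq_smul_one, map_smul, h1, orbit_apply, rep_ev,
        LinearMap.sum_apply, Finset.sum_congr rfl fun i _ => S.site_w i (hZ_01 0)]
      simp [Nat.cast_smul_eq_nsmul]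
    · rw [orbit_apply, rep_od, LinearMap.sum_apply]
      refine Finset.sum_eq_zero fun i _ => ?_
      rw [Module.End.mul_apply, siteOdd_apply, LinearMap.add_apply, S.site_w i (hZ_01 0)]
      simp
  · rw [if_neg (by omega)] at hr
    rcases hr with (⟨a, rfl⟩ | ⟨a, rfl⟩) | rfl
    · simp only
      rw [orbit_apply, rep_ev, LinearMap.sum_apply]
      refine Finset.sum_eq_zero fun i _ => ?_
      rw [S.site_w i (fZ_01 a)]
      simp
    · simp only
      rw [orbit_apply, rep_od, LinearMap.sum_apply]
      refine Finset.sum_eq_zero fun i _ => ?_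
      rw [Module.End.mul_apply, siteOdd_apply, LinearMap.add_apply, S.site_w i (fZ_01 a)]
      simp
    · rw [neg_neg, Int.toNat_natCast, orbit_apply, map_pow, rep_ev, sum_pow_eq_zero_of_commute]
      · rfl
      · intro i j
        by_cases h : i = j
        · rw [h]
          exact Commute.refl _
        · exact S.site_comm h _ _
      · intro i
        rw [site_apply, ← map_mul, eZ_eq, evalIw_ePoly, smul_mul_smul_comm,
          show (!![0, 1; 0, 0] : Matrix (Fin 2) (Fin 2) k) * !![0, 1; 0, 0] = 0 by
            ext i j; fin_cases i <;> fin_cases j <;> simp, smul_zero, map_zero]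

/-- The points `1, …, n` are distinct from one another and from `0`. Vanishing at `0` removes the
character in `siteOdd`, so that `p h ξ` acts through the single site `i`. -/
theorem exists_interpolation (i : Fin n) : ∃ p : k[X], p.coeff 0 = 0 ∧
    ∀ j : Fin n, p.eval ((j : ℕ) + 1 : k) = if j = i then 1 else 0 := by
  have hinj : Set.InjOn (fun j : ℕ => (j : k)) (Finset.range (n + 1)) :=
    fun a _ b _ h => Nat.cast_injective h
  have hm : (i : ℕ) + 1 ∈ Finset.range (n + 1) := by simp
  refine ⟨Lagrange.basis (Finset.range (n + 1)) (fun j : ℕ => (j : k)) ((i : ℕ) + 1), ?_, ?_⟩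
  · rw [Polynomial.coeff_zero_eq_eval_zero]
    have := Lagrange.eval_basis_of_ne (v := fun j : ℕ => (j : k)) (s := Finset.range (n + 1))
      (i := (i : ℕ) + 1) (j := 0) (by omega) (by simp)
    simpa using this
  · intro j
    split_ifs with h
    · subst h
      have := Lagrange.eval_basis_self hinj hm
      simpa using this
    · have := Lagrange.eval_basis_of_ne (v := fun j : ℕ => (j : k)) (s := Finset.range (n + 1))
        (i := (i : ℕ) + 1) (j := (j : ℕ) + 1) (fun h' => h (Fin.ext (by omega)))
        (by simp)
      simpa using this

theorem range_orbit : LinearMap.range S.orbit = ⊤ := by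
  have hcl : ∀ (u : U k), ∀ y ∈ LinearMap.range S.orbit, S.rep u y ∈ LinearMap.range S.orbit := by
    rintro u _ ⟨u', rfl⟩
    exact ⟨u * u', S.orbit_mul u u'⟩
  apply S.generated
  · exact ⟨1, by rw [orbit_apply, map_one]; rfl⟩
  · intro i y hy
    obtain ⟨p, -, hp⟩ := exists_interpolation (k := k) i
    have := hcl (ev k (ePoly p)) y hy
    rw [rep_ev, Finset.sum_eq_single i] at this
    · rwa [site_apply, evalIw_ePoly, hp, if_pos rfl, one_smul] at this
    · intro j _ hj
      rw [site_apply, evalIw_ePoly, hp, if_neg hj, zero_smul, map_zero]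
    · intro h
      exact absurd (Finset.mem_univ i) h
  · intro i y hy
    obtain ⟨p, hp0, hp⟩ := exists_interpolation (k := k) i
    have := hcl (od k (hPoly p)) y hy
    have hc : hCoeff k (hPoly p) = 0 := hp0
    rw [rep_od, Finset.sum_eq_single i] at this
    · rwa [siteOdd_apply, hc, map_zero, add_zero, site_apply, evalIw_hPoly, hp, if_pos rfl,
        one_smul] at this
    · intro j _ hj
      rw [siteOdd_apply, hc, map_zero, add_zero, site_apply, evalIw_hPoly, hp, if_neg hj,
        zero_smul, map_zero, mul_zero]
    · intro h
      exact absurd (Finset.mem_univ i) h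

/-- A homogeneous spanning family of the local module also spans the spin system. -/
theorem orbit_mem_span {ι : Type*} [Finite ι] {u : ι → U k} {d : ι → ℕ × ℕ}
    (hu : ∀ i, u i ∈ gradedU k (d i).1 (d i).2)
    (hspan : Submodule.span k (Set.range fun i => u i • gen k (-(n : ℤ))) = ⊤) (a b : ℕ) :
    ∀ x ∈ gradedU k a b, S.orbit x ∈ Submodule.span k (Set.range fun i => S.orbit (u i)) := by
  classical
  have := Fintype.ofFinite ι
  obtain ⟨π, hπ, hπ'⟩ := exists_projections (iSupIndep_gradedU (k := k)) iSup_gradedU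
  set W := Submodule.span k (Set.range fun i => S.orbit (u i)) with hW
  induction a using Nat.strong_induction_on generalizing b with
  | _ a ih =>
  -- For a homogeneous `y`, a product `y * r` with a global relation `r` kills `w`. The product of
  -- `y` with `h z^(c+1)` has orbit proportional to that of `y`, whose `z`-degree is smaller, so
  -- induction applies.
  have hrel : ∀ x ∈ Submodule.span (U k) (localRelations k (-(n : ℤ))), ∀ y : U k,
      S.orbit (π (a, b) (y * x)) ∈ W := by
    intro x hx
    induction hx using Submodule.span_induction with
    | mem r hr =>
      intro y
      have hy : y ∈ ⨆ d : ℕ × ℕ, gradedU k d.1 d.2 := iSup_gradedU (k := k) ▸ Submodule.mem_top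
      induction hy using Submodule.iSup_induction' with
      | mem d y hy =>
        rcases hr with hr | ⟨c, rfl⟩
        · obtain ⟨a', b', hr'⟩ := localRelations_homogeneous (.inl hr)
          by_cases h : (d.1 + a', d.2 + b') = (a, b)
          · obtain ⟨rfl, rfl⟩ := Prod.mk.inj h
            rw [hπ (_, _) _ (mul_mem_gradedU hy hr'), orbit_mul,
              S.orbit_of_globalRelations hr, map_zero]
            exact zero_mem _
          · rw [hπ' (a, b) (d.1 + a', d.2 + b') _ (mul_mem_gradedU hy hr') h, map_zero]
            exact zero_mem _
        · have hr' := ev_mem_gradedU (isHomogeneousZ_hZ (k := k) (c + 1))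
          by_cases h : (d.1 + (c + 1), d.2 + 0) = (a, b)
          · have hmem := mul_mem_gradedU hy hr'
            obtain ⟨c', hc'⟩ := S.orbit_hZ (c + 1)
            obtain ⟨rfl, rfl⟩ := Prod.mk.inj h
            rw [hπ (_, _) _ hmem, orbit_mul, hc', map_smul]
            exact W.smul_mem _ (ih d.1 (by omega) d.2 y hy)
          · rw [hπ' (a, b) (d.1 + (c + 1), d.2 + 0) _ (mul_mem_gradedU hy hr') h, map_zero]
            exact zero_mem _
      | zero => rw [zero_mul, map_zero, map_zero]; exact zero_mem _
      | add y y' _ _ h h' => rw [add_mul, map_add, map_add]; exact add_mem h h'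
    | zero => intro y; rw [mul_zero, map_zero, map_zero]; exact zero_mem _
    | add x x' _ _ h h' => intro y; rw [mul_add, map_add, map_add]; exact add_mem (h y) (h' y)
    | smul c x _ h => intro y; rw [smul_eq_mul, ← mul_assoc]; exact h _
  intro x hx
  have hx' : x • gen k (-(n : ℤ)) ∈ Submodule.span k (Set.range fun i => u i • gen k (-(n : ℤ))) :=
    hspan ▸ Submodule.mem_top
  obtain ⟨c, hc⟩ := (Submodule.mem_span_range_iff_exists_fun k).1 hx'
  -- Taking the component of bidegree `(a, b)` keeps `x` and discards the `u i` of other bidegrees;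
  -- `hrel` then bounds the orbit of the difference.
  have h0 : x - ∑ i, c i • u i ∈ Submodule.span (U k) (localRelations k (-(n : ℤ))) := by
    rw [← smul_gen_eq_zero_iff, sub_smul, ← hc, Finset.sum_smul, sub_eq_zero]
    exact Finset.sum_congr rfl fun i _ => (smul_assoc _ _ _).symm
  have h1 := hrel _ h0 1
  rw [one_mul, map_sub, hπ (a, b) x hx, map_sub, map_sum, map_sum] at h1
  refine (W.sub_mem_iff_left (W.sum_mem fun i _ => ?_)).1 h1
  rw [map_smul, map_smul]
  refine W.smul_mem _ ?_
  by_cases h : d i = (a, b)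
  · rw [hπ (a, b) _ (h ▸ hu i :)]
    exact Submodule.subset_span ⟨i, rfl⟩
  · rw [hπ' (a, b) (d i) _ (hu i) h, map_zero]
    exact zero_mem _

theorem span_orbit_eq_top {ι : Type*} [Finite ι] {u : ι → U k} {d : ι → ℕ × ℕ}
    (hu : ∀ i, u i ∈ gradedU k (d i).1 (d i).2)
    (hspan : Submodule.span k (Set.range fun i => u i • gen k (-(n : ℤ))) = ⊤) :
    Submodule.span k (Set.range fun i => S.orbit (u i)) = ⊤ := by
  rw [eq_top_iff, ← S.range_orbit]
  rintro _ ⟨x, rfl⟩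
  have hx : x ∈ ⨆ d : ℕ × ℕ, gradedU k d.1 d.2 := iSup_gradedU (k := k) ▸ Submodule.mem_top
  induction hx using Submodule.iSup_induction' with
  | mem d' x hx => exact S.orbit_mem_span hu hspan _ _ x hx
  | zero => rw [map_zero]; exact zero_mem _
  | add y y' _ _ h h' => rw [map_add]; exact add_mem h h'

end SpinSystem

variable (k) in
/-- The automorphism of `U(𝕴[ξ])` that carries the relations of `EM^loc_{(n+1)ω}` to those of
`EM^loc_{-nω}`. -/
def swapU : U k →ₐ[k] U k :=
  -- The character makes `h` go to `1 - h`, so that weight `n + 1` corresponds to weight `-n`.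
  envMap swapIw swapIw_lie (hCoeffL k) hCoeff_lie 1

theorem swapU_ev (x : iwahori k) :
    swapU k (ev k x) = ev k (swapIw x) + algebraMap k _ (hCoeff k x) := by
  exact envMap_ev _ _ _ _ _ x

theorem swapU_od (x : iwahori k) : swapU k (od k x) = od k (swapIw x) := by
  exact (envMap_od _ _ _ _ _ x).trans (one_smul _ _)

theorem swapU_swapU (u : U k) : swapU k (swapU k u) = u := by
  have h : (swapU k).comp (swapU k) = AlgHom.id k (U k) := by
    apply env_hom_ext
    · intro x
      have hx : hCoeff k (swapIw x) = -hCoeff k x := by simp [hCoeff, swapIw_00]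
      simp [swapU_ev, swapIw_swapIw, hx, AlgHom.commutes]
    · intro x
      simp [swapU_od, swapIw_swapIw]
  exact AlgHom.congr_fun h u

theorem swapU_relation {n : ℕ} {r : U k} (hr : r ∈ localRelations k ((n : ℤ) + 1)) :
    swapU k r • gen k (-(n : ℤ)) = 0 := by
  have hw := isLow_gen (k := k) n
  rcases hr with (hr | hr) | ⟨a, rfl⟩
  · rcases hr with rfl | rfl
    · rw [map_sub, swapU_ev, AlgHom.commutes, swapIw_hZ, hCoeff_hZ_zero, ev_neg, sub_smul,
        add_smul, algebraMap_smul_U, algebraMap_smul_U, neg_smul, weight_smul_gen, ← neg_smul,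
        ← add_smul, ← sub_smul]
      push_cast
      ring_nf
      rw [zero_smul]
    · rw [swapU_od, swapIw_hZ, od_neg, neg_smul, neg_eq_zero]
      exact hw.H'
  · rw [if_pos (by omega)] at hr
    rcases hr with (⟨a, rfl⟩ | ⟨a, rfl⟩) | rfl
    · simp only
      rw [swapU_ev, swapIw_eZ, hCoeff_eZ, map_zero, add_zero]
      exact hw.F a
    · simp only
      rw [swapU_od, swapIw_eZ]
      exact hw.F' a
    · rw [map_pow, swapU_ev, swapIw_fZ, hCoeff_fZ, map_zero, add_zero,
        show ((n : ℤ) + 1).toNat = n + 1 by omega]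
      exact hw.E
  · simp only
    rw [swapU_ev, swapIw_hZ, hCoeff_hZ_succ, map_zero, add_zero, ev_neg, neg_smul,
      neg_eq_zero]
    exact hw.H a

/-- `swapU` induces a map between the local modules that is surjective because `swapU` is an
involution. The opposite inequality is supplied by the spanning families. -/
theorem finrank_neg_le_finrank_pos (n : ℕ) [Module.Finite k (EMloc k ((n : ℤ) + 1))] :
    Module.finrank k (EMloc k (-(n : ℤ))) ≤ Module.finrank k (EMloc k ((n : ℤ) + 1)) := by
  let g : U k →ₗ[k] EMloc k (-(n : ℤ)) :=
    (LinearMap.toSpanSingleton (U k) _ (gen k (-(n : ℤ)))).restrictScalars k ∘ₗ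
      (swapU k).toLinearMap
  have hg : ∀ u, g u = swapU k u • gen k (-(n : ℤ)) := fun _ => rfl
  refine LinearMap.finrank_le_finrank_of_surjective (f := liftEM (m := (n : ℤ) + 1) g ?_) ?_
  · intro u r hr
    rw [hg, map_mul, mul_smul, swapU_relation hr, smul_zero]
  · intro y
    obtain ⟨u, rfl⟩ := exists_smul_gen y
    exact ⟨swapU k u • gen k _, by rw [liftEM_smul_gen, hg, swapU_swapU]⟩

theorem finrank_EMloc_neg [CharZero k] {n : ℕ} {ι : Type} [Fintype ι] {u : ι → U k} {d : ι → ℕ × ℕ}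
    (hu : ∀ i, u i ∈ gradedU k (d i).1 (d i).2)
    (hspan : Submodule.span k (Set.range fun i => u i • gen k (-(n : ℤ))) = ⊤)
    (hcard : Fintype.card ι = 4 ^ n) :
    Module.finrank k (EMloc k (-(n : ℤ))) = 4 ^ n := by
  apply le_antisymm
  · rw [← hcard, ← finrank_top k (EMloc k (-(n : ℤ))), ← hspan]
    exact finrank_range_le_card _
  · obtain ⟨M, _, _, _, hM, ⟨S⟩⟩ := SpinSystem.exists_spinSystem k n
    -- A basis extracted from the spanning family is still homogeneous, so it also spans the fusion
    -- module and has at least `4 ^ n` members.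
    obtain ⟨κ, a, ha, hs, hl⟩ := exists_linearIndependent' k fun i => u i • gen k (-(n : ℤ))
    have : Finite κ := Finite.of_injective a ha
    have := Fintype.ofFinite κ
    have h1 := S.span_orbit_eq_top (u := u ∘ a) (d := d ∘ a) (fun i => hu _) (hs.trans hspan)
    have h2 := finrank_range_le_card (R := k) fun i => S.orbit ((u ∘ a) i)
    rw [Set.finrank, h1, finrank_top, hM] at h2
    rwa [← finrank_span_eq_card hl, hs, hspan, finrank_top] at h2

end Evaluation

/-! ### Hecke operators on the recursively defined pair -/

section MacdonaldPolynomials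

open LaurentPolynomial

theorem qt_monomial_injective {a b c d : ℕ} (h : qq ^ a * tt ^ b = qq ^ c * tt ^ d) :
    a = c ∧ b = d := by
  have h1 : algebraMap (MvPolynomial (Fin 2) ℚ) Kqt (MvPolynomial.X 0 ^ a * MvPolynomial.X 1 ^ b)
      = algebraMap (MvPolynomial (Fin 2) ℚ) Kqt (MvPolynomial.X 0 ^ c * MvPolynomial.X 1 ^ d) := by
    simp only [map_mul, map_pow]
    exact h
  have h2 := IsFractionRing.injective (MvPolynomial (Fin 2) ℚ) Kqt h1
  have key : ∀ a b : ℕ, (MvPolynomial.X 0 ^ a * MvPolynomial.X 1 ^ b : MvPolynomial (Fin 2) ℚ)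
      = MvPolynomial.monomial (Finsupp.single 0 a + Finsupp.single 1 b) 1 := fun a b => by
    rw [MvPolynomial.X_pow_eq_monomial, MvPolynomial.X_pow_eq_monomial,
      MvPolynomial.monomial_mul, one_mul]
  rw [key, key] at h2
  have h3 := MvPolynomial.monomial_left_injective one_ne_zero h2
  exact ⟨by simpa using DFunLike.congr_fun h3 0, by simpa using DFunLike.congr_fun h3 1⟩

theorem one_sub_qq_pow_mul_tt_ne_zero (i : ℕ) : 1 - qq ^ i * tt ≠ 0 := by
  intro h
  have h' : qq ^ 0 * tt ^ 0 = qq ^ i * tt ^ 1 := by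
    rw [pow_zero, pow_zero, pow_one, one_mul]
    exact sub_eq_zero.1 h
  exact absurd (qt_monomial_injective h').2 (by norm_num)

theorem linMap_comp_ext {f g : LaurentPolynomial Kqt →ₗ[Kqt] LaurentPolynomial Kqt}
    (h : ∀ m : ℤ, f (T m) = g (T m)) (p : LaurentPolynomial Kqt) : f p = g p :=
  LinearMap.congr_fun (linMap_ext h) p

theorem refl1_T_mul (n : ℤ) (p : LaurentPolynomial Kqt) : refl1 (T n * p) = T (-n) * refl1 p := by
  refine linMap_comp_ext (f := refl1 ∘ₗ LinearMap.mulLeft Kqt (T n))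
    (g := LinearMap.mulLeft Kqt (T (-n)) ∘ₗ refl1) (fun m => ?_) p
  simp only [LinearMap.comp_apply, LinearMap.mulLeft_apply, ← T_add, refl1, linExt_T, neg_add]

theorem refl0_T_mul (n : ℤ) (p : LaurentPolynomial Kqt) :
    refl0 (T n * p) = qq ^ n • (T (-n) * refl0 p) := by
  refine linMap_comp_ext (f := refl0 ∘ₗ LinearMap.mulLeft Kqt (T n))
    (g := qq ^ n • LinearMap.mulLeft Kqt (T (-n)) ∘ₗ refl0) (fun m => ?_) p
  simp only [LinearMap.comp_apply, LinearMap.mulLeft_apply, LinearMap.smul_apply, ← T_add, refl0,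
    linExt_T, neg_add, mul_smul_comm, smul_smul, zpow_add₀ qq_ne_zero]

theorem T_two_sub_one_ne_zero : (T 2 - 1 : LaurentPolynomial Kqt) ≠ 0 := by
  intro h
  have h1 : (T 2 : LaurentPolynomial Kqt) = T 0 := by rw [T_zero]; exact sub_eq_zero.1 h
  have h2 : Finsupp.single (2 : ℤ) (1 : Kqt) = Finsupp.single 0 1 :=
    congrArg (AddMonoidAlgebra.coeffLinearEquiv Kqt) h1
  have h3 := Finsupp.single_left_injective one_ne_zero h2
  norm_num at h3

theorem qq_T_sub_one_ne_zero : (qq • T (-2) - 1 : LaurentPolynomial Kqt) ≠ 0 := by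
  intro h
  have h1 : (qq • T (-2) : LaurentPolynomial Kqt) = T 0 := by rw [T_zero]; exact sub_eq_zero.1 h
  have h2 : qq • Finsupp.single (-2 : ℤ) (1 : Kqt) = Finsupp.single 0 1 :=
    congrArg (AddMonoidAlgebra.coeffLinearEquiv Kqt) h1
  have h3 := DFunLike.congr_fun h2 0
  simp at h3

theorem T_mul_T_neg_mul (n : ℤ) (p : LaurentPolynomial Kqt) : T n * (T (-n) * p) = p := by
  rw [← mul_assoc, ← T_add, add_neg_cancel, T_zero, one_mul]

theorem T_neg_mul_T_mul (n : ℤ) (p : LaurentPolynomial Kqt) : T (-n) * (T n * p) = p := by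
  rw [← mul_assoc, ← T_add, neg_add_cancel, T_zero, one_mul]

/-- The affine Hecke relation between `T₁` and multiplication by `x`, obtained by cancelling `x² -
1`. With its analogue for `T₀`, the recursion can be treated without expanding into monomials. -/
theorem hecke1_T_mul (p : LaurentPolynomial Kqt) :
    hecke1 (T 1 * p) = T (-1) * (hecke1 p - (tt - 1) • p) := by
  apply mul_left_cancel₀ T_two_sub_one_ne_zero
  have h1 := hecke1_spec (T 1 * p)
  have h2 := hecke1_spec p
  rw [refl1_T_mul] at h1
  have e : (T 2 : LaurentPolynomial Kqt) = T 1 * T 1 := by rw [← T_add]; rfl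
  have e' : (T (-1) * T 1 : LaurentPolynomial Kqt) = 1 := by
    rw [← T_add, neg_add_cancel, T_zero]
  simp only [smul_eq_C_mul, e] at h1 h2 ⊢
  linear_combination h1 - T (-1) * h2 + (C (tt - 1) * p * T 1) * e'

theorem hecke1_T_neg_mul (p : LaurentPolynomial Kqt) :
    hecke1 (T (-1) * p) = T 1 * hecke1 p + (tt - 1) • (T (-1) * p) := by
  have h := hecke1_T_mul (T (-1) * p)
  rw [T_mul_T_neg_mul] at h
  rw [h, T_mul_T_neg_mul, sub_add_cancel]

theorem hecke0_T_neg_mul (p : LaurentPolynomial Kqt) :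
    hecke0 (T (-1) * p) = qq⁻¹ • (T 1 * (hecke0 p - (tt - 1) • p)) := by
  apply mul_left_cancel₀ qq_T_sub_one_ne_zero
  have h1 := hecke0_spec (T (-1) * p)
  have h2 := hecke0_spec p
  rw [refl0_T_mul, zpow_neg_one, neg_neg] at h1
  have e : (T (-2) : LaurentPolynomial Kqt) = T (-1) * T (-1) := by rw [← T_add]; rfl
  have e' : (T (-1) * T 1 : LaurentPolynomial Kqt) = 1 := by
    rw [← T_add, neg_add_cancel, T_zero]
  have e'' : (C qq⁻¹ * C qq : LaurentPolynomial Kqt) = 1 := by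
    rw [← map_mul, inv_mul_cancel₀ qq_ne_zero, map_one]
  simp only [smul_eq_C_mul, e] at h1 h2 ⊢
  linear_combination h1 - C qq⁻¹ * T 1 * h2 +
    (C (tt - 1) * p * T (-1)) * (e' * (C qq⁻¹ * C qq) + e'')

theorem hecke0_T_mul (p : LaurentPolynomial Kqt) :
    hecke0 (T 1 * p) = qq • (T (-1) * hecke0 p) + (tt - 1) • (T 1 * p) := by
  have h := hecke0_T_neg_mul (T 1 * p)
  rw [T_neg_mul_T_mul] at h
  rw [h, mul_smul_comm, T_neg_mul_T_mul, smul_smul, mul_inv_cancel₀ qq_ne_zero, one_smul,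
    sub_add_cancel]

/-- The integral forms of `E_{-nω}` and `E_{(n+1)ω}`, defined by their common recursion. -/
def macPair : ℕ → LaurentPolynomial Kqt × LaurentPolynomial Kqt
  | 0 => (T 0, T 1)
  | n + 1 =>
    ((1 - qq ^ (n + 1) * tt) • (T (-1) * (macPair n).1) + (1 - tt) • (macPair n).2,
      (1 - qq ^ (n + 1) * tt) • (T 1 * (macPair n).2)
        + (qq ^ (n + 1) * (1 - tt)) • (macPair n).1)

/-- The four identities are proved together because each one at `n + 1` needs several at `n`.
Composing the first with the third, and the second with the fourth, gives the eigenvalues of `Y = T₀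
T₁`. -/
theorem macPair_hecke (n : ℕ) :
    hecke1 (macPair n).1 = tt • (T (-1) * (macPair n).2) ∧
    hecke1 (macPair n).2 = T (-1) * (macPair n).1 ∧
    hecke0 (T (-1) * (macPair n).2) = (tt * qq ^ n) • (macPair n).1 ∧
    qq ^ (n + 1) • hecke0 (T (-1) * (macPair n).1) = (macPair n).2 := by
  induction n with
  | zero =>
    have h0 : (T (-1) * T 1 : LaurentPolynomial Kqt) = T 0 := by rw [← T_add]; rfl
    have h1 : (T (-1) * T 0 : LaurentPolynomial Kqt) = T (-1) := by rw [← T_add]; rfl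
    simp only [macPair, h0, h1]
    refine ⟨?_, ?_, ?_, ?_⟩
    · simp only [hecke1, linExt_T]
      simp
    · simp only [hecke1, linExt_T]
      simp [sub_smul]
    · simp only [hecke0, linExt_T]
      simp
    · have h2 : (T (-1 + 2 * (((0 : ℕ) : ℤ) + 1)) : LaurentPolynomial Kqt) = T 1 := by norm_num
      simp only [hecke0, linExt_T]
      rw [if_neg (by norm_num), show (-1 : ℤ).natAbs = 1 from rfl, Finset.sum_range_one, h2,
        neg_neg,
        Nat.cast_zero, zero_add, zero_add, pow_one, zpow_neg_one]
      have hq := qq_ne_zero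
      match_scalars
      field_simp
      ring
  | succ n ih =>
    obtain ⟨ha, hb, hc, hd⟩ := ih
    have hd' : hecke0 (T (-1) * (macPair n).1) = (qq ^ (n + 1))⁻¹ • (macPair n).2 := by
      rw [← hd, smul_smul, inv_mul_cancel₀ (pow_ne_zero _ qq_ne_zero), one_smul]
    have he : hecke0 (macPair n).2 = (tt * qq ^ (n + 1)) • (T (-1) * (macPair n).1)
        + (tt - 1) • (macPair n).2 := by
      have h := hecke0_T_mul (T (-1) * (macPair n).2)
      rw [T_mul_T_neg_mul, hc] at h
      rw [h, mul_smul_comm, smul_smul]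
      congr 2
      ring
    have hq := qq_ne_zero
    have e : (T 1 * (T (-1) * (macPair n).2)) = (macPair n).2 := T_mul_T_neg_mul 1 _
    have e' : (T (-1) * (T 1 * (macPair n).2)) = (macPair n).2 := T_neg_mul_T_mul 1 _
    simp only [macPair]
    refine ⟨?_, ?_, ?_, ?_⟩
    · rw [map_add, map_smul, map_smul, hecke1_T_neg_mul, ha, hb, mul_smul_comm, e, mul_add,
        mul_smul_comm, mul_smul_comm, e']
      module
    · rw [map_add, map_smul, map_smul, hecke1_T_mul, ha, hb, mul_add, mul_sub, mul_smul_comm,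
        mul_smul_comm, mul_smul_comm]
      module
    · rw [mul_add, mul_smul_comm, mul_smul_comm, e', map_add, map_smul, map_smul, he, hd']
      match_scalars
      · ring
      · field_simp
        ring
    · rw [mul_add, mul_smul_comm, mul_smul_comm, map_add, map_smul, map_smul, hc,
        hecke0_T_neg_mul (T (-1) * (macPair n).1), hd', mul_sub, mul_smul_comm, mul_smul_comm,
        T_mul_T_neg_mul]
      match_scalars
      · field_simp
        ring
      · field_simp
        ring

end MacdonaldPolynomials

/-! ### Existence and uniqueness of nonsymmetric Macdonald polynomials -/

section NonsymmetricMacdonald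

open LaurentPolynomial

theorem coeff_T_mul (n j : ℤ) (p : LaurentPolynomial Kqt) :
    (T n * p).coeff j = p.coeff (j - n) := by
  have h := AddMonoidAlgebra.coeff_single_mul_add p 1 n (j - n)
  rw [add_sub_cancel, one_mul] at h
  exact h

theorem eq_sum_coeff_smul_T (p : LaurentPolynomial Kqt) :
    p = ∑ j ∈ p.coeff.support, p.coeff j • T j := by
  apply LaurentPolynomial.ext
  intro m
  rw [AddMonoidAlgebra.coeff_sum, Finsupp.finsetSum_apply]
  simp [T_apply, eq_comm]

/-- The leading coefficient of the integral forms in `macPair n`. -/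
def macLead (n : ℕ) : Kqt := ∏ i ∈ Finset.range n, (1 - qq ^ (i + 1) * tt)

theorem ne_zero_or_of_add_ne_zero {a b : Kqt} (h : a + b ≠ 0) : a ≠ 0 ∨ b ≠ 0 := by
  by_contra! h'
  exact h (by rw [h'.1, h'.2, add_zero])

theorem macLead_ne_zero (n : ℕ) : macLead n ≠ 0 :=
  Finset.prod_ne_zero_iff.2 fun i _ => one_sub_qq_pow_mul_tt_ne_zero (i + 1)

/-- Only the first summand of each recursion reaches the new leading exponent, so the leading
coefficient gains just the factor `1 - q^(n+1) t`. -/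
theorem macPair_coeff (n : ℕ) :
    (∀ j : ℤ, (macPair n).1.coeff j ≠ 0 → -(n : ℤ) ≤ j ∧ j ≤ n ∧ Even (j + n)) ∧
    (∀ j : ℤ, (macPair n).2.coeff j ≠ 0 → -(n : ℤ) ≤ j ∧ j ≤ n + 1 ∧ Even (j + n + 1)) ∧
    (macPair n).1.coeff (-n) = macLead n ∧ (macPair n).2.coeff (n + 1) = macLead n := by
  induction n with
  | zero =>
    refine ⟨fun j hj => ?_, fun j hj => ?_, ?_, ?_⟩
    · have : j = 0 := by
        by_contra h
        exact hj ((T_apply j 0).trans (if_neg (Ne.symm h)))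
      subst this
      simp
    · have : j = 1 := by
        by_contra h
        exact hj ((T_apply j 1).trans (if_neg (Ne.symm h)))
      subst this
      norm_num
    · simp [macPair, macLead]
    · simp [macPair, macLead, T_apply]
  | succ n ih =>
    obtain ⟨h1, h2, l1, l2⟩ := ih
    have c1 : ∀ j : ℤ, (macPair (n + 1)).1.coeff j
        = (1 - qq ^ (n + 1) * tt) * (macPair n).1.coeff (j + 1)
          + (1 - tt) * (macPair n).2.coeff j := fun j => by
      simp only [macPair, AddMonoidAlgebra.coeff_add, AddMonoidAlgebra.coeff_smul,
        Finsupp.add_apply, Finsupp.smul_apply, coeff_T_mul, smul_eq_mul, sub_neg_eq_add]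
    have c2 : ∀ j : ℤ, (macPair (n + 1)).2.coeff j
        = (1 - qq ^ (n + 1) * tt) * (macPair n).2.coeff (j - 1)
          + qq ^ (n + 1) * (1 - tt) * (macPair n).1.coeff j := fun j => by
      simp only [macPair, AddMonoidAlgebra.coeff_add, AddMonoidAlgebra.coeff_smul,
        Finsupp.add_apply, Finsupp.smul_apply, coeff_T_mul, smul_eq_mul]
    have z1 : ∀ j : ℤ, (j < -(n : ℤ) ∨ n < j) → (macPair n).1.coeff j = 0 := fun j hj => by
      by_contra h
      have := h1 j h
      omega
    have z2 : ∀ j : ℤ, j < -(n : ℤ) → (macPair n).2.coeff j = 0 := fun j hj => by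
      by_contra h
      have := h2 j h
      omega
    refine ⟨fun j hj => ?_, fun j hj => ?_, ?_, ?_⟩
    · rw [c1] at hj
      rcases ne_zero_or_of_add_ne_zero hj with h | h
      · obtain ⟨a, b, c⟩ := h1 _ (right_ne_zero_of_mul h)
        rw [Int.even_iff] at c ⊢
        omega
      · obtain ⟨a, b, c⟩ := h2 _ (right_ne_zero_of_mul h)
        rw [Int.even_iff] at c ⊢
        omega
    · rw [c2] at hj
      rcases ne_zero_or_of_add_ne_zero hj with h | h
      · obtain ⟨a, b, c⟩ := h2 _ (right_ne_zero_of_mul h)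
        rw [Int.even_iff] at c ⊢
        omega
      · obtain ⟨a, b, c⟩ := h1 _ (right_ne_zero_of_mul h)
        rw [Int.even_iff] at c ⊢
        omega
    · rw [c1, z2 _ (by omega), mul_zero, add_zero, macLead, Finset.prod_range_succ, ← macLead,
        mul_comm, ← l1]
      congr 2
      push_cast
      ring
    · rw [c2, z1 _ (by omega), mul_zero, add_zero, macLead, Finset.prod_range_succ, ← macLead,
        mul_comm, ← l2]
      congr 2
      push_cast
      ring

/-- The integral form of `E_{mω}`. -/
def mac (m : ℤ) : LaurentPolynomial Kqt :=
  if 0 < m then (macPair (m - 1).toNat).2 else (macPair (-m).toNat).1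

theorem mac_neg (n : ℕ) : mac (-(n : ℤ)) = (macPair n).1 := by
  rw [mac, if_neg (by omega), neg_neg, Int.toNat_natCast]

theorem mac_pos (n : ℕ) : mac ((n : ℤ) + 1) = (macPair n).2 := by
  rw [mac, if_pos (by omega), add_sub_cancel_right, Int.toNat_natCast]

theorem neg_or_succ (m : ℤ) : (∃ n : ℕ, m = -(n : ℤ)) ∨ ∃ n : ℕ, m = (n : ℤ) + 1 := by
  rcases le_or_gt m 0 with h | h
  · exact .inl ⟨(-m).toNat, by omega⟩
  · exact .inr ⟨(m - 1).toNat, by omega⟩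

/-- The eigenvalue of `Y` on `mac m`. -/
def macEigenvalue (m : ℤ) : Kqt :=
  if 0 < m then (qq ^ m.toNat)⁻¹ else qq ^ (-m).toNat * tt ^ 2

theorem cherednikY_mac (m : ℤ) : cherednikY (mac m) = macEigenvalue m • mac m := by
  rcases neg_or_succ m with ⟨n, rfl⟩ | ⟨n, rfl⟩ <;> obtain ⟨ha, hb, hc, hd⟩ := macPair_hecke n
  · rw [mac_neg, macEigenvalue, if_neg (by omega), neg_neg, Int.toNat_natCast, cherednikY,
      LinearMap.comp_apply, ha, map_smul, hc, smul_smul]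
    congr 1
    ring
  · rw [mac_pos, macEigenvalue, if_pos (by omega), show ((n : ℤ) + 1).toNat = n + 1 by omega,
      cherednikY, LinearMap.comp_apply, hb, ← hd, smul_smul,
      inv_mul_cancel₀ (pow_ne_zero _ qq_ne_zero), one_smul]

/-- The power of `t` separates positive from nonpositive weights, and the power of `q` separates
weights within each class. -/
theorem macEigenvalue_injective : Function.Injective macEigenvalue := by
  have key : ∀ a b : ℕ, (qq ^ a)⁻¹ ≠ qq ^ b * tt ^ 2 := fun a b h => by
    have h' : qq ^ 0 * tt ^ 0 = qq ^ (a + b) * tt ^ 2 := by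
      rw [pow_add, mul_assoc, ← h, mul_inv_cancel₀ (pow_ne_zero _ qq_ne_zero)]
      simp
    exact absurd (qt_monomial_injective h').2 (by norm_num)
  intro m m' h
  unfold macEigenvalue at h
  split_ifs at h with h1 h2 h2
  · have h' : qq ^ m.toNat * tt ^ 0 = qq ^ m'.toNat * tt ^ 0 := by rw [inv_injective h]
    have := (qt_monomial_injective h').1
    omega
  · exact absurd h (key _ _)
  · exact absurd h.symm (key _ _)
  · have := (qt_monomial_injective h).1
    omega

/-- The coefficient of `x^m` in `mac m`. -/
def macLeadCoeff (m : ℤ) : Kqt := macLead (if 0 < m then (m - 1).toNat else (-m).toNat)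

theorem mac_coeff_self (m : ℤ) : (mac m).coeff m = macLeadCoeff m := by
  rcases neg_or_succ m with ⟨n, rfl⟩ | ⟨n, rfl⟩
  · rw [mac_neg, macLeadCoeff, if_neg (by omega), neg_neg, Int.toNat_natCast,
      (macPair_coeff n).2.2.1]
  · rw [mac_pos, macLeadCoeff, if_pos (by omega), add_sub_cancel_right, Int.toNat_natCast,
      (macPair_coeff n).2.2.2]

theorem macLeadCoeff_ne_zero (m : ℤ) : macLeadCoeff m ≠ 0 := macLead_ne_zero _

theorem eq_or_cherednikLT_of_mac_coeff {m j : ℤ} (h : (mac m).coeff j ≠ 0) :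
    j = m ∨ CherednikLT j m := by
  unfold CherednikLT
  rcases neg_or_succ m with ⟨n, rfl⟩ | ⟨n, rfl⟩
  · rw [mac_neg] at h
    obtain ⟨h1, h2, h3⟩ := (macPair_coeff n).1 j h
    rw [Int.even_iff] at h3 ⊢
    rw [Int.abs_eq_natAbs, Int.abs_eq_natAbs]
    omega
  · rw [mac_pos] at h
    obtain ⟨h1, h2, h3⟩ := (macPair_coeff n).2.1 j h
    rw [Int.even_iff] at h3 ⊢
    rw [Int.abs_eq_natAbs, Int.abs_eq_natAbs]
    omega

/-- A height function compatible with the Cherednik order. -/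
def macHeight (m : ℤ) : ℕ := if 0 < m then 2 * m.natAbs else 2 * m.natAbs + 1

/-- The extra `1` in the height of a nonpositive weight places `|m|` before `-|m|`, as the order
demands. -/
theorem CherednikLT.macHeight_lt {n m : ℤ} (h : CherednikLT n m) : macHeight n < macHeight m := by
  unfold CherednikLT at h
  rw [Int.even_iff, Int.abs_eq_natAbs, Int.abs_eq_natAbs] at h
  unfold macHeight
  split_ifs <;>
  omega

/-- Triangularity with nonzero diagonal coefficients, inverted by induction on the height. -/
theorem span_mac : Submodule.span Kqt (Set.range mac) = ⊤ := by
  have key : ∀ N : ℕ, ∀ m : ℤ, macHeight m = N → T m ∈ Submodule.span Kqt (Set.range mac) := by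
    intro N
    induction N using Nat.strong_induction_on with
    | _ N ih =>
    intro m hm
    have h1 := eq_sum_coeff_smul_T (mac m)
    have hl : (mac m).coeff m ≠ 0 := by rw [mac_coeff_self]; exact macLead_ne_zero _
    rw [← Finset.add_sum_erase _ _ (Finsupp.mem_support_iff.2 hl)] at h1
    have h2 : (mac m).coeff m • T m ∈ Submodule.span Kqt (Set.range mac) := by
      rw [← Submodule.add_mem_iff_left, ← h1]
      · exact Submodule.subset_span ⟨m, rfl⟩
      · refine Submodule.sum_mem _ fun j hj => Submodule.smul_mem _ _ ?_
        rw [Finset.mem_erase, Finsupp.mem_support_iff] at hj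
        have hlt := (eq_or_cherednikLT_of_mac_coeff hj.2).resolve_left hj.1
        exact ih _ (hm ▸ hlt.macHeight_lt) j rfl
    rw [← one_smul Kqt (T m), ← inv_mul_cancel₀ hl, mul_smul]
    exact Submodule.smul_mem _ _ h2
  rw [eq_top_iff]
  intro p _
  rw [eq_sum_coeff_smul_T p]
  exact Submodule.sum_mem _ fun j _ => Submodule.smul_mem _ _ (key _ j rfl)

theorem linearIndependent_mac : LinearIndependent Kqt mac :=
  Module.End.eigenvectors_linearIndependent' cherednikY macEigenvalue macEigenvalue_injective mac
    fun m => ⟨Module.End.mem_eigenspace_iff.2 (cherednikY_mac m), fun h => by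
      have := mac_coeff_self m
      rw [h] at this
      exact macLead_ne_zero _ this.symm⟩

/-- In an eigenbasis with simple spectrum an eigenvector has a single nonzero coordinate. -/
theorem exists_eq_smul_mac {E : LaurentPolynomial Kqt} (hE : E ≠ 0) {c : Kqt}
    (h : cherednikY E = c • E) : ∃ (n : ℤ) (a : Kqt), E = a • mac n := by
  have hE' : E ∈ Submodule.span Kqt (Set.range mac) := span_mac ▸ Submodule.mem_top
  obtain ⟨f, hf⟩ := (Finsupp.mem_span_range_iff_exists_finsupp).1 hE'
  have h0 : ∑ n ∈ f.support, (f n * (macEigenvalue n - c)) • mac n = 0 := by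
    have h1 := h
    rw [← hf, Finsupp.sum, map_sum, Finset.smul_sum, ← sub_eq_zero,
      ← Finset.sum_sub_distrib] at h1
    rw [← h1]
    refine Finset.sum_congr rfl fun n _ => ?_
    rw [map_smul, cherednikY_mac]
    module
  have h1 := linearIndependent_iff'.1 linearIndependent_mac _ _ h0
  have hs : f.support.Nonempty := by
    rw [Finsupp.support_nonempty_iff]
    rintro rfl
    exact hE (by rw [← hf]; simp)
  have h2 : ∀ n ∈ f.support, macEigenvalue n = c := fun n hn =>
    sub_eq_zero.1 ((mul_eq_zero.1 (h1 n hn)).resolve_left (Finsupp.mem_support_iff.1 hn))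
  obtain ⟨n, hn⟩ := hs
  refine ⟨n, f n, ?_⟩
  rw [← hf, Finsupp.sum, Finset.sum_eq_single_of_mem n hn]
  exact fun n' hn' hne => absurd (macEigenvalue_injective ((h2 n' hn').trans (h2 n hn).symm)) hne

/-- `E` is a multiple of some `mac n`. Since `x^n` occurs in `E` and `x^m` occurs in `mac n`, each
of `n` and `m` precedes or equals the other, and the heights force `n = m`. -/
theorem IsNonsymMacdonald.eq {m : ℤ} {E : LaurentPolynomial Kqt} (h : IsNonsymMacdonald m E) :
    E = (macLeadCoeff m)⁻¹ • mac m := by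
  obtain ⟨h1, h2, c, hc⟩ := h
  have hE : E ≠ 0 := by
    rintro rfl
    exact zero_ne_one h1
  obtain ⟨n, a, rfl⟩ := exists_eq_smul_mac hE hc
  have hco : ∀ j, (a • mac n).coeff j = a * (mac n).coeff j := fun j => rfl
  have ha : a ≠ 0 := by
    rintro rfl
    exact hE (zero_smul _ _)
  have hn := h2 n (by
    rw [hco, mac_coeff_self]
    exact mul_ne_zero ha (macLead_ne_zero _))
  have hm := eq_or_cherednikLT_of_mac_coeff (m := n) (j := m) (by
    intro h
    rw [hco, h, mul_zero] at h1
    exact zero_ne_one h1)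
  have hnm : n = m := by
    rcases hn with hn | hn
    · exact hn
    · rcases hm with hm | hm
      · exact hm.symm
      · exact absurd hn.macHeight_lt (not_lt_of_gt hm.macHeight_lt)
  subst hnm
  rw [hco, mac_coeff_self] at h1
  rw [eq_inv_of_mul_eq_one_left h1]

theorem isNonsymMacdonald_mac (m : ℤ) : IsNonsymMacdonald m ((macLeadCoeff m)⁻¹ • mac m) := by
  have hco : ∀ j, ((macLeadCoeff m)⁻¹ • mac m).coeff j = (macLeadCoeff m)⁻¹ * (mac m).coeff j :=
    fun j => rfl
  refine ⟨?_, fun j hj => ?_, macEigenvalue m, ?_⟩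
  · rw [hco, mac_coeff_self, inv_mul_cancel₀ (macLeadCoeff_ne_zero m)]
  · rw [hco] at hj
    exact eq_or_cherednikLT_of_mac_coeff (right_ne_zero_of_mul hj)
  · rw [map_smul, cherednikY_mac, smul_comm]

theorem existsUnique_isNonsymMacdonald (m : ℤ) : ∃! E, IsNonsymMacdonald m E :=
  ⟨_, isNonsymMacdonald_mac m, fun _ h => h.eq⟩

theorem IsNonsymMacdonald.integralForm_eq {m : ℤ} {E : LaurentPolynomial Kqt}
    (h : IsNonsymMacdonald m E) : integralForm m E = mac m := by
  rw [h.eq]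
  change macLeadCoeff m • _ = _
  rw [smul_smul, mul_inv_cancel₀ (macLeadCoeff_ne_zero m), one_smul]

end NonsymmetricMacdonald

/-! ### The base case: weights `0` and `ω` -/

namespace IwahoriSystem.IsLow

variable {A : Type*} [Ring A] {S : IwahoriSystem A} {M : Type*} [AddCommGroup M] [Module A M]
  [IsAddTorsionFree M] {w : M}

theorem E_smul_of_zero (hw : S.IsLow 0 w) (a : ℕ) : S.E a • w = 0 := by
  have h0 : S.E 0 • w = 0 := by simpa using hw.E
  rcases a with _ | a
  · exact h0
  · have h := congrArg (· • w) (S.HE (a + 1) 0)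
    simp only [add_smul, mul_smul, h0, hw.H, smul_zero, zero_add, add_zero] at h
    exact eq_zero_of_natCast_smul (A := A) two_ne_zero (by rw [Nat.cast_ofNat]; exact h.symm)

theorem E'_smul_of_zero (hw : S.IsLow 0 w) (a : ℕ) : S.E' a • w = 0 := by
  have h := congrArg (· • w) (S.H'E 0 a)
  simp only [add_smul, mul_smul, hw.E_smul_of_zero, hw.H', smul_zero, zero_add] at h
  exact eq_zero_of_natCast_smul (A := A) two_ne_zero (by rw [Nat.cast_ofNat]; exact h.symm)

theorem H'_smul_of_zero (hw : S.IsLow 0 w) (a : ℕ) : S.H' a • w = 0 := by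
  rcases a with _ | a
  · exact hw.H'
  · have h := congrArg (· • w) (S.EF' 0 a)
    simp only [add_smul, mul_smul, hw.E_smul_of_zero, hw.F', smul_zero, zero_add] at h
    exact h.symm

end IwahoriSystem.IsLow

/-! ### Homogeneous spanning families and the upper bound -/

section SpanningFamilies

variable {k : Type*} [Field k]

theorem span_gen_eq_top_of_smul {m : ℤ} (he : ∀ a, ev k (eZ k a) • gen k m = 0)
    (he' : ∀ a, od k (eZ k a) • gen k m = 0) (hf : ∀ a, ev k (fZ k a) • gen k m = 0)
    (hf' : ∀ a, od k (fZ k a) • gen k m = 0) (hh : ∀ a, ev k (hZ k (a + 1)) • gen k m = 0)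
    (hh' : ∀ a, od k (hZ k a) • gen k m = 0) : Submodule.span k {gen k m} = ⊤ := by
  have hev : ∀ x : iwahori k, ev k x • gen k m ∈ Submodule.span k {gen k m} := by
    apply iwahori_span_induction
    · exact fun a => he a ▸ zero_mem _
    · rintro (_ | a)
      · rw [weight_smul_gen]
        exact Submodule.smul_mem _ _ (Submodule.mem_span_singleton_self _)
      · exact hh a ▸ zero_mem _
    · exact fun a => hf a ▸ zero_mem _
    · intro x y hx hy
      rw [ev_add, add_smul]
      exact add_mem hx hy
    · intro c x hx
      rw [ev_smul, smul_assoc]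
      exact Submodule.smul_mem _ _ hx
  have hod : ∀ x : iwahori k, od k x • gen k m = 0 := by
    refine iwahori_span_induction (P := fun x => od k x • gen k m = 0) he' hh' hf' ?_ ?_
    · intro x y hx hy
      rw [od_add, add_smul, hx, hy, add_zero]
    · intro c x hx
      rw [od_smul, smul_assoc, hx, smul_zero]
  have key : (Submodule.span k {gen k m}).comap
      ((LinearMap.toSpanSingleton (U k) _ (gen k m)).restrictScalars k) = ⊤ := by
    apply env_eq_top
    · change (1 : U k) • gen k m ∈ Submodule.span k {gen k m}
      rw [one_smul]
      exact Submodule.mem_span_singleton_self _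
    · intro x y hy
      obtain ⟨c, hc⟩ := Submodule.mem_span_singleton.1 hy
      change (ev k x * y) • gen k m ∈ Submodule.span k {gen k m}
      rw [mul_smul, show y • gen k m = c • gen k m from hc.symm, smul_algebra_smul_comm]
      exact Submodule.smul_mem _ _ (hev x)
    · intro x y hy
      obtain ⟨c, hc⟩ := Submodule.mem_span_singleton.1 hy
      change (od k x * y) • gen k m ∈ Submodule.span k {gen k m}
      rw [mul_smul, show y • gen k m = c • gen k m from hc.symm, smul_algebra_smul_comm, hod,
        smul_zero]
      exact zero_mem _
  rw [eq_top_iff]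
  intro y _
  obtain ⟨u, rfl⟩ := exists_smul_gen y
  have hu : u ∈ (⊤ : Submodule k (U k)) := trivial
  rwa [← key] at hu

theorem span_gen_zero [CharZero k] : Submodule.span k {gen k (-((0 : ℕ) : ℤ))} = ⊤ := by
  have := isAddTorsionFree_of_charZero k (EMloc k (-((0 : ℕ) : ℤ)))
  have hw := isLow_gen (k := k) 0
  exact span_gen_eq_top_of_smul hw.E_smul_of_zero hw.E'_smul_of_zero hw.F hw.F' hw.H
    hw.H'_smul_of_zero

theorem span_gen_one [CharZero k] : Submodule.span k {gen k (((0 : ℕ) : ℤ) + 1)} = ⊤ := by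
  have := isAddTorsionFree_of_charZero k (EMloc k (((0 : ℕ) : ℤ) + 1))
  have hw := isLow_swap_gen (k := k) 0
  have neg : ∀ {x : U k} {y : EMloc k (((0 : ℕ) : ℤ) + 1)}, -x • y = 0 → x • y = 0 :=
    fun {x y} h => by rwa [neg_smul, neg_eq_zero] at h
  exact span_gen_eq_top_of_smul hw.F hw.F' hw.E_smul_of_zero hw.E'_smul_of_zero
    (fun a => neg (hw.H a)) (fun a => neg (hw.H'_smul_of_zero a))

open LaurentPolynomial in
/-- The contribution of a vector of weight `d.1`, `z`-degree `d.2.1` and `ξ`-degree `d.2.2` to the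
graded supercharacter. -/
def charMonomial (d : ℤ × ℕ × ℕ) : LaurentPolynomial Kqt :=
  (qq ^ d.2.1 * (-tt) ^ d.2.2) • T d.1

theorem charMonomial_add (d d' : ℤ × ℕ × ℕ) :
    charMonomial (d + d') = charMonomial d * charMonomial d' := by
  simp only [charMonomial, Prod.fst_add, Prod.snd_add, LaurentPolynomial.T_add, pow_add,
    smul_mul_smul_comm]
  congr 1
  ring

variable (k) in
/-- The local module of weight `mω` is spanned by `N` homogeneous vectors whose contributions to
the graded supercharacter add up to `p`. -/
def HasHomogeneousSpan (m : ℤ) (N : ℕ) (p : LaurentPolynomial Kqt) : Prop :=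
  ∃ (ι : Type) (_ : Fintype ι) (u : ι → U k) (d : ι → ℤ × ℕ × ℕ), (∀ i, IsHomU (d i) (u i)) ∧
    Submodule.span k (Set.range fun i => u i • gen k m) = ⊤ ∧ Fintype.card ι = N ∧
    ∑ i, charMonomial (d i + (m, 0, 0)) = p

theorem hasHomogeneousSpan_one {m : ℤ} (h : Submodule.span k {gen k m} = ⊤) :
    HasHomogeneousSpan k m 1 (LaurentPolynomial.T m) := by
  refine ⟨Unit, inferInstance, fun _ => 1, fun _ => 0, fun _ => .one, ?_, rfl, ?_⟩
  · simpa using h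
  · simp [charMonomial]

/-- A filtration of the local module of weight `mω` by cyclic submodules whose subquotients satisfy
the relations of shifted local modules gives a spanning family. -/
theorem HasHomogeneousSpan.of_filtration {m : ℤ} {M S : Fin 4 → ℤ} {N : Fin 4 → ℕ}
    {p : Fin 4 → LaurentPolynomial Kqt} (h : ∀ i, HasHomogeneousSpan k (M i) (N i) (p i))
    {g : Fin 4 → U k} {e : Fin 4 → ℤ × ℕ × ℕ} (hg : ∀ i, IsHomU (e i) (g i)) (hg0 : g 0 = 1)
    (h0 : IsShiftedGen (k := k) (M 0) (S 0) (Submodule.span (U k) {g 1 • gen k m}) (g 0 • gen k m))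
    (h1 : IsShiftedGen (k := k) (M 1) (S 1) (Submodule.span (U k) {g 2 • gen k m}) (g 1 • gen k m))
    (h2 : IsShiftedGen (k := k) (M 2) (S 2) (Submodule.span (U k) {g 3 • gen k m}) (g 2 • gen k m))
    (h3 : IsShiftedGen (k := k) (M 3) (S 3) ⊥ (g 3 • gen k m)) :
    HasHomogeneousSpan k m (∑ i, N i)
      (∑ i, charMonomial (e i + (m - M i, 0, 0)) * p i) := by
  choose ι hι u d hu hs hN hp using h
  let F : (Σ i, ι i) → U k := fun x => twist (-(S x.1 : k)) (u x.1 x.2) * g x.1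
  refine ⟨Σ i, ι i, inferInstance, F, fun x => d x.1 x.2 + e x.1,
    fun x => ((hu _ _).twist _).mul (hg _), ?_, ?_, ?_⟩
  · set W := Submodule.span k (Set.range fun x => F x • gen k m) with hW
    have hmem : ∀ i j, twist (-(S i : k)) (u i j) • g i • gen k m ∈ W := fun i j => by
      rw [smul_smul]
      exact Submodule.subset_span ⟨⟨i, j⟩, rfl⟩
    -- The filtration is climbed from its smallest member: a cyclic submodule lies in `W` once the
    -- next smaller one does.
    have k3 := h3.mem_of_span (hs 3) (W := W)
      (fun y hy => by rw [(Submodule.mem_bot _).1 hy]; exact zero_mem _) (hmem 3)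
    have k2 := h2.mem_of_span (hs 2) k3 (hmem 2)
    have k1 := h1.mem_of_span (hs 1) k2 (hmem 1)
    have k0 := h0.mem_of_span (hs 0) k1 (hmem 0)
    rw [hg0, one_smul, span_gen] at k0
    exact eq_top_iff.2 fun y _ => k0 y trivial
  · rw [Fintype.card_sigma]
    exact Finset.sum_congr rfl fun i _ => hN i
  · rw [Fintype.sum_sigma]
    refine Finset.sum_congr rfl fun i _ => ?_
    rw [← hp, Finset.mul_sum]
    refine Finset.sum_congr rfl fun j _ => ?_
    rw [← charMonomial_add]
    congr 1
    ext <;> simp <;> ring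

theorem lowChain_gen [CharZero k] (n : ℕ) :
    let w := filtVec k (-((n : ℤ) + 1)) (eZ k 0) (fZ k 0) (n + 1)
    let D := filt k (-((n : ℤ) + 1)) (eZ k 0) (fZ k 0) (n + 1)
    IsShiftedGen (k := k) (-(n : ℤ)) (-1) (D 1) (w 0) ∧
    IsShiftedGen (k := k) ((n : ℤ) + 1) 0 (D 2) (w 1) ∧
    IsShiftedGen (k := k) ((n : ℤ) + 1) 0 (D 3) (w 2) ∧
    IsShiftedGen (k := k) (-(n : ℤ)) (-1) ⊥ (w 3) := by
  refine lowChain ?_ weight_smul_gen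
  have h := isLow_gen (k := k) (n + 1)
  rwa [Nat.cast_succ] at h

theorem highChain_gen [CharZero k] (n : ℕ) :
    let w := filtVec k ((n : ℤ) + 2) (fZ k 0) (eZ k 0) (n + 1)
    let D := filt k ((n : ℤ) + 2) (fZ k 0) (eZ k 0) (n + 1)
    IsShiftedGen (k := k) ((n : ℤ) + 1) 1 (D 1) (w 0) ∧
    IsShiftedGen (k := k) (-(n : ℤ)) 0 (D 2) (w 1) ∧
    IsShiftedGen (k := k) (-(n : ℤ)) 0 (D 3) (w 2) ∧
    IsShiftedGen (k := k) ((n : ℤ) + 1) 1 ⊥ (w 3) := by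
  refine highChain ?_ weight_smul_gen
  have h := isLow_swap_gen (k := k) (n + 1)
  rwa [Nat.cast_succ, add_assoc, one_add_one_eq_two] at h

/-- The elements of `U(𝕴[ξ])` that produce the vectors of `filtVec`. -/
def filtElt (a b : iwahori k) (r : ℕ) : Fin 4 → U k :=
  ![1, ev k a ^ r, od k (hZ k 0) * ev k a ^ r, ev k b ^ r * (od k (hZ k 0) * ev k a ^ r)]

theorem filtElt_smul_gen (m : ℤ) (a b : iwahori k) (r : ℕ) (i : Fin 4) :
    filtElt a b r i • gen k m = filtVec k m a b r i := by
  fin_cases i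
  · exact one_smul _ _
  · rfl
  · exact mul_smul _ _ _
  · exact (mul_smul _ _ _).trans (congrArg _ (mul_smul _ _ _))

/-- The degrees of the elements of `filtElt`. -/
def filtDeg (da db : ℤ × ℕ × ℕ) (r : ℕ) : Fin 4 → ℤ × ℕ × ℕ :=
  ![0, r • da, (0, 0, 1) + r • da, r • db + ((0, 0, 1) + r • da)]

theorem isHomU_filtElt {a b : iwahori k} {da db : ℤ × ℕ × ℕ} (ha : IsHomU da (ev k a))
    (hb : IsHomU db (ev k b)) (r : ℕ) (i : Fin 4) :
    IsHomU (filtDeg da db r i) (filtElt a b r i) := by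
  fin_cases i
  · exact .one
  · exact ha.pow r
  · exact IsHomU.hZ_zero.mul (ha.pow r)
  · exact (hb.pow r).mul (IsHomU.hZ_zero.mul (ha.pow r))

theorem HasHomogeneousSpan.of_filt [CharZero k] {n : ℕ} {m : ℤ} {a b : iwahori k} (M S : Fin 4 → ℤ)
    {p : Fin 4 → LaurentPolynomial Kqt} {da db : ℤ × ℕ × ℕ} (c : Fin 4 → ℤ × ℕ × ℕ)
    (h : ∀ i, HasHomogeneousSpan k (M i) (4 ^ n) (p i))
    (ha : IsHomU da (ev k a)) (hb : IsHomU db (ev k b))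
    (hc : ∀ i, filtDeg da db (n + 1) i + (m - M i, 0, 0) = c i)
    (h0 : IsShiftedGen (k := k) (M 0) (S 0) (filt k m a b (n + 1) 1) (filtVec k m a b (n + 1) 0))
    (h1 : IsShiftedGen (k := k) (M 1) (S 1) (filt k m a b (n + 1) 2) (filtVec k m a b (n + 1) 1))
    (h2 : IsShiftedGen (k := k) (M 2) (S 2) (filt k m a b (n + 1) 3) (filtVec k m a b (n + 1) 2))
    (h3 : IsShiftedGen (k := k) (M 3) (S 3) ⊥ (filtVec k m a b (n + 1) 3)) :
    HasHomogeneousSpan k m (4 ^ (n + 1)) (∑ i, charMonomial (c i) * p i) := by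
  have hN : (4 : ℕ) ^ (n + 1) = ∑ _i : Fin 4, 4 ^ n := by simp [pow_succ']
  simp only [filt, ← filtElt_smul_gen] at h0 h1 h2 h3
  simp only [hN, ← hc]
  exact .of_filtration h (isHomU_filtElt ha hb (n + 1)) rfl h0 h1 h2 h3

-- Both weights are carried through the induction because each new module is filtered by shifts of
-- both old ones.
variable (k) in
theorem hasHomogeneousSpan [CharZero k] (n : ℕ) :
    HasHomogeneousSpan k (-(n : ℤ)) (4 ^ n) (macPair n).1 ∧
    HasHomogeneousSpan k ((n : ℤ) + 1) (4 ^ n) (macPair n).2 := by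
  induction n with
  | zero => exact ⟨hasHomogeneousSpan_one span_gen_zero, hasHomogeneousSpan_one span_gen_one⟩
  | succ n ih =>
    obtain ⟨ih₁, ih₂⟩ := ih
    constructor
    · obtain ⟨h0, h1, h2, h3⟩ := lowChain_gen (k := k) n
      -- The triples are the shifts of weight, `z`-degree and `ξ`-degree of the four subquotients.
      -- Each `ξ`-shift contributes `-t`, so the four terms combine into the recursion of `macPair`.
      have h := HasHomogeneousSpan.of_filt ![-(n : ℤ), (n : ℤ) + 1, (n : ℤ) + 1, -(n : ℤ)]
        ![-1, 0, 0, -1] ![(-1, 0, 0), (0, 0, 0), (0, 0, 1), (-1, n + 1, 1)]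
        (p := ![(macPair n).1, (macPair n).2, (macPair n).2, (macPair n).1])
        (fun i => by fin_cases i; exacts [ih₁, ih₂, ih₂, ih₁]) .eZ_zero .fZ_zero
        (fun i => by fin_cases i <;> ext <;> simp [filtDeg] <;> ring) h0 h1 h2 h3
      rw [Nat.cast_succ]
      convert h using 1
      simp only [macPair, Fin.sum_univ_four, charMonomial, Matrix.cons_val]
      simp only [pow_zero, pow_one, one_mul, one_smul, LaurentPolynomial.T_zero, smul_mul_assoc]
      module
    · obtain ⟨h0, h1, h2, h3⟩ := highChain_gen (k := k) n
      have h := HasHomogeneousSpan.of_filt ![(n : ℤ) + 1, -(n : ℤ), -(n : ℤ), (n : ℤ) + 1]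
        ![1, 0, 0, 1] ![(1, 0, 0), (0, n + 1, 0), (0, n + 1, 1), (1, n + 1, 1)]
        (p := ![(macPair n).2, (macPair n).1, (macPair n).1, (macPair n).2])
        (fun i => by fin_cases i; exacts [ih₂, ih₁, ih₁, ih₂]) .fZ_zero .eZ_zero
        (fun i => by fin_cases i <;> ext <;> simp [filtDeg] <;> ring) h0 h1 h2 h3
      rw [Nat.cast_succ, add_assoc, one_add_one_eq_two]
      convert h using 1
      simp only [macPair, Fin.sum_univ_four, charMonomial, Matrix.cons_val]
      simp only [pow_zero, pow_one, one_mul, one_smul, LaurentPolynomial.T_zero, smul_mul_assoc]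
      module

end SpanningFamilies

/-! ### Dimensions and supercharacters -/

section Dimensions

variable {k : Type*} [Field k]

theorem HasHomogeneousSpan.finite {m : ℤ} {N : ℕ} {p : LaurentPolynomial Kqt}
    (h : HasHomogeneousSpan k m N p) : Module.Finite k (EMloc k m) := by
  obtain ⟨ι, _, u, d, -, hs, -⟩ := h
  exact ⟨hs ▸ Submodule.fg_span (Set.finite_range _)⟩

theorem HasHomogeneousSpan.finrank_le {m : ℤ} {N : ℕ} {p : LaurentPolynomial Kqt}
    (h : HasHomogeneousSpan k m N p) : Module.finrank k (EMloc k m) ≤ N := by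
  obtain ⟨ι, _, u, d, -, hs, hN, -⟩ := h
  rw [← hN, ← finrank_top k (EMloc k m), ← hs]
  exact finrank_range_le_card _

variable [CharZero k]

theorem HasHomogeneousSpan.isInternal {m : ℤ} {N : ℕ} {p : LaurentPolynomial Kqt}
    (h : HasHomogeneousSpan k m N p) : DirectSum.IsInternal (pieceEM k m) := by
  obtain ⟨ι, _, u, d, hu, hs, -⟩ := h
  refine DirectSum.isInternal_submodule_of_iSupIndep_of_iSup_eq_top iSupIndep_pieceEM ?_
  rw [eq_top_iff, ← hs, Submodule.span_le]
  rintro _ ⟨i, rfl⟩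
  exact Submodule.mem_iSup_of_mem _ (hu i).smul_gen_mem

/-- A spanning family of the right cardinality is a basis. As it is homogeneous, its members of a
given degree form a basis of that piece, and the dimensions are obtained by counting. -/
theorem HasHomogeneousSpan.gch_eq {m : ℤ} {N : ℕ} {p : LaurentPolynomial Kqt}
    (h : HasHomogeneousSpan k m N p) (hN : Module.finrank k (EMloc k m) = N) : gch k m = p := by
  classical
  have hint := h.isInternal
  obtain ⟨π, hπ, hπ'⟩ := exists_projections hint.submodule_iSupIndep hint.submodule_iSup_eq_top
  obtain ⟨ι, _, u, d, hu, hs, hι, rfl⟩ := h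
  set v : ι → EMloc k m := fun i => u i • gen k m
  set e : ι → ℤ × ℕ × ℕ := fun i => d i + (m, 0, 0)
  have hv : ∀ i, v i ∈ pieceEM k m (e i) := fun i => (hu i).smul_gen_mem
  have hli : LinearIndependent k v :=
    linearIndependent_of_top_le_span_of_card_eq_finrank hs.ge (hι.trans hN.symm)
  have hpiece : ∀ D, pieceEM k m D
      = Submodule.span k (Set.range fun i : {i // e i = D} => v i) := by
    intro D
    apply le_antisymm
    · intro y hy
      have hy' : y ∈ Submodule.span k (Set.range v) := hs ▸ Submodule.mem_top
      obtain ⟨c, hc⟩ := (Submodule.mem_span_range_iff_exists_fun k).1 hy'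
      rw [← hπ D y hy, ← hc, map_sum]
      refine Submodule.sum_mem _ fun i _ => ?_
      rw [map_smul]
      refine Submodule.smul_mem _ _ ?_
      by_cases hi : e i = D
      · rw [hπ D _ (hi ▸ hv i)]
        exact Submodule.subset_span ⟨⟨i, hi⟩, rfl⟩
      · rw [hπ' D (e i) _ (hv i) hi]
        exact zero_mem _
    · rw [Submodule.span_le]
      rintro _ ⟨⟨i, rfl⟩, rfl⟩
      exact hv i
  have hfin : ∀ D, Module.finrank k (pieceEM k m D)
      = (Finset.univ.filter fun i => e i = D).card := by
    intro D
    have hD : LinearIndependent k fun i : {i // e i = D} => v i :=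
      hli.comp _ Subtype.val_injective
    rw [hpiece, finrank_span_eq_card hD, Fintype.card_subtype]
  have hterm : ∀ D : ℤ × ℕ × ℕ,
      ((Module.finrank k (pieceEM k m D) : Kqt) * qq ^ D.2.1 * (-tt) ^ D.2.2) •
        (LaurentPolynomial.T D.1 : LaurentPolynomial Kqt)
      = (Finset.univ.filter fun i => e i = D).card • charMonomial D := by
    intro D
    rw [hfin, charMonomial, mul_assoc, mul_smul, Nat.cast_smul_eq_nsmul]
  rw [Finset.sum_comp charMonomial e, gch, finsum_congr hterm]
  refine finsum_eq_sum_of_support_subset _ fun D hD => ?_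
  rw [Function.mem_support] at hD
  have hne : (Finset.univ.filter fun i => e i = D).card ≠ 0 := fun h0 => hD (by rw [h0, zero_smul])
  obtain ⟨i, hi⟩ := Finset.card_ne_zero.1 hne
  exact Finset.mem_coe.2 (Finset.mem_image.2 ⟨i, Finset.mem_univ i, (Finset.mem_filter.1 hi).2⟩)

variable (k)

theorem finrank_neg (n : ℕ) : Module.finrank k (EMloc k (-(n : ℤ))) = 4 ^ n := by
  obtain ⟨ι, _, u, d, hu, hs, hN, -⟩ := (hasHomogeneousSpan k n).1
  exact finrank_EMloc_neg (fun i => (hu i).mem) hs hN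

theorem finrank_pos (n : ℕ) : Module.finrank k (EMloc k ((n : ℤ) + 1)) = 4 ^ n := by
  have h := (hasHomogeneousSpan k n).2
  have := h.finite
  exact le_antisymm h.finrank_le (finrank_neg k n ▸ finrank_neg_le_finrank_pos n)

theorem finite_EMloc (m : ℤ) : Module.Finite k (EMloc k m) := by
  rcases neg_or_succ m with ⟨n, rfl⟩ | ⟨n, rfl⟩
  exacts [(hasHomogeneousSpan k n).1.finite, (hasHomogeneousSpan k n).2.finite]

theorem isInternal_pieceEM (m : ℤ) : DirectSum.IsInternal (pieceEM k m) := by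
  rcases neg_or_succ m with ⟨n, rfl⟩ | ⟨n, rfl⟩
  exacts [(hasHomogeneousSpan k n).1.isInternal, (hasHomogeneousSpan k n).2.isInternal]

theorem gch_eq_mac (m : ℤ) : gch k m = mac m := by
  rcases neg_or_succ m with ⟨n, rfl⟩ | ⟨n, rfl⟩
  · rw [mac_neg, (hasHomogeneousSpan k n).1.gch_eq (finrank_neg k n)]
  · rw [mac_pos, (hasHomogeneousSpan k n).2.gch_eq (finrank_pos k n)]

end Dimensions

/-! ### Identification of the subquotients -/

section Subquotients

variable {k : Type*} [Field k]

theorem twist_neg_twist (s : k) (u : U k) : twist (-s) (twist s u) = u := by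
  simpa using twist_twist (-s) u

/-- The map from a local module to a cyclic module whose generator satisfies the relations of a
shifted local module. -/
theorem IsShiftedGen.exists_map {m s : ℤ} {V : Type*} [AddCommGroup V] [Module (U k) V]
    [Module k V] [IsScalarTower k (U k) V] {v : V} (h : IsShiftedGen (k := k) m s ⊥ v) :
    ∃ φ : EMloc k m →ₗ[k] V, ∀ u, φ (u • gen k m) = twist (-(s : k)) u • v := by
  let g : U k →ₗ[k] V :=
    (LinearMap.toSpanSingleton (U k) V v).restrictScalars k ∘ₗ (twist (-(s : k))).toLinearMap
  have hg : ∀ u, g u = twist (-(s : k)) u • v := fun _ => rfl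
  refine ⟨liftEM g ?_, fun u => liftEM_smul_gen _ _ u⟩
  intro u r hr
  rw [hg, map_mul, mul_smul, (Submodule.mem_bot _).1 (h r hr), smul_zero]

section

variable {m s : ℤ} {V : Type*} [AddCommGroup V] [Module (U k) V] [Module k V]
  {v : V} {φ : EMloc k m →ₗ[k] V}

theorem ev_smul_map [IsScalarTower k (U k) V] (hφ : ∀ u, φ (u • gen k m) = twist (-(s : k)) u • v)
    (x : iwahori k) (y : EMloc k m) :
    ev k x • φ y = φ (ev k x • y) + ((s : k) * hCoeff k x) • φ y := by
  obtain ⟨u, rfl⟩ := exists_smul_gen y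
  rw [smul_smul (ev k x), hφ, hφ, map_mul, twist_ev, smul_smul (ev k x), neg_mul, map_neg,
    ← sub_eq_add_neg, sub_mul, sub_smul, mul_smul (algebraMap k (U k) _), algebraMap_smul_U,
    sub_add_cancel]

theorem od_smul_map (hφ : ∀ u, φ (u • gen k m) = twist (-(s : k)) u • v) (x : iwahori k)
    (y : EMloc k m) : od k x • φ y = φ (od k x • y) := by
  obtain ⟨u, rfl⟩ := exists_smul_gen y
  rw [smul_smul (od k x), hφ, hφ, map_mul, twist_od, smul_smul (od k x)]

end

theorem finrank_subquotient {V : Type*} [AddCommGroup V] [Module (U k) V]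
    [Module k V] [IsScalarTower k (U k) V] [Module.Finite k V] {P Q : Submodule (U k) V}
    (h : Q ≤ P) :
    Module.finrank k (P ⧸ Q.submoduleOf P) + Module.finrank k Q = Module.finrank k P := by
  have hP : Module.Finite k P := inferInstanceAs (Module.Finite k (P.restrictScalars k))
  have h1 := Submodule.finrank_quotient_add_finrank ((Q.submoduleOf P).restrictScalars k)
  have e1 := (Submodule.Quotient.restrictScalarsEquiv k (Q.submoduleOf P)).finrank_eq
  have e2 := ((Submodule.submoduleOfEquivOfLe h).restrictScalars k).finrank_eq
  rw [← h1, ← e1, ← e2]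
  rfl

section

variable {m m' s : ℤ} {Q : Submodule (U k) (EMloc k m')} {v : EMloc k m'}

theorem IsShiftedGen.exists_surjective (h : IsShiftedGen m s Q v)
    {P : Submodule (U k) (EMloc k m')} (hP : P = Submodule.span (U k) {v}) (hv : v ∈ P) :
    ∃ φ : EMloc k m →ₗ[k] P ⧸ Q.submoduleOf P, Function.Surjective φ ∧
      ∀ u, φ (u • gen k m) = twist (-(s : k)) u • Submodule.Quotient.mk ⟨v, hv⟩ := by
  have h' : IsShiftedGen (k := k) m s (⊥ : Submodule (U k) (P ⧸ Q.submoduleOf P))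
      (Submodule.Quotient.mk ⟨v, hv⟩) := fun r hr => by
    rw [Submodule.mem_bot, ← Submodule.Quotient.mk_smul, Submodule.Quotient.mk_eq_zero]
    exact h r hr
  obtain ⟨φ, hφ⟩ := h'.exists_map
  refine ⟨φ, fun y => ?_, hφ⟩
  obtain ⟨⟨y, hy⟩, rfl⟩ := Submodule.Quotient.mk_surjective _ y
  have hy' := hy
  rw [hP] at hy'
  obtain ⟨x, rfl⟩ := Submodule.mem_span_singleton.1 hy'
  refine ⟨twist (s : k) x • gen k m, ?_⟩
  rw [hφ, twist_neg_twist (s : k) x]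
  rfl

/-- Discarding the other components of `x` does not change a homogeneous `x • v`. This shows that
graded components map onto graded components, not merely into them. -/
theorem exists_homogeneous_smul [CharZero k] {A B : ℕ} (hv : v ∈ gradedEM k m' A B) {a b : ℕ}
    {x : U k} (hx : x • v ∈ gradedEM k m' (a + A) (b + B)) :
    ∃ x₀ ∈ gradedU k a b, x • v = x₀ • v := by
  obtain ⟨π, hπ, hπ'⟩ := exists_projections (iSupIndep_gradedEM (k := k) (m := m')) iSup_gradedEM
  obtain ⟨g, hg, rfl⟩ := mem_gradedEM_iff.1 hv
  suffices H : ∀ x : U k, ∃ x₀ ∈ gradedU k a b,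
      π (a + A, b + B) (x • g • gen k m') = x₀ • g • gen k m' by
    rw [← hπ (a + A, b + B) _ hx]
    exact H x
  intro x
  have hx : x ∈ ⨆ d : ℕ × ℕ, gradedU k d.1 d.2 := iSup_gradedU (k := k) ▸ Submodule.mem_top
  induction hx using Submodule.iSup_induction' with
  | mem d y hy =>
    have hmem : y • g • gen k m' ∈ gradedEM k m' (d.1 + A) (d.2 + B) :=
      mem_gradedEM_iff.2 ⟨y * g, mul_mem_gradedU hy hg, (mul_smul _ _ _).symm⟩
    by_cases hd : d = (a, b)
    · subst hd
      exact ⟨y, hy, hπ (_, _) _ hmem⟩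
    · refine ⟨0, zero_mem _, ?_⟩
      rw [zero_smul, hπ' _ (d.1 + A, d.2 + B) _ hmem]
      rintro hd'
      rw [Prod.mk.injEq] at hd'
      exact hd (Prod.ext (by omega) (by omega))
  | zero => exact ⟨0, zero_mem _, by rw [zero_smul, map_zero]⟩
  | add y y' _ _ h h' =>
    obtain ⟨z, hz, e⟩ := h
    obtain ⟨z', hz', e'⟩ := h'
    exact ⟨z + z', add_mem hz hz', by rw [add_smul, map_add, e, e', add_smul]⟩

theorem IsShiftedGen.isShiftedEM [CharZero k] (h : IsShiftedGen m s Q v)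
    {P : Submodule (U k) (EMloc k m')} (hP : P = Submodule.span (U k) {v}) {A B : ℕ}
    (hvg : v ∈ gradedEM k m' A B)
    (hd : Module.finrank k (P ⧸ Q.submoduleOf P) = Module.finrank k (EMloc k m)) :
    IsShiftedEM m s A B P Q v := by
  have := finite_EMloc k m
  have hv : v ∈ P := hP ▸ Submodule.mem_span_singleton_self v
  obtain ⟨φ, hs, hφ⟩ := h.exists_surjective hP hv
  have := Module.Finite.of_surjective φ hs
  obtain ⟨e, he⟩ : ∃ e : EMloc k m ≃ₗ[k] P ⧸ Q.submoduleOf P, e.toLinearMap = φ :=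
    ⟨LinearEquiv.ofBijective φ
      ⟨(LinearMap.injective_iff_surjective_of_finrank_eq_finrank hd.symm).2 hs, hs⟩, rfl⟩
  subst he
  refine ⟨e, ⟨hv, ?_⟩, ev_smul_map hφ, od_smul_map hφ, ?_⟩
  · have h1 := hφ 1
    rwa [one_smul, map_one, one_smul] at h1
  · intro a b
    apply le_antisymm
    · rintro _ ⟨y, hy, rfl⟩
      obtain ⟨u, hu, rfl⟩ := mem_gradedEM_iff.1 hy
      obtain ⟨g, hg, rfl⟩ := mem_gradedEM_iff.1 hvg
      have hmem : twist (-(s : k)) u • g • gen k m' ∈ gradedEM k m' (a + A) (b + B) :=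
        mem_gradedEM_iff.2 ⟨_, mul_mem_gradedU (twist_mem_gradedU _ hu) hg, (mul_smul _ _ _).symm⟩
      exact ⟨⟨twist (-(s : k)) u • g • gen k m', P.smul_mem _ hv⟩, hmem, (hφ u).symm⟩
    · rintro _ ⟨⟨y, hy⟩, hy', rfl⟩
      have hyP := hy
      rw [hP] at hyP
      obtain ⟨x, rfl⟩ := Submodule.mem_span_singleton.1 hyP
      have hmem : x • v ∈ gradedEM k m' (a + A) (b + B) := hy'
      obtain ⟨x₀, hx₀, h₀⟩ := exists_homogeneous_smul hvg hmem
      have h₁ : (⟨x • v, hy⟩ : P) = x₀ • ⟨v, hv⟩ := Subtype.ext h₀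
      refine ⟨twist (s : k) x₀ • gen k m, mem_gradedEM_iff.2 ⟨_, twist_mem_gradedU _ hx₀, rfl⟩, ?_⟩
      have h₂ := congrArg (fun u : U k => u • (Submodule.Quotient.mk ⟨v, hv⟩ : P ⧸ Q.submoduleOf P))
        (twist_neg_twist (s : k) x₀)
      exact ((hφ _).trans h₂).trans (congrArg (Q.submoduleOf P).mkQ h₁.symm)

end

variable [CharZero k]

/-- Each of the four subquotients is the image of a module of dimension `4 ^ n`, while their
dimensions add up to `4 ^ (n + 1)`. All four bounds are therefore equalities and the surjections are
bijective. -/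
theorem isShiftedEM_filt {n : ℕ} {m : ℤ} {a b : iwahori k} (M S : Fin 4 → ℤ) (A B : Fin 4 → ℕ)
    (hM : ∀ i, Module.finrank k (EMloc k (M i)) = 4 ^ n)
    (hm : Module.finrank k (EMloc k m) = 4 ^ (n + 1))
    (hg : ∀ i, filtElt a b (n + 1) i ∈ gradedU k (A i) (B i))
    (h : let w := filtVec k m a b (n + 1)
      let D := filt k m a b (n + 1)
      IsShiftedGen (k := k) (M 0) (S 0) (D 1) (w 0) ∧
      IsShiftedGen (k := k) (M 1) (S 1) (D 2) (w 1) ∧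
      IsShiftedGen (k := k) (M 2) (S 2) (D 3) (w 2) ∧
      IsShiftedGen (k := k) (M 3) (S 3) ⊥ (w 3)) :
    let w := filtVec k m a b (n + 1)
    let D := filt k m a b (n + 1)
    D 0 = ⊤ ∧ D 1 ≤ D 0 ∧ D 2 ≤ D 1 ∧ D 3 ≤ D 2 ∧
    IsShiftedEM (M 0) (S 0) (A 0) (B 0) (D 0) (D 1) (w 0) ∧
    IsShiftedEM (M 1) (S 1) (A 1) (B 1) (D 1) (D 2) (w 1) ∧
    IsShiftedEM (M 2) (S 2) (A 2) (B 2) (D 2) (D 3) (w 2) ∧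
    IsShiftedEM (M 3) (S 3) (A 3) (B 3) (D 3) ⊥ (w 3) := by
  intro w D
  obtain ⟨h0, h1, h2, h3⟩ := h
  have := finite_EMloc k m
  have hw : ∀ i, w i ∈ gradedEM k m (A i) (B i) := fun i =>
    mem_gradedEM_iff.2 ⟨_, hg i, (filtElt_smul_gen m a b (n + 1) i).symm⟩
  have hmem : ∀ i, w i ∈ D i := fun i => Submodule.mem_span_singleton_self _
  have hD0 : D 0 = ⊤ := span_gen
  have hle : ∀ {i j : Fin 4} {x : U k}, w j = x • w i → D j ≤ D i := fun {i j x} e => by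
    refine (Submodule.span_singleton_le_iff_mem _ _).2 ?_
    change w j ∈ D i
    rw [e]
    exact Submodule.smul_mem _ _ (hmem i)
  have hD1 : D 1 ≤ D 0 := hle (x := ev k a ^ (n + 1)) rfl
  have hD2 : D 2 ≤ D 1 := hle (x := od k (hZ k 0)) rfl
  have hD3 : D 3 ≤ D 2 := hle (x := ev k b ^ (n + 1)) rfl
  have hb : ∀ {i : Fin 4} {Q : Submodule (U k) (EMloc k m)}, IsShiftedGen (M i) (S i) Q (w i) →
      Module.finrank k (D i ⧸ Q.submoduleOf (D i)) ≤ 4 ^ n := fun {i Q} hi => by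
    have := finite_EMloc k (M i)
    obtain ⟨φ, hs, -⟩ := hi.exists_surjective (P := D i) rfl (hmem i)
    exact (LinearMap.finrank_le_finrank_of_surjective hs).trans (hM i).le
  have f0 := finrank_subquotient hD1
  have f1 := finrank_subquotient hD2
  have f2 := finrank_subquotient hD3
  have f3 := finrank_subquotient (bot_le : ⊥ ≤ D 3)
  have hbot : Module.finrank k (⊥ : Submodule (U k) (EMloc k m)) = 0 :=
    Module.finrank_zero_of_subsingleton
  have htop : Module.finrank k (D 0) = 4 ^ (n + 1) := by
    rw [hD0, ← hm]
    exact (Submodule.topEquiv.restrictScalars k).finrank_eq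
  rw [pow_succ] at htop
  have b0 : Module.finrank k (D 0 ⧸ (D 1).submoduleOf (D 0)) ≤ 4 ^ n := hb h0
  have b1 : Module.finrank k (D 1 ⧸ (D 2).submoduleOf (D 1)) ≤ 4 ^ n := hb h1
  have b2 : Module.finrank k (D 2 ⧸ (D 3).submoduleOf (D 2)) ≤ 4 ^ n := hb h2
  have b3 : Module.finrank k (D 3 ⧸ (⊥ : Submodule (U k) _).submoduleOf (D 3)) ≤ 4 ^ n := hb h3
  have d0 : Module.finrank k (D 0 ⧸ (D 1).submoduleOf (D 0)) = 4 ^ n := by omega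
  have d1 : Module.finrank k (D 1 ⧸ (D 2).submoduleOf (D 1)) = 4 ^ n := by omega
  have d2 : Module.finrank k (D 2 ⧸ (D 3).submoduleOf (D 2)) = 4 ^ n := by omega
  have d3 : Module.finrank k (D 3 ⧸ (⊥ : Submodule (U k) _).submoduleOf (D 3)) = 4 ^ n := by omega
  exact ⟨hD0, hD1, hD2, hD3,
    h0.isShiftedEM rfl (hw 0) (d0.trans (hM 0).symm),
    h1.isShiftedEM rfl (hw 1) (d1.trans (hM 1).symm),
    h2.isShiftedEM rfl (hw 2) (d2.trans (hM 2).symm),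
    h3.isShiftedEM rfl (hw 3) (d3.trans (hM 3).symm)⟩

end Subquotients

end MacdonaldSL2

end

/-! ### Assembly of the theorem -/

theorem mainTheorem7 (k : Type*) [Field k] [CharZero k] :
    (∀ m : ℤ,
      DirectSum.IsInternal (pieceEM k m) ∧
      (∃! E, IsNonsymMacdonald m E) ∧
      ∀ E, IsNonsymMacdonald m E → gch k m = integralForm m E) ∧
    (∀ n : ℕ,
      Module.finrank k (EMloc k (-(n : ℤ))) = 4 ^ n ∧
      Module.finrank k (EMloc k ((n : ℤ) + 1)) = 4 ^ n) ∧
    (∀ n : ℕ,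
      let w := filtVec k (-((n : ℤ) + 1)) (eZ k 0) (fZ k 0) (n + 1)
      let D := filt k (-((n : ℤ) + 1)) (eZ k 0) (fZ k 0) (n + 1)
      D 0 = ⊤ ∧ D 1 ≤ D 0 ∧ D 2 ≤ D 1 ∧ D 3 ≤ D 2 ∧
      IsShiftedEM (-(n : ℤ)) (-1) 0 0 (D 0) (D 1) (w 0) ∧
      IsShiftedEM ((n : ℤ) + 1) 0 0 0 (D 1) (D 2) (w 1) ∧
      IsShiftedEM ((n : ℤ) + 1) 0 0 1 (D 2) (D 3) (w 2) ∧
      IsShiftedEM (-(n : ℤ)) (-1) (n + 1) 1 (D 3) ⊥ (w 3)) ∧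
    (∀ n : ℕ,
      let w := filtVec k ((n : ℤ) + 2) (fZ k 0) (eZ k 0) (n + 1)
      let D := filt k ((n : ℤ) + 2) (fZ k 0) (eZ k 0) (n + 1)
      D 0 = ⊤ ∧ D 1 ≤ D 0 ∧ D 2 ≤ D 1 ∧ D 3 ≤ D 2 ∧
      IsShiftedEM ((n : ℤ) + 1) 1 0 0 (D 0) (D 1) (w 0) ∧
      IsShiftedEM (-(n : ℤ)) 0 (n + 1) 0 (D 1) (D 2) (w 1) ∧
      IsShiftedEM (-(n : ℤ)) 0 (n + 1) 1 (D 2) (D 3) (w 2) ∧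
      IsShiftedEM ((n : ℤ) + 1) 1 (n + 1) 1 (D 3) ⊥ (w 3)) := by
  refine ⟨fun m => ⟨isInternal_pieceEM k m, existsUnique_isNonsymMacdonald m, fun E hE => ?_⟩,
    fun n => ⟨finrank_neg k n, finrank_pos k n⟩, fun n => ?_, fun n => ?_⟩
  · rw [gch_eq_mac, hE.integralForm_eq]
  · have hdeg := isHomU_filtElt (k := k) .eZ_zero .fZ_zero (n + 1)
    have hm := finrank_neg k (n + 1)
    rw [Nat.cast_succ] at hm
    refine isShiftedEM_filt ![-(n : ℤ), (n : ℤ) + 1, (n : ℤ) + 1, -(n : ℤ)] ![-1, 0, 0, -1]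
      ![0, 0, 0, n + 1] ![0, 0, 1, 1] (fun i => ?_) hm (fun i => ?_) (lowChain_gen n)
    · fin_cases i
      exacts [finrank_neg k n, finrank_pos k n, finrank_pos k n, finrank_neg k n]
    · have h := (hdeg i).mem
      fin_cases i <;> simpa [filtDeg] using h
  · have hdeg := isHomU_filtElt (k := k) .fZ_zero .eZ_zero (n + 1)
    have hm := finrank_pos k (n + 1)
    rw [Nat.cast_succ, add_assoc, one_add_one_eq_two] at hm
    refine isShiftedEM_filt ![(n : ℤ) + 1, -(n : ℤ), -(n : ℤ), (n : ℤ) + 1] ![1, 0, 0, 1]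
      ![0, n + 1, n + 1, n + 1] ![0, 0, 1, 1] (fun i => ?_) hm (fun i => ?_) (highChain_gen n)
    · fin_cases i
      exacts [finrank_pos k n, finrank_neg k n, finrank_neg k n, finrank_pos k n]
    · have h := (hdeg i).mem
      fin_cases i <;> simpa [filtDeg] using h
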